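/- Let $F$ be a totally real number field, $K/F$ a totally imaginary quadratic extension, $\mathfrak p$ a finite prime of $F$ with completion $F_{\mathfrak p}$ and uniformizer $\varpi$, and $B$ a totally definite quaternion algebra over $F$ with a fixed isomorphism $\iota: B_{\mathfrak p}\cong M_2(F_{\mathfrak p})$. Let $R\subset B$ be an $\mathcal O_F[1/\mathfrak p]$-order (for instance an Eichler order), let $Z$ be the maximal $\mathcal O_F[1/\mathfrak p]$-order of $K$, and let $\Psi:K\to B$ be an optimal embedding, i.e. an $F$-algebra homomorphism with $\Psi(K)\cap R=\Psi(Z)$. Let $\mathcal O$ be a commutative ring (for instance the ring of integers of a finite extension of $\mathbf Q_p$). *Forms.* For $C\subset GL_2(F_{\mathfrak p})$ let $H_C=C\times\prod_{v\neq\mathfrak p}R_v^\times\subset\widehat B^\times$. A form of level $H_C$ is a function $\Phi:\widehat B^\times\to\mathcal O$ with $\Phi(\gamma bhz)=\Phi(b)$ for $\gamma\in B^\times$, $h\in H_C$, $z\in\widehat F^\times$. Let $I_{\mathfrak p}\subset GL_2(\mathcal O_{F_{\mathfrak p}})$ be the Iwahori subgroup (lower left entry in the maximal ideal). On forms of level $H_{GL_2(\mathcal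 O_{F_{\mathfrak p}})}$ (resp. $H_{I_{\mathfrak p}}$) put $(T_{\mathfrak p}\Phi)(b)=\sum_\sigma\Phi(b\,\iota^{-1}(\sigma))$ (resp. $(U_{\mathfrak p}\Phi)(b)=\sum_\sigma\Phi(b\,\iota^{-1}(\sigma))$), where $\sigma$ runs over representatives of the left cosets $\sigma\, GL_2(\mathcal O_{F_{\mathfrak p}})$ in $GL_2(\mathcal O_{F_{\mathfrak p}})\,\mathrm{diag}(\varpi,1)\,GL_2(\mathcal O_{F_{\mathfrak p}})$ (resp. $\sigma I_{\mathfrak p}$ in $I_{\mathfrak p}\,\mathrm{diag}(1,\varpi)\,I_{\mathfrak p}$). *Tree.* The vertices of the Bruhat–Tits tree are the cosets of $F_{\mathfrak p}^\times GL_2(\mathcal O_{F_{\mathfrak p}})$ in $GL_2(F_{\mathfrak p})$ and its directed edges are the cosets of $F_{\mathfrak p}^\times I_{\mathfrak p}$; the edge $[g]$ goes from the vertex $[g]$ to the vertex $[g\,\mathrm{diag}(1,\varpi)]$. If $\Phi$ is a form of the corresponding level, $b\in\widehat B^\times$, and $w=[g]$ is a vertex or an edge, put $\Phi(b\star w)=\Phi(b\,\iota^{-1}(g))$.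 Let $K_{\mathfrak p}=K\otimes_F F_{\mathfrak p}$, $\mathcal O_{K,\mathfrak p}=\mathcal O_K\otimes_{\mathcal O_F}\mathcal O_{F_{\mathfrak p}}$ and $\mathcal U_j=(1+\mathfrak p^j\mathcal O_{K,\mathfrak p})^\times$ for $j\ge 0$ (so $\mathcal U_0=\mathcal O_{K,\mathfrak p}^\times$). The group $K_{\mathfrak p}^\times$ acts on the tree through $\iota\circ\Psi$. Fix consecutive (adjacent) vertices $\mathfrak v_0,\mathfrak v_1,\dots$ such that the stabilizer of $\mathfrak v_j$ in $K_{\mathfrak p}^\times/F_{\mathfrak p}^\times$ is the image of $\mathcal U_j$ for all $j\ge0$, and let $\mathfrak e_j$ $(j\ge1)$ be the directed edge from $\mathfrak v_{j-1}$ to $\mathfrak v_j$. *Theta elements.* Let $\mathcal H_\infty=\widehat K^\times/K^\times U$ with $U=\{x\in\widehat{\mathcal O}_K^\times: x_{\mathfrak p}\in\mathcal O_{F_{\mathfrak p}}^\times\}$, and let $\mathcal H_j$ be the (finite) quotient of $\mathcal H_\infty$ by the image of $\mathcal U_j$, with projections $\pi_{j+1,j}:\mathcal H_{j+1}\to\mathcal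 H_j$. For $y\in\mathcal H_j$ let $\xi_j(y)=\sum_{x\in\mathcal H_{j+1},\,\pi_{j+1,j}(x)=y}x$, and extend $\pi_{j+1,j}$ and $\xi_j$ linearly to group rings. For $w_j=\mathfrak v_j$ $(j\ge0)$, or $w_j=\mathfrak e_j$ $(j\ge1)$, and $\Phi$ of the corresponding level, put $\Phi_{K,j}(t)=\Phi(\widehat\Psi(t)\star w_j)$ for $t\in\mathcal H_j$ and $\vartheta_{\Phi,j}=\sum_{t\in\mathcal H_j}\Phi_{K,j}(t)\cdot t\in\mathcal O[\mathcal H_j]$. Say that $j$ is *stable* if every unit of the order $\mathcal O_F+\mathfrak p^{j}\mathcal O_K$ lies in $\mathcal O_F+\mathfrak p^{j+1}\mathcal O_K$. (All large $j$ are stable; all $j\ge1$ are stable if $(\mathcal O_F+\mathfrak p\mathcal O_K)^\times=\mathcal O_F^\times$, e.g. if $F=\mathbf Q$.) Then $\Phi_{K,j}$ is well defined on $\mathcal H_j$, and the following hold. (i) Let $\Phi$ have level $H_{GL_2(\mathcal O_{F_{\mathfrak p}})}$ with $T_{\mathfrak p}\Phi=a_{\mathfrak p}\Phi$, $a_{\mathfrak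 p}\in\mathcal O$, and let $w_j=\mathfrak v_j$. Then for every stable $j\ge1$, $$\pi_{j+1,j}(\vartheta_{\Phi,j+1})=a_{\mathfrak p}\,\vartheta_{\Phi,j}-\xi_{j-1}\vartheta_{\Phi,j-1}.$$ (ii) Let $\Phi$ have level $H_{I_{\mathfrak p}}$ with $U_{\mathfrak p}\Phi=\alpha_{\mathfrak p}\Phi$, $\alpha_{\mathfrak p}\in\mathcal O$, and let $w_j=\mathfrak e_j$. Then for every stable $j\ge1$, $$\pi_{j+1,j}(\vartheta_{\Phi,j+1})=\alpha_{\mathfrak p}\,\vartheta_{\Phi,j}.$$ (iii) (Ordinary case.) In (ii) suppose moreover that $\alpha_{\mathfrak p}\in\mathcal O^\times$, and let $j_0\ge1$ be such that all $j\ge j_0$ are stable. Then the elements $\theta_{\Phi,j}=\alpha_{\mathfrak p}^{-j}\vartheta_{\Phi,j}$ satisfy $\pi_{j+1,j}(\theta_{\Phi,j+1})=\theta_{\Phi,j}$ for $j\ge j_0$, and there is exactly one $\mathcal O$-valued measure $\theta_\Phi$ on $\mathcal H_\infty=\varprojlim_j\mathcal H_j$ (a finitely additive function on the compact open subsets, i.e.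 the subsets stable under the image of some $\mathcal U_j$) whose value on the inverse image in $\mathcal H_\infty$ of $t\in\mathcal H_j$ is $\alpha_{\mathfrak p}^{-j}\Phi_{K,j}(t)$ for all $j\ge j_0$ and $t\in\mathcal H_j$. -/

import Mathlib

open scoped TensorProduct NumberField Pointwise
open IsDedekindDomain NumberField

noncomputable section

namespace QuaternionicTheta

/-! ### Adelic and local points of an algebra over a number field -/

/-- The finite places of `F`. -/
abbrev Place (F : Type*) [Field F] [NumberField F] := HeightOneSpectrum (𝓞 F)

/-- The completion `F_v`. -/
abbrev Fv {F : Type*} [Field F] [NumberField F] (v : Place F) := v.adicCompletion F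

/-- The ring of integers `O_{F_v}`. -/
abbrev Ov {F : Type*} [Field F] [NumberField F] (v : Place F) := v.adicCompletionIntegers F

/-- The ring of finite adeles of `F`. -/
abbrev Fhat (F : Type*) [Field F] [NumberField F] := FiniteAdeleRing (𝓞 F) F

/-- The finite adelic points `Â = F̂ ⊗ A` of an `F`-algebra `A`. -/
abbrev Adelic (F A : Type*) [Field F] [NumberField F] [Ring A] [Algebra F A] := Fhat F ⊗[F] A

/-- The local points `A_v = F_v ⊗ A`. -/
abbrev Local {F : Type*} [Field F] [NumberField F] (v : Place F) (A : Type*) [Ring A]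
    [Algebra F A] := Fv v ⊗[F] A

section Adeles

variable {F : Type*} [Field F] [NumberField F] (A : Type*) [Ring A] [Algebra F A]

/-- The projection `F̂ → F_v`. -/
def evalAt (v : Place F) : Fhat F →ₐ[F] Fv v where
  toFun x := x v
  map_one' := rfl
  map_mul' _ _ := rfl
  map_zero' := rfl
  map_add' _ _ := rfl
  commutes' _ := rfl

/-- The `v`-component `Â → A_v`. -/
def component (v : Place F) : Adelic F A →ₐ[F] Local v A :=
  Algebra.TensorProduct.map (evalAt v) (AlgHom.id F A)

/-- The `v`-component on units, `Â^× → A_v^×`. -/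
def componentUnits (v : Place F) : (Adelic F A)ˣ →* (Local v A)ˣ :=
  Units.map (component A v : Adelic F A →* Local v A)

open Classical in
/-- The adele with component `x` at `v` and component `0` at all other places. -/
def singleAdele (v : Place F) (x : Fv v) : Fhat F :=
  RestrictedProduct.single (fun w : Place F => Ov w) v x

open Classical in
lemma singleAdele_apply (v w : Place F) (x : Fv v) :
    singleAdele v x w = Pi.single (M := fun w : Place F => Fv w) v x w := rfl

/-- The additive embedding of `F_v` in `F̂` with zero components away from `v`. -/
def single (v : Place F) : Fv v →ₗ[F] Fhat F where
  toFun := singleAdele v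
  map_add' x y := by
    refine FiniteAdeleRing.ext F fun w => ?_
    classical
    change _ = singleAdele v x w + singleAdele v y w
    simp only [singleAdele_apply, Pi.single_add, Pi.add_apply]
  map_smul' c x := by
    rw [RingHom.id_apply, Algebra.smul_def, Algebra.smul_def]
    refine FiniteAdeleRing.ext F fun w => ?_
    classical
    change _ = (algebraMap F (Fv w) c) * singleAdele v x w
    simp only [singleAdele_apply]
    by_cases h : w = v
    · subst h; simp
    · simp [Pi.single_eq_of_ne h]

lemma single_mul (v : Place F) (x y : Fv v) : single v (x * y) = single v x * single v y := by
  refine FiniteAdeleRing.ext F fun w => ?_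
  classical
  change singleAdele v (x * y) w = singleAdele v x w * singleAdele v y w
  simp only [singleAdele_apply]
  by_cases h : w = v
  · subst h; simp
  · simp [Pi.single_eq_of_ne h]

/-- The non-unital embedding `A_v → Â` with zero components away from `v`. -/
def extendZero (v : Place F) : Local v A →ₗ[F] Adelic F A := LinearMap.rTensor A (single v)

lemma extendZero_mul (v : Place F) (x y : Local v A) :
    extendZero A v (x * y) = extendZero A v x * extendZero A v y := by
  refine TensorProduct.induction_on x (by simp) (fun a b => ?_)
    (fun x₁ x₂ h₁ h₂ => by simp [add_mul, h₁, h₂])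
  refine TensorProduct.induction_on y (by simp) (fun c d => ?_)
    (fun y₁ y₂ h₁ h₂ => by simp [mul_add, h₁, h₂])
  simp [extendZero, single_mul]

/-- The embedding `A_v^× → Â^×`: the component at `v` is the given unit, all others are `1`. -/
def atPlace (v : Place F) : (Local v A)ˣ →* (Adelic F A)ˣ :=
  Units.map
    { toFun := fun x => 1 + extendZero A v (x - 1)
      map_one' := by simp
      map_mul' := fun x y => by
        have h : x * y - 1 = (x - 1) + (y - 1) + (x - 1) * (y - 1) := by noncomm_ring
        rw [h, map_add, map_add, extendZero_mul]
        noncomm_ring }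

/-- The diagonal embedding `A^× → Â^×`. -/
def diagonal (F : Type*) [Field F] [NumberField F] (A : Type*) [Ring A] [Algebra F A] :
    Aˣ →* (Adelic F A)ˣ :=
  Units.map ((Algebra.TensorProduct.includeRight : A →ₐ[F] Adelic F A) : A →* Adelic F A)

/-- The central embedding `F̂^× → Â^×`. -/
def central (F : Type*) [Field F] [NumberField F] (A : Type*) [Ring A] [Algebra F A] :
    (Fhat F)ˣ →* (Adelic F A)ˣ :=
  Units.map ((Algebra.TensorProduct.includeLeft : Fhat F →ₐ[F] Adelic F A) :
    Fhat F →* Adelic F A)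

/-- The scalars `F_v^× ⊆ A_v^×`. -/
def localScalars (v : Place F) : Subgroup (Local v A)ˣ :=
  (Units.map (algebraMap (Fv v) (Local v A) : Fv v →* Local v A)).range

variable {A}

/-- The `O_{F_v}`-subalgebra of `A_v` generated by a subset `S` of `A`. When `S` is an order over
`O_F`, or over `O_F[1/𝔭]` with `v ≠ 𝔭`, this is the completion `S_v`. -/
def localOrder (v : Place F) (S : Set A) : Subalgebra (Ov v) (Local v A) :=
  Algebra.adjoin (Ov v) ((fun a : A => (1 : Fv v) ⊗ₜ[F] a) '' S)

/-- The unit group of a subring, as a subgroup of the ambient unit group. -/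
def unitsOf {k C : Type*} [CommRing k] [Ring C] [Algebra k C] (S : Subalgebra k C) :
    Subgroup Cˣ := S.toSubmonoid.units

/-- `A` is totally definite: `A ⊗ F_w` is a division algebra for every archimedean place `w`. -/
def IsTotallyDefinite (F A : Type*) [Field F] [NumberField F] [Ring A] [Algebra F A] : Prop :=
  ∀ w : InfinitePlace F, ∀ x : w.Completion ⊗[F] A, x ≠ 0 → IsUnit x

/-- The ring `O_F[1/𝔭]`. -/
abbrev awayFrom (𝔭 : Place F) : Subalgebra (𝓞 F) F := Set.integer ({𝔭} : Set (Place F)) F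

/-- `R` is an `O_F[1/𝔭]`-order of `A`. -/
def IsOrder (𝔭 : Place F) (R : Subalgebra (awayFrom 𝔭) A) : Prop :=
  Module.Finite (awayFrom 𝔭) R ∧ Submodule.span F (R : Set A) = ⊤

end Adeles

/-! ### Subgroups of `GL₂(F_𝔭)` and the Bruhat-Tits tree -/

section Tree

variable {F : Type*} [Field F] [NumberField F] (𝔭 : Place F)

/-- `GL₂(F_𝔭)`. -/
abbrev GL2 := GL (Fin 2) (Fv 𝔭)

/-- The Eichler order of level `𝔭` of `M₂(F_𝔭)`: integral matrices with lower left entry in the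
maximal ideal. -/
def eichlerOrder : Subring (Matrix (Fin 2) (Fin 2) (Fv 𝔭)) where
  carrier := {M | (∀ i k, Valued.v (M i k) ≤ 1) ∧ Valued.v (M 1 0) < 1}
  mul_mem' := by
    rintro M N ⟨hM, hM'⟩ ⟨hN, hN'⟩
    refine ⟨fun i k => ?_, ?_⟩
    · rw [Matrix.mul_apply]
      refine Valuation.map_sum_le _ fun l _ => ?_
      rw [map_mul]
      exact mul_le_one' (hM i l) (hN l k)
    · rw [Matrix.mul_apply, Fin.sum_univ_two]
      refine Valuation.map_add_lt _ ?_ ?_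
      · rw [map_mul]
        exact mul_lt_one_of_nonneg_of_lt_one_left zero_le hM' (hN 0 0)
      · rw [map_mul]
        exact mul_lt_one_of_nonneg_of_lt_one_right (hM 1 1) zero_le hN'
  one_mem' := by
    refine ⟨fun i k => ?_, by simp⟩
    by_cases h : i = k
    · subst h; simp
    · simp [Matrix.one_apply_ne h]
  add_mem' := by
    rintro M N ⟨hM, hM'⟩ ⟨hN, hN'⟩
    exact ⟨fun i k => Valuation.map_add_le _ (hM i k) (hN i k),
      Valuation.map_add_lt _ hM' hN'⟩
  zero_mem' := ⟨fun i k => by simp, by simp⟩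
  neg_mem' := by
    rintro M ⟨hM, hM'⟩
    exact ⟨fun i k => by simpa [Valuation.map_neg] using hM i k,
      by simpa [Valuation.map_neg] using hM'⟩

/-- The subgroup `GL₂(O_{F_𝔭})` of `GL₂(F_𝔭)`. -/
def GL2O : Subgroup (GL2 𝔭) := (Ov 𝔭).toSubring.matrix.toSubmonoid.units

/-- The Iwahori subgroup `I_𝔭` of matrices in `GL₂(O_{F_𝔭})` with lower left entry in the maximal
ideal. -/
def iwahori : Subgroup (GL2 𝔭) := (eichlerOrder 𝔭).toSubmonoid.units

/-- The scalar matrices `F_𝔭^×`. -/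
def scalars : Subgroup (GL2 𝔭) :=
  (Units.map (algebraMap (Fv 𝔭) (Matrix (Fin 2) (Fin 2) (Fv 𝔭)) :
    Fv 𝔭 →* Matrix (Fin 2) (Fin 2) (Fv 𝔭))).range

/-- The vertices of the Bruhat-Tits tree, `PGL₂(F_𝔭) / PGL₂(O_{F_𝔭})`. The class of `g` is the
homothety class of the lattice `g (O ⊕ O)`, that is, the maximal order `g M₂(O) g⁻¹`. -/
abbrev Vertex := GL2 𝔭 ⧸ (GL2O 𝔭 ⊔ scalars 𝔭)

/-- The directed edges of the Bruhat-Tits tree. The class of `g` is the pair of homothety classes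
of lattices `(g (O ⊕ O), g (O ⊕ ϖ O))`. -/
abbrev Edge := GL2 𝔭 ⧸ (iwahori 𝔭 ⊔ scalars 𝔭)

variable {𝔭}

/-- `ϖ` is a uniformizer of `F_𝔭`. -/
def IsUniformizer (ϖ : (Fv 𝔭)ˣ) : Prop :=
  ∃ π : Ov 𝔭, Irreducible π ∧ (π : Fv 𝔭) = ϖ

/-- The matrix `diag(a, b)`. -/
def diag (a b : (Fv 𝔭)ˣ) : GL2 𝔭 where
  val := Matrix.diagonal ![(a : Fv 𝔭), (b : Fv 𝔭)]
  inv := Matrix.diagonal ![((a⁻¹ : (Fv 𝔭)ˣ) : Fv 𝔭), ((b⁻¹ : (Fv 𝔭)ˣ) : Fv 𝔭)]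
  val_inv := by
    rw [Matrix.diagonal_mul_diagonal, ← Matrix.diagonal_one]
    congr 1; ext i; fin_cases i <;> simp
  inv_val := by
    rw [Matrix.diagonal_mul_diagonal, ← Matrix.diagonal_one]
    congr 1; ext i; fin_cases i <;> simp

/-- `e` is the directed edge with source `x` and target `y`. -/
def Joins (ϖ : (Fv 𝔭)ˣ) (e : Edge 𝔭) (x y : Vertex 𝔭) : Prop :=
  ∃ g : GL2 𝔭, e = QuotientGroup.mk g ∧ x = QuotientGroup.mk g ∧
    y = QuotientGroup.mk (g * diag 1 ϖ)

end Tree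

/-! ### Automorphic forms on `B^×` and Hecke operators at `𝔭` -/

section Forms

variable {F : Type*} [Field F] [NumberField F] {𝔭 : Place F}
  {B : Type*} [Ring B] [Algebra F B] {O : Type*} [CommRing O]

/-- The embedding `GL₂(F_𝔭) ≅ B_𝔭^× → B̂^×` given by a splitting `ι` of `B` at `𝔭`. -/
def atP (ι : Local 𝔭 B ≃ₐ[Fv 𝔭] Matrix (Fin 2) (Fin 2) (Fv 𝔭)) :
    GL2 𝔭 →* (Adelic F B)ˣ :=
  (atPlace B 𝔭).comp
    (Units.map (ι.symm : Matrix (Fin 2) (Fin 2) (Fv 𝔭) →* Local 𝔭 B))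

/-- The level subgroup `H = ∏_v H_v` of `B̂^×` with `H_v = R_v^×` for `v ≠ 𝔭` and with `H_𝔭` the
given subgroup `C` of `GL₂(F_𝔭)`. -/
def level (ι : Local 𝔭 B ≃ₐ[Fv 𝔭] Matrix (Fin 2) (Fin 2) (Fv 𝔭))
    (R : Subalgebra (awayFrom 𝔭) B) (C : Subgroup (GL2 𝔭)) : Subgroup (Adelic F B)ˣ :=
  (⨅ (v : Place F) (_ : v ≠ 𝔭),
      (unitsOf (localOrder v (R : Set B))).comap (componentUnits B v)) ⊓
    C.comap ((Units.map (ι : Local 𝔭 B →* Matrix (Fin 2) (Fin 2) (Fv 𝔭))).comp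
      (componentUnits B 𝔭))

/-- `Φ` is an `O`-valued automorphic form of weight `2`, level `H` and trivial central character
on `B^×`. -/
def IsAutomorphicForm (H : Subgroup (Adelic F B)ˣ) (Φ : (Adelic F B)ˣ → O) : Prop :=
  ∀ (γ : Bˣ) (b : (Adelic F B)ˣ), ∀ h ∈ H, ∀ z : (Fhat F)ˣ,
    Φ (diagonal F B γ * b * h * central F B z) = Φ b

/-- The Hecke operator of the double coset `C δ C = ∐ σ C`, that is,
`Φ ↦ (b ↦ ∑_σ Φ (b σ))`. -/
def hecke (ι : Local 𝔭 B ≃ₐ[Fv 𝔭] Matrix (Fin 2) (Fin 2) (Fv 𝔭))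
    (C : Subgroup (GL2 𝔭)) (δ : GL2 𝔭) (Φ : (Adelic F B)ˣ → O) (b : (Adelic F B)ˣ) : O :=
  ∑ᶠ σ ∈ {σ : GL2 𝔭 ⧸ C | ∃ k ∈ C, σ = QuotientGroup.mk (k * δ)}, Φ (b * atP ι σ.out)

/-- The operator `T_𝔭`. -/
def heckeT (ι : Local 𝔭 B ≃ₐ[Fv 𝔭] Matrix (Fin 2) (Fin 2) (Fv 𝔭)) (ϖ : (Fv 𝔭)ˣ)
    (Φ : (Adelic F B)ˣ → O) : (Adelic F B)ˣ → O :=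
  hecke ι (GL2O 𝔭) (diag ϖ 1) Φ

/-- The operator `U_𝔭`. -/
def heckeU (ι : Local 𝔭 B ≃ₐ[Fv 𝔭] Matrix (Fin 2) (Fin 2) (Fv 𝔭)) (ϖ : (Fv 𝔭)ˣ)
    (Φ : (Adelic F B)ˣ → O) : (Adelic F B)ˣ → O :=
  hecke ι (iwahori 𝔭) (diag 1 ϖ) Φ

/-- The value `Φ(b ⋆ w)` of `Φ` at the translate by `b ∈ B̂^×` of a vertex or directed edge `w`
represented by `g ∈ GL₂(F_𝔭)`, namely `Φ(b g)`. For a form whose level at `𝔭` lies in the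
stabilizer that defines `w` this does not depend on the choice of `g`; for `b = ξ_i` it is the
`i`-th component of `Φ`, viewed as a function on the tree. -/
def valueAt (ι : Local 𝔭 B ≃ₐ[Fv 𝔭] Matrix (Fin 2) (Fin 2) (Fv 𝔭)) {C : Subgroup (GL2 𝔭)}
    (Φ : (Adelic F B)ˣ → O) (b : (Adelic F B)ˣ) (w : GL2 𝔭 ⧸ C) : O :=
  Φ (b * atP ι w.out)

end Forms

/-! ### The groups `H_∞` and `H_j` -/

section ClassGroups

variable {F : Type*} [Field F] [NumberField F] (𝔭 : Place F)
  (K : Type*) [Field K] [NumberField K] [Algebra F K]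

/-- The ring `O_{K,v} = O_K ⊗ O_{F_v}`. -/
def OKv (v : Place F) : Subalgebra (Ov v) (Local v K) :=
  localOrder v (Set.range (algebraMap (𝓞 K) K))

/-- The lattice `𝔭^j O_{K,𝔭}`. -/
def ideal (j : ℕ) : Submodule (Ov 𝔭) (Local 𝔭 K) :=
  (IsLocalRing.maximalIdeal (Ov 𝔭) ^ j) • Subalgebra.toSubmodule (OKv K 𝔭)

lemma ideal_mul_mem (j : ℕ) {x y : Local 𝔭 K} (hx : x ∈ OKv K 𝔭) (hy : y ∈ ideal 𝔭 K j) :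
    x * y ∈ ideal 𝔭 K j := by
  refine Submodule.smul_induction_on hy (fun r hr n hn => ?_) (fun a b ha hb => ?_)
  · rw [mul_smul_comm]
    exact Submodule.smul_mem_smul hr ((OKv K 𝔭).mul_mem hx hn)
  · rw [mul_add]
    exact add_mem ha hb

/-- The group `(1 + 𝔭^j O_{K,𝔭})^×`, which is `O_{K,𝔭}^×` for `j = 0`. -/
def localU (j : ℕ) : Subgroup (Local 𝔭 K)ˣ where
  carrier := {u | u ∈ unitsOf (OKv K 𝔭) ∧ (u : Local 𝔭 K) - 1 ∈ ideal 𝔭 K j}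
  one_mem' := ⟨one_mem _, by simp⟩
  mul_mem' := by
    rintro u w ⟨hu, hu'⟩ ⟨hw, hw'⟩
    refine ⟨mul_mem hu hw, ?_⟩
    have h : ((u * w : (Local 𝔭 K)ˣ) : Local 𝔭 K) - 1
        = (u : Local 𝔭 K) * ((w : Local 𝔭 K) - 1) + ((u : Local 𝔭 K) - 1) := by
      push_cast; ring
    rw [h]
    exact add_mem (ideal_mul_mem 𝔭 K j hu.1 hw') hu'
  inv_mem' := by
    rintro u ⟨hu, hu'⟩
    refine ⟨inv_mem hu, ?_⟩
    have h : ((u⁻¹ : (Local 𝔭 K)ˣ) : Local 𝔭 K) - 1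
        = -(((u⁻¹ : (Local 𝔭 K)ˣ) : Local 𝔭 K) * ((u : Local 𝔭 K) - 1)) := by
      rw [mul_sub, Units.inv_mul]; ring
    rw [h]
    exact neg_mem (ideal_mul_mem 𝔭 K j (inv_mem hu).1 hu')

lemma localU_antitone (j : ℕ) : localU 𝔭 K (j + 1) ≤ localU 𝔭 K j := fun _ hu =>
  ⟨hu.1, Submodule.smul_mono_left (Ideal.pow_le_pow_right (Nat.le_succ j)) hu.2⟩

/-- The group `U` of all `x ∈ ∏_v O_{K,v}^×` with `x_𝔭 ∈ O_{F_𝔭}^×`. -/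
def unitsAway : Subgroup (Adelic F K)ˣ :=
  (⨅ v : Place F, (unitsOf (OKv K v)).comap (componentUnits K v)) ⊓
    (unitsOf (⊥ : Subalgebra (Ov 𝔭) (Local 𝔭 K))).comap (componentUnits K 𝔭)

instance normal_of_field (S : Subgroup (Adelic F K)ˣ) : S.Normal :=
  ⟨fun n hn g => by
    have h : g * n * g⁻¹ = n := by
      rw [mul_inv_eq_iff_eq_mul]
      exact Units.ext (mul_comm (g : Adelic F K) (n : Adelic F K))
    rwa [h]⟩

/-- The group `H_∞ = K̂^× / K^× U`, isomorphic to `Gal(K[𝔭^∞]/K)` by class field theory. -/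
abbrev Hinf := (Adelic F K)ˣ ⧸ ((diagonal F K).range ⊔ unitsAway 𝔭 K)

instance normal_of_Hinf (S : Subgroup (Hinf 𝔭 K)) : S.Normal :=
  ⟨fun n hn g => by
    have h : g * n * g⁻¹ = n := by
      rw [mul_inv_eq_iff_eq_mul]
      refine Quotient.inductionOn₂' g n fun a b => ?_
      exact congrArg QuotientGroup.mk
        (Units.ext (mul_comm (a : Adelic F K) (b : Adelic F K)))
    rwa [h]⟩

/-- The image in `H_∞` of `(1 + 𝔭^j O_{K,𝔭})^×`. -/
def filtration (j : ℕ) : Subgroup (Hinf 𝔭 K) :=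
  (localU 𝔭 K j).map ((QuotientGroup.mk' _).comp (atPlace K 𝔭))

/-- The finite group `H_j`, the quotient of `H_∞` by the image of `(1 + 𝔭^j O_{K,𝔭})^×`. -/
abbrev Hlev (j : ℕ) := Hinf 𝔭 K ⧸ filtration 𝔭 K j

/-- The class in `H_j` of a finite idele of `K`. -/
def toHlev (j : ℕ) (t : (Adelic F K)ˣ) : Hlev 𝔭 K j :=
  QuotientGroup.mk (QuotientGroup.mk t : Hinf 𝔭 K)

/-- The projection `π_{j+1,j} : H_{j+1} → H_j`. -/
def proj (j : ℕ) : Hlev 𝔭 K (j + 1) →* Hlev 𝔭 K j :=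
  QuotientGroup.map _ _ (MonoidHom.id _) (Subgroup.map_mono (localU_antitone 𝔭 K j))

variable {K} in
/-- `u` lies in the order `O_F + 𝔭^j O_K` of conductor `𝔭^j`. -/
def MemOrder (j : ℕ) (u : 𝓞 K) : Prop :=
  ∃ a : 𝓞 F, u - algebraMap (𝓞 F) (𝓞 K) a ∈ (𝔭.asIdeal ^ j).map (algebraMap (𝓞 F) (𝓞 K))

/-- The orders of conductor `𝔭^j` and `𝔭^(j+1)` in `K` have the same units. -/
def UnitsStable (j : ℕ) : Prop :=
  ∀ u : (𝓞 K)ˣ, MemOrder 𝔭 j (u : 𝓞 K) → MemOrder 𝔭 (j + 1) (u : 𝓞 K)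

variable {𝔭 K} {O : Type*} [CommRing O]

variable (𝔭 K O) in
/-- The map `π_{j+1,j} : O[H_{j+1}] → O[H_j]` on group rings. -/
def projRing (j : ℕ) : MonoidAlgebra O (Hlev 𝔭 K (j + 1)) →+* MonoidAlgebra O (Hlev 𝔭 K j) :=
  MonoidAlgebra.mapDomainRingHom O (proj 𝔭 K j)

/-- The additive map `ξ_j : O[H_j] → O[H_{j+1}]` that sends `y` to the sum of its preimages under
`π_{j+1,j}`. -/
def xi (j : ℕ) (θ : MonoidAlgebra O (Hlev 𝔭 K j)) : MonoidAlgebra O (Hlev 𝔭 K (j + 1)) :=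
  θ.coeff.sum fun y c => ∑ᶠ x ∈ {x | proj 𝔭 K j x = y}, MonoidAlgebra.single x c

variable (𝔭 K) in
/-- The compact open subsets of the profinite group `H_∞ = lim H_j`. -/
def CompactOpen := {S : Set (Hinf 𝔭 K) // ∃ j, ∀ u ∈ filtration 𝔭 K j, ∀ t ∈ S, t * u ∈ S}

variable (𝔭 K O) in
/-- The `O`-valued measures on `H_∞`: finitely additive functions on compact open subsets. -/
def HMeasure := {μ : CompactOpen 𝔭 K → O // ∀ S T V : CompactOpen 𝔭 K,
  V.1 = S.1 ∪ T.1 → Disjoint S.1 T.1 → μ V = μ S + μ T}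

variable (𝔭 K) in
/-- The inverse image in `H_∞` of an element of `H_j`. -/
def fibre (j : ℕ) (t : Hlev 𝔭 K j) : CompactOpen 𝔭 K :=
  ⟨{s | (QuotientGroup.mk s : Hlev 𝔭 K j) = t}, j, fun u hu s hs => by
    rw [Set.mem_ofPred_eq] at hs ⊢
    rw [← hs, QuotientGroup.eq]
    simpa using hu⟩

end ClassGroups

/-! ### The torus action and the theta elements -/

section Theta

variable {F : Type*} [Field F] [NumberField F] {𝔭 : Place F}
  {K : Type*} [Field K] [NumberField K] [Algebra F K]
  {B : Type*} [Ring B] [Algebra F B] {O : Type*} [CommRing O]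

/-- `Ψ` is an optimal embedding into `R` of the maximal `O_F[1/𝔭]`-order of `K`. -/
def IsOptimal (R : Subalgebra (awayFrom 𝔭) B) (Ψ : K →ₐ[F] B) : Prop :=
  ∀ x : K, Ψ x ∈ R ↔ x ∈ integralClosure (awayFrom 𝔭) K

/-- The adelization `Ψ̂ : K̂^× → B̂^×`. -/
def adelicEmb (Ψ : K →ₐ[F] B) : (Adelic F K)ˣ →* (Adelic F B)ˣ :=
  Units.map ((Algebra.TensorProduct.map (AlgHom.id F (Fhat F)) Ψ :
    Adelic F K →ₐ[F] Adelic F B) : Adelic F K →* Adelic F B)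

/-- The local embedding `Ψ_𝔭 : K_𝔭^× → B_𝔭^× ≅ GL₂(F_𝔭)`, through which `K_𝔭^×` acts on the
tree. -/
def torus (ι : Local 𝔭 B ≃ₐ[Fv 𝔭] Matrix (Fin 2) (Fin 2) (Fv 𝔭)) (Ψ : K →ₐ[F] B) :
    (Local 𝔭 K)ˣ →* GL2 𝔭 :=
  (Units.map (ι : Local 𝔭 B →* Matrix (Fin 2) (Fin 2) (Fv 𝔭))).comp
    (Units.map ((Algebra.TensorProduct.map (AlgHom.id F (Fv 𝔭)) Ψ :
      Local 𝔭 K →ₐ[F] Local 𝔭 B) : Local 𝔭 K →* Local 𝔭 B))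

/-- A sequence of consecutive vertices `v_0, v_1, …` such that the stabilizer of `v_j` in
`K_𝔭^× / F_𝔭^×` is the image of `(1 + 𝔭^j O_{K,𝔭})^×`. -/
def IsVertexSequence (ι : Local 𝔭 B ≃ₐ[Fv 𝔭] Matrix (Fin 2) (Fin 2) (Fv 𝔭)) (ϖ : (Fv 𝔭)ˣ)
    (Ψ : K →ₐ[F] B) (v : ℕ → Vertex 𝔭) : Prop :=
  (∀ j, ∃ e, Joins ϖ e (v j) (v (j + 1))) ∧
  ∀ j, ∀ x : (Local 𝔭 K)ˣ,
    torus ι Ψ x • v j = v j ↔ x ∈ localU 𝔭 K j ⊔ localScalars K 𝔭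

/-- A sequence of directed edges `e_1, e_2, …` such that `e_j` goes from `v_{j-1}` to `v_j`, for
a sequence of vertices as above. The value `e 0` plays no role. -/
def IsEdgeSequence (ι : Local 𝔭 B ≃ₐ[Fv 𝔭] Matrix (Fin 2) (Fin 2) (Fv 𝔭)) (ϖ : (Fv 𝔭)ˣ)
    (Ψ : K →ₐ[F] B) (e : ℕ → Edge 𝔭) : Prop :=
  ∃ v, IsVertexSequence ι ϖ Ψ v ∧ ∀ j, Joins ϖ (e (j + 1)) (v j) (v (j + 1))

/-- The function `Φ_{K,j} : H_j → O`, `t ↦ Φ(Ψ̂(t) ⋆ w_j)`. -/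
def phiK (ι : Local 𝔭 B ≃ₐ[Fv 𝔭] Matrix (Fin 2) (Fin 2) (Fv 𝔭)) (Ψ : K →ₐ[F] B)
    {C : Subgroup (GL2 𝔭)} (Φ : (Adelic F B)ˣ → O) (w : ℕ → GL2 𝔭 ⧸ C) (j : ℕ)
    (t : Hlev 𝔭 K j) : O :=
  valueAt ι Φ (adelicEmb Ψ t.out.out) (w j)

/-- The group ring element `ϑ_{Φ,j} = ∑_{t ∈ H_j} Φ_{K,j}(t) t` of `O[H_j]`. -/
def theta (ι : Local 𝔭 B ≃ₐ[Fv 𝔭] Matrix (Fin 2) (Fin 2) (Fv 𝔭)) (Ψ : K →ₐ[F] B)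
    {C : Subgroup (GL2 𝔭)} (Φ : (Adelic F B)ˣ → O) (w : ℕ → GL2 𝔭 ⧸ C) (j : ℕ) :
    MonoidAlgebra O (Hlev 𝔭 K j) :=
  ∑ᶠ t : Hlev 𝔭 K j, MonoidAlgebra.single t (phiK ι Ψ Φ w j t)

end Theta

end QuaternionicTheta

end

noncomputable section

namespace QuaternionicTheta

set_option linter.unusedSectionVars false

open WithZero HeightOneSpectrum

/-! ### Local and adelic points -/

section Adelic

variable {F : Type*} [Field F] [NumberField F] {A B : Type*} [Ring A] [Algebra F A]
  [Ring B] [Algebra F B]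

/-! The distribution relations come from comparing two counts: neighbours on the tree and fibres of
H_{j+1} → H_j. Write q for the size of the residue field at 𝔭 and U_j for (1 + 𝔭^j O_{K,𝔭})^×.

Right translation of Φ by a local idele u ∈ K_𝔭^× moves the point of the tree at which Φ is
evaluated (`IsAutomorphicForm.valueAt_atPlace`). Together with invariance under B^× and under U
(where optimality of Ψ enters), this makes Φ_{K,j} well defined on H_j, because U_j fixes w_j
(`IsAutomorphicForm.phiK_toHlev`).

The fibre of H_{j+1} → H_j over the class of t consists of the classes of t u with u ∈ U_j. If j is
stable, t u and t u' have the same class exactly when u and u' differ by U_{j+1} F_𝔭^×, the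
stabilizer of w_{j+1} (`toHlev_mul_atPlace_eq_iff`). Without stability a global unit may identify
further classes. Hence the sum of Φ_{K,j+1} over the fibre is the sum of Φ(Ψ̂(t) ⋆ ·) over the
U_j-orbit of w_{j+1} (`IsAutomorphicForm.finsum_phiK`).

On the other side, T_𝔭 Φ or U_𝔭 Φ evaluated at w_j is a sum over the neighbours of w_j
(`IsAutomorphicForm.hecke_eq_finsum`). There are at most q + 1 of them for a vertex and at most q
for an edge. For j ≥ 1 the orbit has at least q elements, since the 1 + π^j b τ, with b running over
residues and τ ∈ O_{K,𝔭} not a scalar modulo 𝔭, are inequivalent modulo U_{j+1} F_𝔭^×. The vertex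
sequence cannot backtrack, because stabilizers shrink strictly. So the neighbours of v_j are exactly
v_{j-1} and the orbit of v_{j+1}, and those of e_j are exactly the orbit of e_{j+1}
(`neighbours_eq`, `neighbours_iwahori_eq`). This yields (i) and (ii).

Finiteness of H_j is needed for the sums to have their intended meaning: H_0 injects into the class
group of K, and each fibre of H_{j+1} → H_j is covered by a finite orbit on the tree. For (iii),
scaling by α^{-j} makes the Φ_{K,j} compatible, and a compatible system of functions on the H_j is
the same as a finitely additive measure (`existsUnique_measure`). -/

lemma single_mul_left (v : Place F) (a : Fhat F) (x : Fv v) :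
    single v (a v * x) = a * single v x := by
  refine FiniteAdeleRing.ext F fun w => ?_
  classical
  change singleAdele v (a v * x) w = a w * singleAdele v x w
  simp only [singleAdele_apply]
  by_cases h : w = v
  · subst h; simp
  · simp [Pi.single_eq_of_ne h]

lemma component_tmul (v : Place F) (a : Fhat F) (x : A) :
    component A v (a ⊗ₜ[F] x) = a v ⊗ₜ[F] x := rfl

lemma extendZero_tmul (v : Place F) (a : Fv v) (x : A) :
    extendZero A v (a ⊗ₜ[F] x) = single v a ⊗ₜ[F] x := rfl

/-- The image of A_v is a two-sided ideal of Â on which Â acts through its v-component. Left and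
right versions are both needed because A may be noncommutative. -/
lemma mul_extendZero (v : Place F) (x : Adelic F A) (y : Local v A) :
    x * extendZero A v y = extendZero A v (component A v x * y) := by
  induction x using TensorProduct.induction_on with
  | zero => simp
  | add x₁ x₂ h₁ h₂ => simp [add_mul, h₁, h₂]
  | tmul a b =>
    induction y using TensorProduct.induction_on with
    | zero => simp
    | add y₁ y₂ h₁ h₂ => simp only [map_add, mul_add, h₁, h₂]
    | tmul c d =>
      rw [component_tmul, Algebra.TensorProduct.tmul_mul_tmul, extendZero_tmul, extendZero_tmul,
        single_mul_left, Algebra.TensorProduct.tmul_mul_tmul]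

lemma extendZero_mul' (v : Place F) (x : Adelic F A) (y : Local v A) :
    extendZero A v y * x = extendZero A v (y * component A v x) := by
  induction x using TensorProduct.induction_on with
  | zero => simp
  | add x₁ x₂ h₁ h₂ => simp [mul_add, h₁, h₂]
  | tmul a b =>
    induction y using TensorProduct.induction_on with
    | zero => simp
    | add y₁ y₂ h₁ h₂ => simp only [map_add, add_mul, h₁, h₂]
    | tmul c d =>
      rw [component_tmul, Algebra.TensorProduct.tmul_mul_tmul, extendZero_tmul, extendZero_tmul,
        mul_comm c, single_mul_left, Algebra.TensorProduct.tmul_mul_tmul, mul_comm (single v c)]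

lemma component_extendZero_self (v : Place F) (y : Local v A) :
    component A v (extendZero A v y) = y := by
  induction y using TensorProduct.induction_on with
  | zero => simp
  | add y₁ y₂ h₁ h₂ => simp only [map_add, h₁, h₂]
  | tmul c d =>
    change singleAdele v c v ⊗ₜ[F] d = _
    classical
    rw [singleAdele_apply, Pi.single_eq_same]

lemma component_extendZero_of_ne {v w : Place F} (h : w ≠ v) (y : Local v A) :
    component A w (extendZero A v y) = 0 := by
  induction y using TensorProduct.induction_on with
  | zero => simp
  | add y₁ y₂ h₁ h₂ => simp only [map_add, h₁, h₂, add_zero]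
  | tmul c d =>
    change singleAdele v c w ⊗ₜ[F] d = _
    classical
    rw [singleAdele_apply, Pi.single_eq_of_ne h, TensorProduct.zero_tmul]

@[simp] lemma componentUnits_atPlace_self (v : Place F) (u : (Local v A)ˣ) :
    componentUnits A v (atPlace A v u) = u := by
  ext
  change component A v (1 + extendZero A v (u - 1)) = u
  rw [map_add, map_one, component_extendZero_self, add_sub_cancel]

lemma componentUnits_atPlace_of_ne {v w : Place F} (h : w ≠ v) (u : (Local v A)ˣ) :
    componentUnits A w (atPlace A v u) = 1 := by
  ext
  change component A w (1 + extendZero A v (u - 1)) = 1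
  rw [map_add, map_one, component_extendZero_of_ne h, add_zero]

/-- Away from v the idele `atPlace A v u` is 1, so only the v-components have to commute. -/
lemma commute_atPlace (v : Place F) (x : (Adelic F A)ˣ) (u : (Local v A)ˣ)
    (h : Commute (componentUnits A v x) u) : Commute x (atPlace A v u) := by
  have h' : component A v x * (u : Local v A) = u * component A v x := congrArg Units.val h
  refine Units.ext ?_
  change (x : Adelic F A) * (1 + extendZero A v (u - 1)) = (1 + extendZero A v (u - 1)) * x
  rw [mul_add, add_mul, mul_extendZero, extendZero_mul', mul_sub, sub_mul, h', mul_one, one_mul,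
    mul_one, one_mul]

/-- The local embedding `A_v → B_v`. -/
def localMap (v : Place F) (Ψ : A →ₐ[F] B) : Local v A →ₐ[Fv v] Local v B :=
  Algebra.TensorProduct.map (AlgHom.id (Fv v) (Fv v)) Ψ

lemma component_map (v : Place F) (Ψ : A →ₐ[F] B) (x : Adelic F A) :
    component B v (Algebra.TensorProduct.map (AlgHom.id F (Fhat F)) Ψ x) =
      localMap v Ψ (component A v x) := by
  induction x using TensorProduct.induction_on with
  | zero => simp
  | add x₁ x₂ h₁ h₂ => simp only [map_add, h₁, h₂]
  | tmul a b => rfl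

lemma map_extendZero (v : Place F) (Ψ : A →ₐ[F] B) (x : Local v A) :
    Algebra.TensorProduct.map (AlgHom.id F (Fhat F)) Ψ (extendZero A v x) =
      extendZero B v (localMap v Ψ x) := by
  induction x using TensorProduct.induction_on with
  | zero => simp
  | add x₁ x₂ h₁ h₂ => simp only [map_add, h₁, h₂]
  | tmul a b => rfl

lemma localMap_mem_localOrder (v : Place F) (Ψ : A →ₐ[F] B) {S : Set A} {T : Set B}
    (h : ∀ x ∈ S, Ψ x ∈ T) {x : Local v A} (hx : x ∈ localOrder v S) :
    localMap v Ψ x ∈ localOrder v T := by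
  induction hx using Algebra.adjoin_induction with
  | mem x hx =>
    obtain ⟨a, ha, rfl⟩ := hx
    exact Algebra.subset_adjoin ⟨Ψ a, h a ha, rfl⟩
  | algebraMap r =>
    have : localMap v Ψ (algebraMap (Ov v) (Local v A) r) = algebraMap (Ov v) (Local v B) r := by
      change localMap v Ψ ((r : Fv v) ⊗ₜ 1) = (r : Fv v) ⊗ₜ 1
      simp [localMap]
    rw [this]
    exact Subalgebra.algebraMap_mem _ _
  | add x y _ _ hx hy => rw [map_add]; exact add_mem hx hy
  | mul x y _ _ hx hy => rw [map_mul]; exact mul_mem hx hy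

lemma central_one_add_single (v : Place F) (c : Fv v) :
    (1 + single v (c - 1)) ⊗ₜ[F] (1 : A) = 1 + extendZero A v (algebraMap (Fv v) (Local v A) c - 1) := by
  have : (algebraMap (Fv v) (Local v A) c - 1) = (c - 1) ⊗ₜ[F] (1 : A) := by
    rw [TensorProduct.sub_tmul]; rfl
  rw [this, TensorProduct.add_tmul]
  rfl

/-- The idele with component `c` at `v` and `1` elsewhere. -/
def singleUnit (v : Place F) : (Fv v)ˣ →* (Fhat F)ˣ :=
  Units.map
    { toFun := fun x => 1 + single v (x - 1)
      map_one' := by simp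
      map_mul' := fun x y => by
        have h : x * y - 1 = (x - 1) + (y - 1) + (x - 1) * (y - 1) := by ring
        rw [h, map_add, map_add, single_mul]
        ring }

/-- Local scalars at v are central ideles. This converts invariance under F̂^× into invariance under
F_𝔭^×, as required for functions on the tree. -/
lemma central_singleUnit (v : Place F) (c : (Fv v)ˣ) :
    central F A (singleUnit v c) =
      atPlace A v (Units.map (algebraMap (Fv v) (Local v A) : Fv v →* Local v A) c) :=
  Units.ext (central_one_add_single v (c : Fv v))

end Adelic

/-! ### Values of forms on the tree and well-definedness on H_j -/

section Values

variable {F : Type*} [Field F] [NumberField F] {𝔭 : Place F}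
  {K : Type*} [Field K] [NumberField K] [Algebra F K]
  {B : Type*} [Ring B] [Algebra F B] {O : Type*} [CommRing O]
  {ι : Local 𝔭 B ≃ₐ[Fv 𝔭] Matrix (Fin 2) (Fin 2) (Fv 𝔭)}
  {R : Subalgebra (awayFrom 𝔭) B} {C : Subgroup (GL2 𝔭)} {Φ : (Adelic F B)ˣ → O}

/-- The scalar matrices. -/
def scalarHom (𝔭 : Place F) : (Fv 𝔭)ˣ →* GL2 𝔭 :=
  Units.map (algebraMap (Fv 𝔭) (Matrix (Fin 2) (Fin 2) (Fv 𝔭)) :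
    Fv 𝔭 →* Matrix (Fin 2) (Fin 2) (Fv 𝔭))

lemma scalarHom_commute (c : (Fv 𝔭)ˣ) (g : GL2 𝔭) : scalarHom 𝔭 c * g = g * scalarHom 𝔭 c :=
  Units.ext (Algebra.commutes (c : Fv 𝔭) (g : Matrix (Fin 2) (Fin 2) (Fv 𝔭)))

instance scalars_normal : (scalars 𝔭).Normal :=
  ⟨by
    rintro _ ⟨c, rfl⟩ g
    refine ⟨c, ?_⟩
    change scalarHom 𝔭 c = g * scalarHom 𝔭 c * g⁻¹
    rw [← scalarHom_commute, mul_inv_cancel_right]⟩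

lemma mk_eq_mk_iff {C : Subgroup (GL2 𝔭)} (g h : GL2 𝔭) :
    (QuotientGroup.mk g : GL2 𝔭 ⧸ (C ⊔ scalars 𝔭)) = QuotientGroup.mk h ↔
      ∃ k ∈ C, ∃ c, h = g * k * scalarHom 𝔭 c := by
  rw [QuotientGroup.eq, Subgroup.mem_sup_of_normal_right]
  constructor
  · rintro ⟨k, hk, _, ⟨c, rfl⟩, h'⟩
    refine ⟨k, hk, c, ?_⟩
    rw [mul_assoc]
    change k * scalarHom 𝔭 c = _ at h'
    rw [h', mul_inv_cancel_left]
  · rintro ⟨k, hk, c, rfl⟩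
    exact ⟨k, hk, _, ⟨c, rfl⟩, by simp [mul_assoc]; rfl⟩

lemma componentUnits_atP_self (g : GL2 𝔭) :
    componentUnits B 𝔭 (atP ι g) =
      Units.map (ι.symm : Matrix (Fin 2) (Fin 2) (Fv 𝔭) →* Local 𝔭 B) g :=
  componentUnits_atPlace_self _ _

lemma mem_level_iff {x : (Adelic F B)ˣ} : x ∈ level ι R C ↔
    (∀ v ≠ 𝔭, componentUnits B v x ∈ unitsOf (localOrder v (R : Set B))) ∧
      Units.map (ι : Local 𝔭 B →* Matrix (Fin 2) (Fin 2) (Fv 𝔭)) (componentUnits B 𝔭 x) ∈ C := by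
  simp only [level, Subgroup.mem_inf, Subgroup.mem_iInf, Subgroup.mem_comap]
  rfl

lemma mem_unitsAway_iff {x : (Adelic F K)ˣ} : x ∈ unitsAway 𝔭 K ↔
    (∀ v, componentUnits K v x ∈ unitsOf (OKv K v)) ∧
      componentUnits K 𝔭 x ∈ unitsOf (⊥ : Subalgebra (Ov 𝔭) (Local 𝔭 K)) := by
  simp only [unitsAway, Subgroup.mem_inf, Subgroup.mem_iInf, Subgroup.mem_comap]

lemma atP_mem_level {g : GL2 𝔭} (hg : g ∈ C) : atP ι g ∈ level ι R C := by
  refine mem_level_iff.2 ⟨?_, ?_⟩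
  · intro v hv
    rw [atP, MonoidHom.comp_apply, componentUnits_atPlace_of_ne hv]
    exact one_mem _
  · rw [componentUnits_atP_self]
    convert hg
    exact Units.ext (ι.apply_symm_apply _)

lemma atP_scalarHom (c : (Fv 𝔭)ˣ) : atP ι (scalarHom 𝔭 c) = central F B (singleUnit 𝔭 c) := by
  rw [central_singleUnit, atP, MonoidHom.comp_apply]
  congr 1
  ext1
  exact ι.symm.commutes _

lemma IsAutomorphicForm.mul_atP (hΦ : IsAutomorphicForm (level ι R C) Φ) (b : (Adelic F B)ˣ)
    {k : GL2 𝔭} (hk : k ∈ C) (c : (Fv 𝔭)ˣ) :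
    Φ (b * atP ι (k * scalarHom 𝔭 c)) = Φ b := by
  rw [map_mul, atP_scalarHom, ← mul_assoc, ← one_mul (b * _ * _), ← mul_assoc, ← mul_assoc,
    ← map_one (diagonal F B)]
  exact hΦ 1 b _ (atP_mem_level hk) _

/-- Independence of the representative `w.out`: another one differs by an element of C, which lies
in the level, and by a scalar, which is central. -/
lemma IsAutomorphicForm.valueAt_mk (hΦ : IsAutomorphicForm (level ι R C) Φ) (b : (Adelic F B)ˣ)
    (g : GL2 𝔭) :
    valueAt ι Φ b (QuotientGroup.mk g : GL2 𝔭 ⧸ (C ⊔ scalars 𝔭)) = Φ (b * atP ι g) := by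
  obtain ⟨k, hk, c, h⟩ := (mk_eq_mk_iff g (QuotientGroup.mk g : GL2 𝔭 ⧸ (C ⊔ scalars 𝔭)).out).1
    (QuotientGroup.out_eq' _).symm
  rw [valueAt, h, mul_assoc, map_mul (atP ι) g, ← mul_assoc, hΦ.mul_atP _ hk]

lemma IsAutomorphicForm.valueAt_diagonal (hΦ : IsAutomorphicForm (level ι R C) Φ) (γ : Bˣ)
    (b : (Adelic F B)ˣ) (w : GL2 𝔭 ⧸ (C ⊔ scalars 𝔭)) :
    valueAt ι Φ (diagonal F B γ * b) w = valueAt ι Φ b w := by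
  have := hΦ γ (b * atP ι w.out) 1 (one_mem _) 1
  rwa [map_one, mul_one, mul_one, ← mul_assoc] at this

lemma adelicEmb_diagonal (Ψ : K →ₐ[F] B) (x : Kˣ) :
    adelicEmb Ψ (diagonal F K x) = diagonal F B (Units.map (Ψ : K →* B) x) := by
  ext1
  change Algebra.TensorProduct.map (AlgHom.id F (Fhat F)) Ψ (1 ⊗ₜ (x : K)) = 1 ⊗ₜ Ψ x
  simp

lemma adelicEmb_atPlace (Ψ : K →ₐ[F] B) (u : (Local 𝔭 K)ˣ) :
    adelicEmb Ψ (atPlace K 𝔭 u) = atP ι (torus ι Ψ u) := by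
  ext1
  change Algebra.TensorProduct.map (AlgHom.id F (Fhat F)) Ψ (1 + extendZero K 𝔭 (u - 1)) =
    1 + extendZero B 𝔭 (ι.symm (ι (localMap 𝔭 Ψ u)) - 1)
  rw [map_add, map_one, map_extendZero, AlgEquiv.symm_apply_apply, map_sub, map_one]

/-- The link between ideles and the tree: Ψ̂ sends the local idele u to the element `torus ι Ψ u` at
𝔭, which can be absorbed into the representative of w. -/
lemma IsAutomorphicForm.valueAt_atPlace (hΦ : IsAutomorphicForm (level ι R C) Φ) (Ψ : K →ₐ[F] B)
    (b : (Adelic F B)ˣ) (u : (Local 𝔭 K)ˣ) (w : GL2 𝔭 ⧸ (C ⊔ scalars 𝔭)) :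
    valueAt ι Φ (b * adelicEmb Ψ (atPlace K 𝔭 u)) w = valueAt ι Φ b (torus ι Ψ u • w) := by
  induction w using QuotientGroup.induction_on with
  | H g =>
    rw [MulAction.Quotient.smul_mk, hΦ.valueAt_mk, hΦ.valueAt_mk, adelicEmb_atPlace (ι := ι),
      smul_eq_mul, map_mul, mul_assoc]

/-- Integers of K are integral over O_F, hence over O_F[1/𝔭], so optimality applies to them. -/
lemma IsOptimal.integer_mem {Ψ : K →ₐ[F] B} (hΨ : IsOptimal R Ψ) (x : 𝓞 K) :
    Ψ (algebraMap (𝓞 K) K x) ∈ R := by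
  rw [hΨ]
  have : IsIntegral (𝓞 F) (algebraMap (𝓞 K) K x) :=
    (Algebra.IsIntegral.isIntegral (R := 𝓞 F) x).map (IsScalarTower.toAlgHom (𝓞 F) (𝓞 K) K)
  exact this.tower_top

lemma localMap_mem_unitsOf (v : Place F) {Ψ : K →ₐ[F] B} (hΨ : IsOptimal R Ψ)
    {u : (Local v K)ˣ} (hu : u ∈ unitsOf (OKv K v)) :
    Units.map (localMap v Ψ : Local v K →* Local v B) u ∈ unitsOf (localOrder v (R : Set B)) := by
  have h : ∀ x ∈ Set.range (algebraMap (𝓞 K) K), Ψ x ∈ (R : Set B) := by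
    rintro _ ⟨x, rfl⟩
    exact hΨ.integer_mem x
  exact ⟨localMap_mem_localOrder v Ψ h hu.1, localMap_mem_localOrder v Ψ h hu.2⟩

lemma componentUnits_adelicEmb (v : Place F) (Ψ : K →ₐ[F] B) (t : (Adelic F K)ˣ) :
    componentUnits B v (adelicEmb Ψ t) =
      Units.map (localMap v Ψ : Local v K →* Local v B) (componentUnits K v t) :=
  Units.ext (component_map v Ψ t)

/-- A unit of `A_v` that lies in `O_{F_v}` with its inverse is a unit scalar. -/
lemma exists_unit_of_mem_unitsOf_bot {A : Type*} [Ring A] [Algebra F A] [Nontrivial A]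
    {u : (Local 𝔭 A)ˣ} (hu : u ∈ unitsOf (⊥ : Subalgebra (Ov 𝔭) (Local 𝔭 A))) :
    ∃ c : (Ov 𝔭)ˣ, u = Units.map (algebraMap (Fv 𝔭) (Local 𝔭 A) : Fv 𝔭 →* Local 𝔭 A)
      (Units.map (algebraMap (Ov 𝔭) (Fv 𝔭) : Ov 𝔭 →* Fv 𝔭) c) := by
  obtain ⟨c, hc⟩ := Algebra.mem_bot.1 hu.1
  obtain ⟨d, hd⟩ := Algebra.mem_bot.1 hu.2
  have hcd : c * d = 1 := by
    have : algebraMap (Fv 𝔭) (Local 𝔭 A) ((c : Fv 𝔭) * d) = algebraMap (Fv 𝔭) (Local 𝔭 A) 1 := by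
      rw [map_mul, map_one]
      change algebraMap (Ov 𝔭) (Local 𝔭 A) c * algebraMap (Ov 𝔭) (Local 𝔭 A) d = 1
      rw [hc, hd]
      exact u.mul_inv
    exact Subtype.ext (FaithfulSMul.algebraMap_injective (Fv 𝔭) (Local 𝔭 A) this)
  exact ⟨⟨c, d, hcd, by rw [mul_comm, hcd]⟩, Units.ext hc.symm⟩

/-- At v ≠ 𝔭 the components of Ψ̂(u) lie in R_v^×. At 𝔭 the component is an integral unit scalar, so
Ψ̂(u) commutes past the element representing w and is then absorbed by the level. -/
lemma IsAutomorphicForm.valueAt_unitsAway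
    (hC : ∀ c : (Ov 𝔭)ˣ, scalarHom 𝔭 (Units.map (algebraMap (Ov 𝔭) (Fv 𝔭) : Ov 𝔭 →* Fv 𝔭) c) ∈ C)
    (hΦ : IsAutomorphicForm (level ι R C) Φ)
    {Ψ : K →ₐ[F] B} (hΨ : IsOptimal R Ψ) (b : (Adelic F B)ˣ) {u : (Adelic F K)ˣ}
    (hu : u ∈ unitsAway 𝔭 K) (w : GL2 𝔭 ⧸ (C ⊔ scalars 𝔭)) :
    valueAt ι Φ (b * adelicEmb Ψ u) w = valueAt ι Φ b w := by
  obtain ⟨hu₁, hu₂⟩ := mem_unitsAway_iff.1 hu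
  obtain ⟨c, hc⟩ := exists_unit_of_mem_unitsOf_bot hu₂
  have hloc : componentUnits B 𝔭 (adelicEmb Ψ u) =
      Units.map (algebraMap (Fv 𝔭) (Local 𝔭 B) : Fv 𝔭 →* Local 𝔭 B)
        (Units.map (algebraMap (Ov 𝔭) (Fv 𝔭) : Ov 𝔭 →* Fv 𝔭) c) := by
    rw [componentUnits_adelicEmb, hc]
    ext1
    exact (localMap 𝔭 Ψ).commutes _
  have hcomm : Commute (adelicEmb Ψ u) (atP ι w.out) := by
    refine commute_atPlace _ _ _ ?_
    rw [hloc]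
    exact Units.ext (Algebra.commutes _ _)
  have hmem : adelicEmb Ψ u ∈ level ι R C := by
    refine mem_level_iff.2 ⟨?_, ?_⟩
    · intro v _
      rw [componentUnits_adelicEmb]
      exact localMap_mem_unitsOf v hΨ (hu₁ v)
    · rw [hloc]
      convert hC c
      exact Units.ext (ι.commutes _)
  rw [valueAt, valueAt, mul_assoc, hcomm.eq, ← mul_assoc]
  have := hΦ 1 (b * atP ι w.out) _ hmem 1
  rwa [map_one, one_mul, map_one, mul_one] at this

lemma toHlev_eq_iff (j : ℕ) (s t : (Adelic F K)ˣ) :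
    toHlev 𝔭 K j s = toHlev 𝔭 K j t ↔ ∃ x : Kˣ, ∃ a ∈ unitsAway 𝔭 K, ∃ u ∈ localU 𝔭 K j,
      t = diagonal F K x * s * a * atPlace K 𝔭 u := by
  have hcomm : ∀ a b : (Adelic F K)ˣ, a * b = b * a := fun a b => Units.ext (mul_comm _ _)
  rw [toHlev, toHlev, QuotientGroup.eq]
  constructor
  · rintro ⟨u, hu, h⟩
    have h' : (QuotientGroup.mk (atPlace K 𝔭 u) : Hinf 𝔭 K) = QuotientGroup.mk (s⁻¹ * t) := h
    rw [QuotientGroup.eq, Subgroup.mem_sup_of_normal_right] at h'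
    obtain ⟨_, ⟨x, rfl⟩, a, ha, h'⟩ := h'
    refine ⟨x, a, ha, u, hu, ?_⟩
    have : t = s * atPlace K 𝔭 u * (diagonal F K x * a) := by rw [h']; group
    rw [this, mul_assoc s, hcomm (atPlace K 𝔭 u), ← mul_assoc, ← mul_assoc, hcomm s]
  · rintro ⟨x, a, ha, u, hu, rfl⟩
    refine ⟨u, hu, ?_⟩
    change (QuotientGroup.mk (atPlace K 𝔭 u) : Hinf 𝔭 K) =
      QuotientGroup.mk (s⁻¹ * (diagonal F K x * s * a * atPlace K 𝔭 u))
    rw [QuotientGroup.eq, Subgroup.mem_sup_of_normal_right]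
    refine ⟨_, ⟨x, rfl⟩, a, ha, ?_⟩
    rw [hcomm (diagonal F K x) s, mul_assoc s, mul_assoc s, inv_mul_cancel_left,
      hcomm (_ * a), inv_mul_cancel_left]

lemma toHlev_surjective (j : ℕ) : Function.Surjective (toHlev 𝔭 K j) := fun t =>
  ⟨t.out.out, by rw [toHlev, QuotientGroup.out_eq', QuotientGroup.out_eq']⟩

lemma proj_toHlev (j : ℕ) (t : (Adelic F K)ˣ) :
    proj 𝔭 K j (toHlev 𝔭 K (j + 1) t) = toHlev 𝔭 K j t := rfl

/-- Two representatives of a class differ by factors from K^×, U and (1 + 𝔭^j O_{K,𝔭})^×. They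
disappear respectively by left B^×-invariance, by `valueAt_unitsAway`, and because the last group
fixes `w j`. -/
lemma IsAutomorphicForm.phiK_toHlev
    (hC : ∀ c : (Ov 𝔭)ˣ, scalarHom 𝔭 (Units.map (algebraMap (Ov 𝔭) (Fv 𝔭) : Ov 𝔭 →* Fv 𝔭) c) ∈ C)
    (hΦ : IsAutomorphicForm (level ι R C) Φ)
    {Ψ : K →ₐ[F] B} (hΨ : IsOptimal R Ψ) {w : ℕ → GL2 𝔭 ⧸ (C ⊔ scalars 𝔭)} {j : ℕ}
    (hw : ∀ u ∈ localU 𝔭 K j, torus ι Ψ u • w j = w j) (t : (Adelic F K)ˣ) :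
    phiK ι Ψ Φ w j (toHlev 𝔭 K j t) = valueAt ι Φ (adelicEmb Ψ t) (w j) := by
  have h : toHlev 𝔭 K j t = toHlev 𝔭 K j (toHlev 𝔭 K j t).out.out := by
    rw [toHlev, toHlev, QuotientGroup.out_eq', QuotientGroup.out_eq']
  obtain ⟨x, a, ha, u, hu, h⟩ := (toHlev_eq_iff j _ _).1 h
  rw [phiK, h, map_mul, hΦ.valueAt_atPlace, hw u hu, map_mul, hΦ.valueAt_unitsAway hC hΨ _ ha,
    map_mul, adelicEmb_diagonal, hΦ.valueAt_diagonal]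

end Values

/-! ### Approximation in F_v and in the finite adeles of F -/

section Valuation

variable {F : Type*} [Field F] [NumberField F] (v : Place F)

lemma valued_integer (a : 𝓞 F) :
    Valued.v (algebraMap (𝓞 F) (Fv v) a) = v.intValuation a := by
  rw [← valuation_of_algebraMap (K := F), ← valuedAdicCompletion_eq_valuation]
  rfl

lemma exists_uniformizer : ∃ π : 𝓞 F, Valued.v (algebraMap (𝓞 F) (Fv v) π) = exp (-1 : ℤ) := by
  obtain ⟨π, hπ⟩ := v.intValuation_exists_uniformizer
  refine ⟨π, ?_⟩
  rw [← hπ, valued_integer]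

lemma dvd_iff_valued_le {x y : Ov v} : x ∣ y ↔ Valued.v (y : Fv v) ≤ Valued.v (x : Fv v) :=
  (adicCompletionIntegers.integers F v).dvd_iff_le

lemma mem_maximalIdeal_iff {x : Ov v} :
    x ∈ IsLocalRing.maximalIdeal (Ov v) ↔ Valued.v (x : Fv v) < 1 := by
  rw [IsLocalRing.mem_maximalIdeal, mem_nonunits_iff,
    adicCompletionIntegers.isUnit_iff_valued_eq_one]
  exact ⟨fun h => lt_of_le_of_ne x.2 h, fun h => h.ne⟩

/-- Discreteness of the value group: it turns strict inequalities into divisibility by a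
uniformizer. -/
lemma lt_one_iff_le_exp {a : ℤᵐ⁰} : a < 1 ↔ a ≤ exp (-1 : ℤ) := by
  induction a using WithZero.expRecOn with
  | zero => simp
  | exp a => rw [← exp_zero, exp_lt_exp, exp_le_exp]; omega

lemma maximalIdeal_eq_span {π : Ov v} (hπ : Valued.v (π : Fv v) = exp (-1 : ℤ)) :
    IsLocalRing.maximalIdeal (Ov v) = Ideal.span {π} := by
  ext x
  rw [mem_maximalIdeal_iff, Ideal.mem_span_singleton, dvd_iff_valued_le, hπ, lt_one_iff_le_exp]

lemma mem_maximalIdeal_pow_iff {x : Ov v} (n : ℕ) :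
    x ∈ IsLocalRing.maximalIdeal (Ov v) ^ n ↔ Valued.v (x : Fv v) ≤ exp (-(n : ℤ)) := by
  obtain ⟨π, hπ⟩ := exists_uniformizer v
  rw [maximalIdeal_eq_span v (π := algebraMap (𝓞 F) (Ov v) π) hπ, Ideal.span_singleton_pow,
    Ideal.mem_span_singleton, dvd_iff_valued_le]
  have : Valued.v (((algebraMap (𝓞 F) (Ov v) π) ^ n : Ov v) : Fv v) = exp (-(n : ℤ)) := by
    change Valued.v ((algebraMap (𝓞 F) (Fv v) π) ^ n) = _
    rw [map_pow, hπ, ← exp_nsmul]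
    simp
  rw [this]

lemma valued_algebraMap_le_iff (a : 𝓞 F) (n : ℕ) :
    Valued.v (algebraMap (𝓞 F) (Fv v) a) ≤ exp (-(n : ℤ)) ↔ a ∈ v.asIdeal ^ n := by
  rw [← intValuation_le_pow_iff_mem, valued_integer]

/-- `O_F` is dense in `O_{F_v}`. -/
lemma exists_integer_sub_le (x : Ov v) (n : ℕ) :
    ∃ a : 𝓞 F, Valued.v ((x : Fv v) - algebraMap (𝓞 F) (Fv v) a) ≤ exp (-(n : ℤ)) := by
  obtain ⟨π, hπ⟩ := exists_uniformizer v
  have hπn : Valued.v (algebraMap (𝓞 F) (Fv v) π ^ n) = exp (-(n : ℤ)) := by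
    rw [map_pow, hπ, ← exp_nsmul]
    simp
  -- This set is x + π^n O_v, an open neighbourhood of x. It meets F in some y, which is v-integral
  -- and can itself be approximated by an element of O_F.
  have hopen : IsOpen {y : Fv v | (y - x) * (algebraMap (𝓞 F) (Fv v) π ^ n)⁻¹ ∈ Ov v} :=
    (Valued.isOpen_valuationSubring (Fv v)).preimage
      ((continuous_mul_const _).comp (continuous_sub_right (x : Fv v)))
  obtain ⟨y, hy⟩ := (denseRange_algebraMap F v).exists_mem_open hopen ⟨x, by simp⟩
  have hy' : Valued.v ((x : Fv v) - algebraMap F (Fv v) y) ≤ exp (-(n : ℤ)) := by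
    have hy : Valued.v ((algebraMap F (Fv v) y - x) * (algebraMap (𝓞 F) (Fv v) π ^ n)⁻¹) ≤ 1 := hy
    rw [map_mul, map_inv₀, hπn, ← div_eq_mul_inv, div_le_one₀ (by simp)] at hy
    rwa [Valuation.map_sub_swap]
  have hy1 : v.valuation F y ≤ 1 := by
    rw [← valuedAdicCompletion_eq_valuation']
    have : algebraMap F (Fv v) y = x - (x - algebraMap F (Fv v) y) := by ring
    change Valued.v (algebraMap F (Fv v) y) ≤ 1
    rw [this]
    refine Valuation.map_sub_le _ x.2 (hy'.trans ?_)
    rw [← exp_zero, exp_le_exp]; omega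
  obtain ⟨a, ha⟩ := v.exists_valuation_sub_lt_of_integer hy1
    (Units.mk0 (exp (-(n : ℤ))) exp_ne_zero)
  refine ⟨a, ?_⟩
  have : (x : Fv v) - algebraMap (𝓞 F) (Fv v) a =
      (x - algebraMap F (Fv v) y) - algebraMap F (Fv v) (algebraMap (𝓞 F) F a - y) := by
    rw [map_sub, ← IsScalarTower.algebraMap_apply]; ring
  rw [this]
  refine Valuation.map_sub_le _ hy' ?_
  change Valued.v ((algebraMap (𝓞 F) F a - y : F) : Fv v) ≤ _
  rw [valuedAdicCompletion_eq_valuation']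
  exact ha.le

lemma finite_valued_lt_one {N : 𝓞 F} (hN : N ≠ 0) :
    {v : Place F | Valued.v (algebraMap (𝓞 F) (Fv v) N) < 1}.Finite := by
  have : ∀ v : Place F, Valued.v (algebraMap (𝓞 F) (Fv v) N) < 1 ↔
      v.asIdeal ∣ Ideal.span {N} := fun v => by
    rw [← v.intValuation_lt_one_iff_dvd, valued_integer]
  simp_rw [this]
  exact Ideal.finite_factors (by simpa using hN)

lemma exists_valued_eq_exp {N : 𝓞 F} (hN : N ≠ 0) :
    ∃ n : ℕ, Valued.v (algebraMap (𝓞 F) (Fv v) N) = exp (-(n : ℤ)) := by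
  refine ⟨multiplicity v.asIdeal (Ideal.span {N}), ?_⟩
  rw [← v.intValuation_eq_exp_neg_multiplicity hN, valued_integer]

/-- An integral adele is congruent to an integer modulo a given nonzero integer. -/
lemma exists_integer_adele_sub_le (a : Fhat F) (ha : ∀ v, a v ∈ Ov v) {N : 𝓞 F} (hN : N ≠ 0) :
    ∃ b : 𝓞 F, ∀ v, Valued.v (a v - algebraMap (𝓞 F) (Fv v) b) ≤
      Valued.v (algebraMap (𝓞 F) (Fv v) N) := by
  choose n hn using fun v : Place F => exists_valued_eq_exp v hN
  choose c hc using fun v : Place F => exists_integer_sub_le v ⟨a v, ha v⟩ (n v)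
  -- Only the finitely many places dividing N impose a condition beyond integrality; there the local
  -- approximations `c v` are glued by the Chinese remainder theorem.
  set s := (finite_valued_lt_one hN).toFinset
  obtain ⟨b, hb⟩ := IsDedekindDomain.exists_forall_sub_mem_ideal (s := s)
    (fun v : Place F => v.asIdeal) n (fun v _ => v.prime)
    (fun v _ w _ h h' => h (HeightOneSpectrum.ext h')) (fun v => c v)
  refine ⟨b, fun v => ?_⟩
  by_cases hv : v ∈ s
  · have h1 := (valued_algebraMap_le_iff v _ _).2 (hb v hv)
    have : a v - algebraMap (𝓞 F) (Fv v) b =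
        (a v - algebraMap (𝓞 F) (Fv v) (c v)) - algebraMap (𝓞 F) (Fv v) (b - c v) := by
      rw [map_sub]; ring
    rw [this, hn]
    exact Valuation.map_sub_le _ (hc v) h1
  · have h1 : Valued.v (algebraMap (𝓞 F) (Fv v) N) = 1 := by
      have h2 : ¬ Valued.v (algebraMap (𝓞 F) (Fv v) N) < 1 := by simpa [s] using hv
      exact le_antisymm (coe_mem_adicCompletionIntegers v N) (not_lt.1 h2)
    rw [h1]
    exact Valuation.map_sub_le _ (ha v) (coe_mem_adicCompletionIntegers v b)

lemma exists_integer_mul_mem (a : Fhat F) :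
    ∃ N : 𝓞 F, N ≠ 0 ∧ ∀ v, algebraMap (𝓞 F) (Fv v) N * a v ∈ Ov v := by
  have hfin : {v : Place F | a v ∉ Ov v}.Finite := a.2
  choose b hb hab using fun v : Place F =>
    adicCompletion.mul_nonZeroDivisor_mem_adicCompletionIntegers v (a v)
  refine ⟨∏ v ∈ hfin.toFinset, b v, Finset.prod_ne_zero_iff.2 fun v _ => nonZeroDivisors.ne_zero (hb v),
    fun v => ?_⟩
  by_cases hv : a v ∈ Ov v
  · exact mul_mem (coe_mem_adicCompletionIntegers v _) hv
  · classical
    rw [← Finset.mul_prod_erase _ _ ((hfin.mem_toFinset (a := v)).2 hv), map_mul, mul_assoc,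
      mul_left_comm, mul_comm _ (a v)]
    exact mul_mem (coe_mem_adicCompletionIntegers v _) (hab v)

lemma exists_integer_of_forall_valued_le {x : F} (h : ∀ v : Place F, algebraMap F (Fv v) x ∈ Ov v) :
    ∃ a : 𝓞 F, algebraMap (𝓞 F) F a = x := by
  refine mem_integers_of_valuation_le_one F x fun v => ?_
  rw [← valuedAdicCompletion_eq_valuation']
  exact h v

end Valuation

/-! ### Dual basis of O_K over O_F -/

section DualBasis

variable (F : Type*) [Field F] [NumberField F] (K : Type*) [Field K] [NumberField K] [Algebra F K]

/-- O_K need not be free over O_F, but it is finite and flat, hence projective. A section s of a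
surjection O_F^n → O_K gives coordinate forms that take O_K into O_F, and these serve in place of a
basis wherever integrality is tested coordinate by coordinate. -/
lemma exists_dual_basis : ∃ (n : ℕ) (m : Fin n → 𝓞 K) (f : Fin n → K →ₗ[F] F),
    (∀ i (x : 𝓞 K), ∃ a : 𝓞 F, f i (algebraMap (𝓞 K) K x) = algebraMap (𝓞 F) F a) ∧
    ∀ y : K, ∑ i, f i y • algebraMap (𝓞 K) K (m i) = y := by
  have : Module.Flat (𝓞 F) (𝓞 K) := inferInstance
  have : Module.Projective (𝓞 F) (𝓞 K) :=
    have := Module.finitePresentation_of_finite (𝓞 F) (𝓞 K)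
    Module.Flat.projective_of_finitePresentation
  obtain ⟨n, p, s, -, -, hps⟩ := Module.Finite.exists_comp_eq_id_of_projective (𝓞 F) (𝓞 K)
  have : IsLocalization (Algebra.algebraMapSubmonoid (𝓞 K) (nonZeroDivisors (𝓞 F))) K :=
    IsIntegralClosure.isLocalization (𝓞 F) F K (𝓞 K)
  have hloc : IsLocalizedModule (nonZeroDivisors (𝓞 F))
      (IsScalarTower.toAlgHom (𝓞 F) (𝓞 K) K).toLinearMap :=
    isLocalizedModule_iff_isLocalization.2 this
  -- The forms are the coordinates of s, extended from O_K to K by localization at the nonzero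
  -- elements of O_F.
  let f : Fin n → K →ₗ[𝓞 F] F := fun i => IsLocalizedModule.map (nonZeroDivisors (𝓞 F))
    (IsScalarTower.toAlgHom (𝓞 F) (𝓞 K) K).toLinearMap (Algebra.linearMap (𝓞 F) F)
    ((LinearMap.proj i).comp s)
  have hf : ∀ i (x : 𝓞 K), f i (algebraMap (𝓞 K) K x) = algebraMap (𝓞 F) F (s x i) := fun i x =>
    IsLocalizedModule.map_apply (nonZeroDivisors (𝓞 F))
      (IsScalarTower.toAlgHom (𝓞 F) (𝓞 K) K).toLinearMap (Algebra.linearMap (𝓞 F) F)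
      ((LinearMap.proj i).comp s) x
  let f' : Fin n → K →ₗ[F] F := fun i =>
    (f i).extendScalarsOfIsLocalization (nonZeroDivisors (𝓞 F)) F
  have hf' : ∀ i (x : 𝓞 K), f' i (algebraMap (𝓞 K) K x) = algebraMap (𝓞 F) F (s x i) := hf
  refine ⟨n, fun i => p (fun j => if i = j then 1 else 0), f', fun i x => ⟨s x i, hf' i x⟩, fun y => ?_⟩
  obtain ⟨⟨x, d⟩, hxd⟩ := IsLocalizedModule.surj (nonZeroDivisors (𝓞 F))
    (IsScalarTower.toAlgHom (𝓞 F) (𝓞 K) K).toLinearMap y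
  have hx : ∑ i, f' i (algebraMap (𝓞 K) K x) • algebraMap (𝓞 K) K (p (fun j => if i = j then 1 else 0)) =
      algebraMap (𝓞 K) K x := by
    have h1 : x = ∑ i, s x i • p (fun j => if i = j then 1 else 0) := by
      rw [← LinearMap.pi_apply_eq_sum_univ, ← LinearMap.comp_apply, hps, LinearMap.id_apply]
    conv_rhs => rw [h1, map_sum]
    refine Finset.sum_congr rfl fun i _ => ?_
    rw [hf', algebraMap_smul, Algebra.smul_def, Algebra.smul_def, map_mul,
      ← IsScalarTower.algebraMap_apply]
  have hxd' : (d : 𝓞 F) • y = algebraMap (𝓞 K) K x := hxd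
  replace hxd' : ((d : 𝓞 F) : F) • y = algebraMap (𝓞 K) K x := by
    rw [← hxd']
    exact algebraMap_smul F (d : 𝓞 F) y
  have hd : ((d : 𝓞 F) : F) ≠ 0 := by simp
  refine smul_right_injective K hd ?_
  change ((d : 𝓞 F) : F) • _ = ((d : 𝓞 F) : F) • y
  rw [hxd', ← hx, ← hxd', Finset.smul_sum]
  simp only [map_smul, smul_assoc]

end DualBasis

/-! ### Integral adeles of K by means of coordinates -/

section Dual

variable {F : Type*} [Field F] [NumberField F] {K : Type*} [Field K] [NumberField K] [Algebra F K]

/-- The extension of scalars of a linear form. -/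
def extendForm (S : Type*) [CommRing S] [Algebra F S] (f : K →ₗ[F] F) : S ⊗[F] K →ₗ[S] S :=
  (TensorProduct.AlgebraTensorModule.rid F S S).toLinearMap ∘ₗ f.baseChange S

lemma extendForm_tmul (S : Type*) [CommRing S] [Algebra F S] (f : K →ₗ[F] F) (s : S) (x : K) :
    extendForm S f (s ⊗ₜ x) = s * algebraMap F S (f x) := by
  rw [extendForm, LinearMap.comp_apply, LinearMap.baseChange_tmul, mul_comm, ← Algebra.smul_def]
  rfl

lemma sum_extendForm (S : Type*) [CommRing S] [Algebra F S] {n : ℕ} {m : Fin n → K}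
    {f : Fin n → K →ₗ[F] F} (h : ∀ y : K, ∑ i, f i y • m i = y) (x : S ⊗[F] K) :
    ∑ i, extendForm S (f i) x ⊗ₜ[F] m i = x := by
  induction x using TensorProduct.induction_on with
  | zero => simp
  | add x y hx hy => simp only [map_add, TensorProduct.add_tmul, Finset.sum_add_distrib, hx, hy]
  | tmul s y =>
    simp only [extendForm_tmul]
    conv_rhs => rw [← h y, TensorProduct.tmul_sum]
    refine Finset.sum_congr rfl fun i _ => ?_
    rw [mul_comm, ← Algebra.smul_def, TensorProduct.smul_tmul]

lemma adele_smul_apply (c : F) (a : Fhat F) (v : Place F) :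
    (c • a) v = algebraMap F (Fv v) c * a v := by
  rw [Algebra.smul_def]; rfl

lemma adele_sub_apply (a b : Fhat F) (v : Place F) : (a - b) v = a v - b v := rfl

lemma extendForm_component (f : K →ₗ[F] F) (v : Place F) (x : Adelic F K) :
    extendForm (Fv v) f (component K v x) = extendForm (Fhat F) f x v := by
  induction x using TensorProduct.induction_on with
  | zero => simp; rfl
  | add x y hx hy => rw [map_add, map_add, map_add, hx, hy]; rfl
  | tmul s y => rw [component_tmul, extendForm_tmul, extendForm_tmul]; rfl

/-- The image of O_K is already closed under multiplication, so the generated subalgebra is the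
linear span. -/
lemma OKv_eq_span (v : Place F) : Subalgebra.toSubmodule (OKv K v) =
    Submodule.span (Ov v) (Set.range fun x : 𝓞 K => (1 : Fv v) ⊗ₜ[F] algebraMap (𝓞 K) K x) := by
  rw [OKv, localOrder, Algebra.adjoin_eq_span, ← Set.range_comp]
  congr 1
  let φ : 𝓞 K →* Local v K := ((Algebra.TensorProduct.includeRight : K →ₐ[F] Local v K) :
    K →* Local v K).comp (algebraMap (𝓞 K) K : 𝓞 K →* K)
  have : Set.range ((fun a : K => (1 : Fv v) ⊗ₜ[F] a) ∘ algebraMap (𝓞 K) K) =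
    (MonoidHom.mrange φ : Set (Local v K)) := rfl
  rw [this, Submonoid.closure_eq]
  rfl

lemma one_tmul_mem_OKv (v : Place F) (x : 𝓞 K) :
    (1 : Fv v) ⊗ₜ[F] algebraMap (𝓞 K) K x ∈ OKv K v :=
  Algebra.subset_adjoin ⟨_, ⟨x, rfl⟩, rfl⟩

lemma tmul_mem_OKv {v : Place F} {a : Fv v} (ha : a ∈ Ov v) (x : 𝓞 K) :
    a ⊗ₜ[F] algebraMap (𝓞 K) K x ∈ OKv K v := by
  have : a ⊗ₜ[F] algebraMap (𝓞 K) K x = (⟨a, ha⟩ : Ov v) • (1 : Fv v) ⊗ₜ[F] algebraMap (𝓞 K) K x := by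
    rw [TensorProduct.smul_tmul']
    change _ = (a * 1) ⊗ₜ[F] _
    rw [mul_one]
  rw [this]
  exact Subalgebra.smul_mem _ (one_tmul_mem_OKv v x) _

lemma extendForm_mem {v : Place F} {f : K →ₗ[F] F}
    (hf : ∀ x : 𝓞 K, ∃ a : 𝓞 F, f (algebraMap (𝓞 K) K x) = algebraMap (𝓞 F) F a)
    {x : Local v K} (hx : x ∈ OKv K v) : extendForm (Fv v) f x ∈ Ov v := by
  rw [← Subalgebra.mem_toSubmodule, OKv_eq_span] at hx
  induction hx using Submodule.span_induction with
  | mem x hx =>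
    obtain ⟨y, rfl⟩ := hx
    obtain ⟨a, ha⟩ := hf y
    rw [extendForm_tmul, ha, one_mul]
    exact coe_mem_adicCompletionIntegers v a
  | zero => rw [map_zero]; exact zero_mem _
  | add x y _ _ hx hy => rw [map_add]; exact add_mem hx hy
  | smul a x _ hx =>
    have : a • x = (a : Fv v) • x := rfl
    rw [this, map_smul]
    exact mul_mem a.2 hx

lemma extendForm_mem_pow {𝔭 : Place F} {f : K →ₗ[F] F}
    (hf : ∀ x : 𝓞 K, ∃ a : 𝓞 F, f (algebraMap (𝓞 K) K x) = algebraMap (𝓞 F) F a)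
    {j : ℕ} {x : Local 𝔭 K} (hx : x ∈ ideal 𝔭 K j) :
    Valued.v (extendForm (Fv 𝔭) f x) ≤ exp (-(j : ℤ)) := by
  induction hx using Submodule.smul_induction_on' with
  | smul a ha x hx =>
    have : a • x = (a : Fv 𝔭) • x := rfl
    rw [this, map_smul, smul_eq_mul, map_mul, ← mul_one (exp _)]
    exact mul_le_mul' ((mem_maximalIdeal_pow_iff 𝔭 j).1 ha) (extendForm_mem hf hx)
  | add x _ y _ hx hy => rw [map_add]; exact Valuation.map_add_le _ hx hy

/-- An element of `O_K` that lies in `𝔭^j O_{K,𝔭}` lies in `𝔭^j O_K`. -/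
lemma mem_map_pow_of_mem_ideal {𝔭 : Place F} {j : ℕ} {y : 𝓞 K}
    (hy : (1 : Fv 𝔭) ⊗ₜ[F] algebraMap (𝓞 K) K y ∈ ideal 𝔭 K j) :
    y ∈ (𝔭.asIdeal ^ j).map (algebraMap (𝓞 F) (𝓞 K)) := by
  obtain ⟨n, m, f, hf, hsum⟩ := exists_dual_basis F K
  choose a ha using fun i => hf i y
  have hay : y = ∑ i, algebraMap (𝓞 F) (𝓞 K) (a i) * m i := by
    refine FaithfulSMul.algebraMap_injective (𝓞 K) K ?_
    rw [map_sum]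
    conv_lhs => rw [← hsum (algebraMap (𝓞 K) K y)]
    refine Finset.sum_congr rfl fun i _ => ?_
    rw [ha, map_mul, Algebra.smul_def, ← IsScalarTower.algebraMap_apply,
      ← IsScalarTower.algebraMap_apply]
  rw [hay]
  refine sum_mem fun i _ => Ideal.mul_mem_right _ _ (Ideal.mem_map_of_mem _ ?_)
  rw [← valued_algebraMap_le_iff]
  have := extendForm_mem_pow (hf i) hy
  rwa [extendForm_tmul, one_mul, ha, ← IsScalarTower.algebraMap_apply] at this

/-- An element of `K` that is integral at all places lies in `O_K`. -/
lemma exists_integer_of_forall_mem_OKv {y : K} (hy : ∀ v : Place F, (1 : Fv v) ⊗ₜ[F] y ∈ OKv K v) :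
    ∃ x : 𝓞 K, algebraMap (𝓞 K) K x = y := by
  obtain ⟨n, m, f, hf, hsum⟩ := exists_dual_basis F K
  have h : ∀ i, ∃ a : 𝓞 F, algebraMap (𝓞 F) F a = f i y := fun i =>
    exists_integer_of_forall_valued_le fun v => by
      simpa only [extendForm_tmul, one_mul] using extendForm_mem (hf i) (hy v)
  choose a ha using h
  refine ⟨∑ i, algebraMap (𝓞 F) (𝓞 K) (a i) * m i, ?_⟩
  rw [map_sum, ← hsum y]
  refine Finset.sum_congr rfl fun i _ => ?_
  rw [← ha, map_mul, Algebra.smul_def, ← IsScalarTower.algebraMap_apply,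
    ← IsScalarTower.algebraMap_apply]

variable (F K) in
/-- The ring of finite adeles of `K` that are integral at all places. -/
def integralAdeles : Subring (Adelic F K) :=
  ⨅ v : Place F, (OKv K v).toSubring.comap (component K v : Adelic F K →+* Local v K)

lemma mem_integralAdeles {x : Adelic F K} :
    x ∈ integralAdeles F K ↔ ∀ v, component K v x ∈ OKv K v := by
  simp only [integralAdeles, Subring.mem_iInf]
  rfl

lemma tmul_mem_integralAdeles {a : Fhat F} (ha : ∀ v, a v ∈ Ov v) (x : 𝓞 K) :
    a ⊗ₜ[F] algebraMap (𝓞 K) K x ∈ integralAdeles F K :=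
  mem_integralAdeles.2 fun v => tmul_mem_OKv (ha v) x

lemma one_tmul_mem_integralAdeles (x : 𝓞 K) :
    (1 : Fhat F) ⊗ₜ[F] algebraMap (𝓞 K) K x ∈ integralAdeles F K :=
  tmul_mem_integralAdeles (fun _ => one_mem _) x

/-- Each of the finitely many coordinates has a denominator in O_F; the product of these
denominators works. -/
lemma exists_mul_mem_integralAdeles (x : Adelic F K) :
    ∃ N : 𝓞 F, N ≠ 0 ∧ algebraMap (𝓞 F) F N • x ∈ integralAdeles F K := by
  obtain ⟨n, m, f, hf, hsum⟩ := exists_dual_basis F K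
  choose N hN0 hN using fun i => exists_integer_mul_mem (extendForm (Fhat F) (f i) x)
  refine ⟨∏ i, N i, Finset.prod_ne_zero_iff.2 fun i _ => hN0 i, ?_⟩
  rw [← sum_extendForm (Fhat F) hsum x, Finset.smul_sum]
  refine sum_mem fun i hi => ?_
  rw [TensorProduct.smul_tmul']
  refine tmul_mem_integralAdeles (fun v => ?_) _
  have : (algebraMap (𝓞 F) F (∏ i, N i) • extendForm (Fhat F) (f i) x) v =
      algebraMap (𝓞 F) (Fv v) (∏ j ∈ Finset.univ.erase i, N j) *
        (algebraMap (𝓞 F) (Fv v) (N i) * extendForm (Fhat F) (f i) x v) := by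
    rw [← mul_assoc, ← map_mul, mul_comm (Finset.prod _ _), Finset.mul_prod_erase _ _ hi,
      Algebra.smul_def]
    rfl
  rw [this]
  exact mul_mem (coe_mem_adicCompletionIntegers v _) (hN i v)

/-- An integral adele of `K` is congruent to an element of `O_K` modulo a given integer. -/
lemma exists_integer_add_mul {x : Adelic F K} (hx : x ∈ integralAdeles F K) {N : 𝓞 F}
    (hN : N ≠ 0) : ∃ y : 𝓞 K, ∃ z ∈ integralAdeles F K,
      x = 1 ⊗ₜ algebraMap (𝓞 K) K y + algebraMap (𝓞 F) F N • z := by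
  obtain ⟨n, m, f, hf, hsum⟩ := exists_dual_basis F K
  have ha : ∀ i v, extendForm (Fhat F) (f i) x v ∈ Ov v := fun i v => by
    rw [← extendForm_component]
    exact extendForm_mem (hf i) (mem_integralAdeles.1 hx v)
  choose b hb using fun i => exists_integer_adele_sub_le _ (ha i) hN
  have hN' : algebraMap (𝓞 F) F N ≠ 0 := by simpa using hN
  -- `c i` is the remainder of the i-th coordinate after subtracting `b i`, divided by N; the choice
  -- of `b i` makes it integral at every place.
  let c : Fin n → Fhat F := fun i => (algebraMap (𝓞 F) F N)⁻¹ •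
    (extendForm (Fhat F) (f i) x - algebraMap F (Fhat F) (b i))
  have hc : ∀ i v, c i v ∈ Ov v := fun i v => by
    have : c i v = (algebraMap (𝓞 F) (Fv v) N)⁻¹ *
        (extendForm (Fhat F) (f i) x v - algebraMap (𝓞 F) (Fv v) (b i)) := by
      rw [adele_smul_apply, adele_sub_apply, IsScalarTower.algebraMap_apply (𝓞 F) F (Fv v),
        map_inv₀ (algebraMap F (Fv v))]
      rfl
    rw [this, mem_adicCompletionIntegers, map_mul, map_inv₀, mul_comm, ← div_eq_mul_inv]
    exact div_le_one_of_le₀ (hb i v) zero_le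
  have hxc : ∀ i, extendForm (Fhat F) (f i) x =
      algebraMap F (Fhat F) (b i) + algebraMap (𝓞 F) F N • c i := fun i => by
    simp only [c]
    rw [smul_inv_smul₀ hN']
    ring
  refine ⟨∑ i, algebraMap (𝓞 F) (𝓞 K) (b i) * m i, ∑ i, c i ⊗ₜ algebraMap (𝓞 K) K (m i),
    sum_mem fun i _ => tmul_mem_integralAdeles (hc i) _, ?_⟩
  rw [map_sum, TensorProduct.tmul_sum, Finset.smul_sum, ← Finset.sum_add_distrib]
  conv_lhs => rw [← sum_extendForm (Fhat F) hsum x]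
  refine Finset.sum_congr rfl fun i _ => ?_
  rw [hxc, TensorProduct.add_tmul, TensorProduct.smul_tmul', Algebra.algebraMap_eq_smul_one,
    TensorProduct.smul_tmul, map_mul, Algebra.smul_def, ← IsScalarTower.algebraMap_apply,
    ← IsScalarTower.algebraMap_apply]

end Dual

/-! ### Finiteness of H_0 -/

section Finiteness

variable {F : Type*} [Field F] [NumberField F] {K : Type*} [Field K] [NumberField K] [Algebra F K]

/-- Removing the 𝔭-component from a unit of Ô_K leaves an element of U, so units of Ô_K are trivial
in H_0. -/
lemma unitsAway_mul_atPlace_aux (𝔭 : Place F) {u : (Adelic F K)ˣ}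
    (hu : (u : Adelic F K) ∈ integralAdeles F K)
    (hu' : ((u⁻¹ : (Adelic F K)ˣ) : Adelic F K) ∈ integralAdeles F K) :
    componentUnits K 𝔭 u ∈ localU 𝔭 K 0 ∧
      u * (atPlace K 𝔭 (componentUnits K 𝔭 u))⁻¹ ∈ unitsAway 𝔭 K := by
  have h : ∀ v, componentUnits K v u ∈ unitsOf (OKv K v) := fun v =>
    ⟨mem_integralAdeles.1 hu v, mem_integralAdeles.1 hu' v⟩
  refine ⟨⟨h 𝔭, ?_⟩, mem_unitsAway_iff.2 ⟨fun v => ?_, ?_⟩⟩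
  · rw [ideal, pow_zero, Ideal.one_eq_top, Submodule.top_smul]
    exact Subalgebra.sub_mem _ (h 𝔭).1 (one_mem (OKv K 𝔭))
  · by_cases hv : v = 𝔭
    · subst hv
      rw [map_mul, map_inv, componentUnits_atPlace_self, mul_inv_cancel]
      exact one_mem _
    · rw [map_mul, map_inv, componentUnits_atPlace_of_ne hv, inv_one, mul_one]
      exact h v
  · rw [map_mul, map_inv, componentUnits_atPlace_self, mul_inv_cancel]
    exact one_mem _

lemma toHlev_zero_eq_of_integral (𝔭 : Place F) {s t : (Adelic F K)ˣ} {x : Kˣ}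
    (h : ((diagonal F K x * s⁻¹ * t : (Adelic F K)ˣ) : Adelic F K) ∈ integralAdeles F K)
    (h' : (((diagonal F K x * s⁻¹ * t)⁻¹ : (Adelic F K)ˣ) : Adelic F K) ∈ integralAdeles F K) :
    toHlev 𝔭 K 0 s = toHlev 𝔭 K 0 t := by
  obtain ⟨h1, h2⟩ := unitsAway_mul_atPlace_aux 𝔭 h h'
  have hcomm : ∀ a b : (Adelic F K)ˣ, a * b = b * a := fun a b => Units.ext (mul_comm _ _)
  refine (toHlev_eq_iff _ _ _).2 ⟨x⁻¹, _, h2, _, h1, ?_⟩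
  rw [mul_assoc _ _ (atPlace K 𝔭 _), inv_mul_cancel_right, map_inv, mul_assoc _ s⁻¹ t,
    mul_assoc _ s, hcomm s, ← mul_assoc, inv_mul_cancel_left, hcomm s⁻¹ t, inv_mul_cancel_right]

/-- The ideal of all `y ∈ O_K` with `y ∈ t Ô_K`. -/
def ideleIdeal (t : (Adelic F K)ˣ) : Ideal (𝓞 K) where
  carrier := {y | ((t⁻¹ : (Adelic F K)ˣ) : Adelic F K) * (1 ⊗ₜ algebraMap (𝓞 K) K y) ∈
    integralAdeles F K}
  zero_mem' := by simp
  add_mem' {x y} hx hy := by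
    rw [Set.mem_ofPred_eq, map_add, TensorProduct.tmul_add, mul_add]
    exact add_mem hx hy
  smul_mem' c x hx := by
    have : (1 : Fhat F) ⊗ₜ[F] algebraMap (𝓞 K) K (c * x) =
        (1 ⊗ₜ algebraMap (𝓞 K) K c) * (1 ⊗ₜ algebraMap (𝓞 K) K x) := by
      rw [Algebra.TensorProduct.tmul_mul_tmul, map_mul, mul_one]
    rw [Set.mem_ofPred_eq, smul_eq_mul, this, mul_left_comm]
    exact mul_mem (one_tmul_mem_integralAdeles c) hx

lemma mem_ideleIdeal {t : (Adelic F K)ˣ} {y : 𝓞 K} : y ∈ ideleIdeal t ↔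
    ((t⁻¹ : (Adelic F K)ˣ) : Adelic F K) * (1 ⊗ₜ algebraMap (𝓞 K) K y) ∈ integralAdeles F K :=
  Iff.rfl

lemma smul_eq_mul_tmul (N : 𝓞 F) (x : Adelic F K) : algebraMap (𝓞 F) F N • x =
    x * (1 ⊗ₜ algebraMap (𝓞 K) K (algebraMap (𝓞 F) (𝓞 K) N)) := by
  rw [← IsScalarTower.algebraMap_apply, IsScalarTower.algebraMap_apply (𝓞 F) F K,
    Algebra.algebraMap_eq_smul_one (algebraMap (𝓞 F) F N), TensorProduct.tmul_smul,
    ← Algebra.TensorProduct.one_def, mul_smul_comm, mul_one]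

lemma exists_mem_ideleIdeal (t : (Adelic F K)ˣ) :
    ∃ N : 𝓞 F, N ≠ 0 ∧ algebraMap (𝓞 F) (𝓞 K) N ∈ ideleIdeal t := by
  obtain ⟨N, hN, h⟩ := exists_mul_mem_integralAdeles ((t⁻¹ : (Adelic F K)ˣ) : Adelic F K)
  exact ⟨N, hN, by rwa [mem_ideleIdeal, ← smul_eq_mul_tmul]⟩

lemma ideleIdeal_ne_bot (t : (Adelic F K)ˣ) : ideleIdeal t ≠ ⊥ := by
  obtain ⟨N, hN, h⟩ := exists_mem_ideleIdeal t
  intro h0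
  rw [h0, Ideal.mem_bot] at h
  exact hN ((FaithfulSMul.algebraMap_eq_zero_iff (𝓞 F) (𝓞 K)).1 h)

/-- The hypothesis says that a maps the ideal of t into the ideal of s, so a s⁻¹ carries the ideal
of t into Ô_K. It remains to pass from that ideal to t itself: t is a combination of two of its
elements with coefficients in Ô_K. -/
lemma integral_of_mul_ideleIdeal_le {s t : (Adelic F K)ˣ}
    (ht : (t : Adelic F K) ∈ integralAdeles F K) {x y : 𝓞 K} (hy : y ≠ 0)
    (h : Ideal.span {x} * ideleIdeal t ≤ Ideal.span {y} * ideleIdeal s) (a : Kˣ)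
    (ha : (a : K) * algebraMap (𝓞 K) K y = algebraMap (𝓞 K) K x) :
    ((diagonal F K a * s⁻¹ * t : (Adelic F K)ˣ) : Adelic F K) ∈ integralAdeles F K := by
  have key : ∀ z ∈ ideleIdeal t, ((diagonal F K a * s⁻¹ : (Adelic F K)ˣ) : Adelic F K) *
      (1 ⊗ₜ algebraMap (𝓞 K) K z) ∈ integralAdeles F K := fun z hz => by
    obtain ⟨w, hw, hyw⟩ := Ideal.mem_span_singleton_mul.1
      (h (Ideal.mul_mem_mul (Ideal.mem_span_singleton_self x) hz))
    have hw' := mem_ideleIdeal.1 hw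
    have haz : (a : K) * algebraMap (𝓞 K) K z = algebraMap (𝓞 K) K w := by
      have hy' : algebraMap (𝓞 K) K y ≠ 0 := by simpa using hy
      refine mul_left_cancel₀ hy' ?_
      rw [← map_mul, hyw, map_mul, ← ha]; ring
    have : ((diagonal F K a * s⁻¹ : (Adelic F K)ˣ) : Adelic F K) * (1 ⊗ₜ algebraMap (𝓞 K) K z) =
        ((s⁻¹ : (Adelic F K)ˣ) : Adelic F K) * (1 ⊗ₜ algebraMap (𝓞 K) K w) := by
      rw [← haz, Units.val_mul, mul_comm _ ((s⁻¹ : (Adelic F K)ˣ) : Adelic F K), mul_assoc]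
      congr 1
      change (1 ⊗ₜ (a : K)) * _ = _
      rw [Algebra.TensorProduct.tmul_mul_tmul, mul_one]
    rw [this]
    exact hw'
  -- Write t = z + N c with N in the ideal of t, z ∈ O_K and c integral. Then z also lies in that
  -- ideal, since t⁻¹ z = 1 - c t⁻¹ N.
  obtain ⟨N, hN, hNt⟩ := exists_mem_ideleIdeal t
  obtain ⟨z, c, hc, htz⟩ := exists_integer_add_mul ht hN
  have hz : z ∈ ideleIdeal t := by
    have h1 : (1 : Fhat F) ⊗ₜ algebraMap (𝓞 K) K z = (t : Adelic F K) - algebraMap (𝓞 F) F N • c := by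
      rw [htz, add_sub_cancel_right]
    rw [mem_ideleIdeal, h1, mul_sub, Units.inv_mul, smul_eq_mul_tmul, mul_left_comm]
    exact sub_mem (one_mem _) (mul_mem hc hNt)
  have h2 : ((diagonal F K a * s⁻¹ * t : (Adelic F K)ˣ) : Adelic F K) =
      ((diagonal F K a * s⁻¹ : (Adelic F K)ˣ) : Adelic F K) * (1 ⊗ₜ algebraMap (𝓞 K) K z) +
      c * (((diagonal F K a * s⁻¹ : (Adelic F K)ˣ) : Adelic F K) *
        (1 ⊗ₜ algebraMap (𝓞 K) K (algebraMap (𝓞 F) (𝓞 K) N))) := by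
    rw [Units.val_mul _ t, htz, smul_eq_mul_tmul, mul_add, mul_left_comm c]
  rw [h2]
  exact add_mem (key z hz) (mul_mem hc (key _ hNt))

lemma exists_integral_toHlev_eq (𝔭 : Place F) (j : ℕ) (h : Hlev 𝔭 K j) :
    ∃ t : (Adelic F K)ˣ, (t : Adelic F K) ∈ integralAdeles F K ∧ toHlev 𝔭 K j t = h := by
  obtain ⟨t, rfl⟩ := toHlev_surjective j h
  obtain ⟨N, hN, hNt⟩ := exists_mul_mem_integralAdeles (t : Adelic F K)
  have hN' : algebraMap (𝓞 K) K (algebraMap (𝓞 F) (𝓞 K) N) ≠ 0 := by simpa using hN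
  refine ⟨diagonal F K (Units.mk0 _ hN') * t, ?_, ?_⟩
  · rw [smul_eq_mul_tmul, mul_comm] at hNt
    exact hNt
  · symm
    exact (toHlev_eq_iff _ _ _).2 ⟨Units.mk0 _ hN', 1, one_mem _, 1, one_mem _,
      by rw [map_one, mul_one, mul_one]⟩

/-- The group `H_0` is finite. -/
lemma finite_Hlev_zero (𝔭 : Place F) : Finite (Hlev 𝔭 K 0) := by
  choose t ht hth using exists_integral_toHlev_eq (K := K) 𝔭 0
  -- If two ideals are in the same class, the quotient a = x / y of their multipliers makes a s⁻¹ t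
  -- and its inverse integral, so s and t agree in H_0. Integral representatives t are used so that
  -- `integral_of_mul_ideleIdeal_le` applies.
  refine Finite.of_injective (fun h => ClassGroup.mk0
    ⟨ideleIdeal (t h), mem_nonZeroDivisors_of_ne_zero (ideleIdeal_ne_bot (t h))⟩) fun h h' hh => ?_
  obtain ⟨x, y, hx, hy, hxy⟩ := ClassGroup.mk0_eq_mk0_iff.1 hh
  have hxy : Ideal.span {x} * ideleIdeal (t h) = Ideal.span {y} * ideleIdeal (t h') := hxy
  have hx' : algebraMap (𝓞 K) K x ≠ 0 := by simpa using hx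
  have hy' : algebraMap (𝓞 K) K y ≠ 0 := by simpa using hy
  let a : Kˣ := Units.mk0 (algebraMap (𝓞 K) K x / algebraMap (𝓞 K) K y) (div_ne_zero hx' hy')
  have h1 := integral_of_mul_ideleIdeal_le (ht h) hy hxy.le a (div_mul_cancel₀ _ hy')
  have h2 := integral_of_mul_ideleIdeal_le (ht h') hx hxy.ge a⁻¹
    (by rw [Units.val_inv_eq_inv_val, Units.val_mk0, inv_div, div_mul_cancel₀ _ hx'])
  have h3 : diagonal F K a⁻¹ * (t h)⁻¹ * t h' = (diagonal F K a * (t h')⁻¹ * t h)⁻¹ := by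
    have hcomm : ∀ a b : (Adelic F K)ˣ, a * b = b * a := fun a b => Units.ext (mul_comm _ _)
    rw [mul_inv_rev, mul_inv_rev, inv_inv, map_inv, hcomm _ (t h)⁻¹]
    rw [mul_assoc, hcomm _ (t h')]
  rw [h3] at h2
  rw [← hth h, ← hth h', toHlev_zero_eq_of_integral 𝔭 h1 h2]

end Finiteness

/-! ### The local order O_{K,𝔭} and its unit filtration -/

section LocalOrder

variable {F : Type*} [Field F] [NumberField F] {𝔭 : Place F}
  {K : Type*} [Field K] [NumberField K] [Algebra F K]

lemma isIntegral_of_mem_OKv {v : Place F} {x : Local v K} (hx : x ∈ OKv K v) :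
    IsIntegral (Ov v) x := by
  have h : Algebra.IsIntegral (Ov v) (OKv K v) := Algebra.IsIntegral.adjoin <| by
    rintro _ ⟨_, ⟨y, rfl⟩, rfl⟩
    have h1 : IsIntegral (𝓞 F) (algebraMap (𝓞 K) K y) :=
      (Algebra.IsIntegral.isIntegral (R := 𝓞 F) y).map (IsScalarTower.toAlgHom (𝓞 F) (𝓞 K) K)
    refine h1.map_of_comp_eq (algebraMap (𝓞 F) (Ov v))
      ((Algebra.TensorProduct.includeRight : K →ₐ[F] Local v K) : K →+* Local v K) ?_
    ext a
    change algebraMap F (Local v K) (algebraMap (𝓞 F) F a) = _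
    rw [RingHom.comp_apply, IsScalarTower.algebraMap_apply (𝓞 F) F K]
    exact ((Algebra.TensorProduct.includeRight : K →ₐ[F] Local v K).commutes _).symm
  exact (h.isIntegral (⟨x, hx⟩ : OKv K v)).map (OKv K v).val

/-- O_{K,v} is integral over the integrally closed ring O_v, hence meets F_v in O_v. -/
lemma mem_Ov_of_algebraMap_mem {v : Place F} {c : Fv v}
    (h : algebraMap (Fv v) (Local v K) c ∈ OKv K v) : c ∈ Ov v := by
  have h1 : IsIntegral (Ov v) c :=
    (isIntegral_algebraMap_iff (FaithfulSMul.algebraMap_injective (Fv v) (Local v K))).1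
      (isIntegral_of_mem_OKv h)
  obtain ⟨y, hy⟩ := IsIntegrallyClosed.isIntegral_iff.1 h1
  rw [← hy]
  exact y.2

lemma algebraMap_mem_OKv (v : Place F) (c : Ov v) :
    algebraMap (Fv v) (Local v K) c ∈ OKv K v :=
  Subalgebra.algebraMap_mem (OKv K v) c

lemma OKv_fg (v : Place F) : (Subalgebra.toSubmodule (OKv K v)).FG := by
  obtain ⟨n, m, f, hf, hsum⟩ := exists_dual_basis F K
  refine Submodule.fg_def.2 ⟨_, Set.finite_range fun i => (1 : Fv v) ⊗ₜ[F] algebraMap (𝓞 K) K (m i),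
    le_antisymm (Submodule.span_le.2 ?_) fun x hx => ?_⟩
  · rintro _ ⟨i, rfl⟩
    exact one_tmul_mem_OKv v (m i)
  · rw [← sum_extendForm (Fv v) hsum x]
    refine sum_mem fun i _ => ?_
    have : extendForm (Fv v) (f i) x ⊗ₜ[F] algebraMap (𝓞 K) K (m i) =
        (⟨_, extendForm_mem (hf i) hx⟩ : Ov v) • (1 : Fv v) ⊗ₜ[F] algebraMap (𝓞 K) K (m i) := by
      rw [TensorProduct.smul_tmul']
      exact congrArg (· ⊗ₜ[F] _) (mul_one _).symm
    rw [this]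
    exact Submodule.smul_mem _ _ (Submodule.subset_span ⟨i, rfl⟩)

/-- Nakayama's lemma for the finitely generated O_{F_𝔭}-module O_{K,𝔭}. -/
lemma OKv_le_of_le_sup {N : Submodule (Ov 𝔭) (Local 𝔭 K)}
    (h : Subalgebra.toSubmodule (OKv K 𝔭) ≤ N ⊔ ideal 𝔭 K 1) :
    Subalgebra.toSubmodule (OKv K 𝔭) ≤ N := by
  rw [ideal, pow_one] at h
  exact Submodule.le_of_le_smul_of_le_jacobson_bot (OKv_fg 𝔭)
    (IsLocalRing.maximalIdeal_le_jacobson _) h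

lemma ideal_zero : ideal 𝔭 K 0 = Subalgebra.toSubmodule (OKv K 𝔭) := by
  rw [ideal, pow_zero, Ideal.one_eq_top, Submodule.top_smul]

lemma ideal_antitone {i j : ℕ} (h : i ≤ j) : ideal 𝔭 K j ≤ ideal 𝔭 K i :=
  Submodule.smul_mono_left (Ideal.pow_le_pow_right h)

lemma mem_OKv_of_mem_ideal {j : ℕ} {x : Local 𝔭 K} (hx : x ∈ ideal 𝔭 K j) : x ∈ OKv K 𝔭 := by
  have := ideal_antitone (Nat.zero_le j) hx
  rwa [ideal_zero] at this

/-- Multiplication by 1 + z is the identity modulo 𝔭, hence surjective on O_{K,𝔭} by Nakayama; no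
geometric series is needed. -/
lemma exists_mul_eq_one_of_mem_ideal {z : Local 𝔭 K} (hz : z ∈ ideal 𝔭 K 1) :
    ∃ w ∈ OKv K 𝔭, (1 + z) * w = 1 := by
  have h : Subalgebra.toSubmodule (OKv K 𝔭) ≤
      (Subalgebra.toSubmodule (OKv K 𝔭)).map (LinearMap.mulLeft (Ov 𝔭) (1 + z)) := by
    refine OKv_le_of_le_sup fun x hx => ?_
    have : x = (1 + z) * x + -(x * z) := by ring
    rw [this]
    exact add_mem (Submodule.mem_sup_left ⟨x, hx, rfl⟩)
      (Submodule.mem_sup_right (neg_mem (ideal_mul_mem 𝔭 K 1 hx hz)))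
  exact h (one_mem (OKv K 𝔭))

/-- The elements of `1 + 𝔭^j O_{K,𝔭}` are units if `j ≥ 1`. -/
lemma exists_localU {j : ℕ} (hj : 1 ≤ j) {z : Local 𝔭 K} (hz : z ∈ ideal 𝔭 K j) :
    ∃ u ∈ localU 𝔭 K j, (u : Local 𝔭 K) = 1 + z := by
  obtain ⟨w, hw, h⟩ := exists_mul_eq_one_of_mem_ideal (ideal_antitone hj hz)
  refine ⟨⟨1 + z, w, h, by rw [mul_comm, h]⟩,
    ⟨⟨add_mem (one_mem (OKv K 𝔭)) (mem_OKv_of_mem_ideal hz), hw⟩, ?_⟩, rfl⟩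
  rwa [add_sub_cancel_left]

lemma mem_ideal_iff {π : Ov 𝔭} (hπ : Valued.v (π : Fv 𝔭) = exp (-1 : ℤ)) {j : ℕ} {x : Local 𝔭 K} :
    x ∈ ideal 𝔭 K j ↔ ∃ y ∈ OKv K 𝔭, π ^ j • y = x := by
  rw [ideal, maximalIdeal_eq_span 𝔭 hπ, Ideal.span_singleton_pow, Submodule.ideal_span_singleton_smul]
  exact Submodule.mem_smul_pointwise_iff_exists _ _ _

variable (𝔭) in
lemma exists_local_uniformizer : ∃ π : Ov 𝔭, Valued.v (π : Fv 𝔭) = exp (-1 : ℤ) := by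
  obtain ⟨π, hπ⟩ := exists_uniformizer 𝔭
  exact ⟨algebraMap (𝓞 F) (Ov 𝔭) π, hπ⟩

lemma smul_injective_of_ne_zero {π : Ov 𝔭} (hπ : π ≠ 0) :
    Function.Injective fun x : Local 𝔭 K => π • x := by
  have h : (π : Fv 𝔭) ≠ 0 := fun h => hπ (Subtype.ext h)
  exact smul_right_injective (R := Fv 𝔭) (Local 𝔭 K) h

lemma one_notMem_ideal_one : (1 : Local 𝔭 K) ∉ ideal 𝔭 K 1 := by
  obtain ⟨π, hπ⟩ := exists_local_uniformizer 𝔭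
  intro h
  obtain ⟨y, hy, h⟩ := (mem_ideal_iff hπ).1 h
  have hπ0 : (π : Fv 𝔭) ≠ 0 := fun h0 => by rw [h0, map_zero] at hπ; exact exp_ne_zero hπ.symm
  have : y = algebraMap (Fv 𝔭) (Local 𝔭 K) (π : Fv 𝔭)⁻¹ := by
    rw [pow_one] at h
    change (π : Fv 𝔭) • y = 1 at h
    rw [Algebra.algebraMap_eq_smul_one, ← h, inv_smul_smul₀ hπ0]
  rw [this] at hy
  have h1 : Valued.v (π : Fv 𝔭)⁻¹ ≤ 1 := mem_Ov_of_algebraMap_mem hy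
  rw [map_inv₀, hπ, ← exp_neg, ← exp_zero, exp_le_exp] at h1
  omega

/-- There is an element of `O_{K,𝔭}` that is not congruent to a scalar modulo `𝔭`. -/
lemma exists_notMem_sup (hK : Module.finrank F K = 2) :
    ∃ τ ∈ OKv K 𝔭, τ ∉ Submodule.span (Ov 𝔭) {(1 : Local 𝔭 K)} ⊔ ideal 𝔭 K 1 := by
  by_contra! h
  -- Otherwise Nakayama gives O_{K,𝔭} = O_{F_𝔭}, and K_𝔭 would have dimension at most 1 over F_𝔭.
  have h1 : Subalgebra.toSubmodule (OKv K 𝔭) ≤ Submodule.span (Ov 𝔭) {(1 : Local 𝔭 K)} :=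
    OKv_le_of_le_sup h
  have h2 : ∀ x : Local 𝔭 K, ∃ c : Fv 𝔭, c • (1 : Local 𝔭 K) = x := fun x => by
    obtain ⟨n, m, f, hf, hsum⟩ := exists_dual_basis F K
    rw [← Submodule.mem_span_singleton, ← sum_extendForm (Fv 𝔭) hsum x]
    refine sum_mem fun i _ => ?_
    obtain ⟨c, hc⟩ := Submodule.mem_span_singleton.1 (h1 (one_tmul_mem_OKv 𝔭 (m i)))
    rw [← mul_one (extendForm (Fv 𝔭) (f i) x), ← smul_eq_mul, ← TensorProduct.smul_tmul', ← hc]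
    exact Submodule.smul_mem _ _ (Submodule.smul_mem _ (c : Fv 𝔭) (Submodule.mem_span_singleton_self _))
  have h3 : Module.finrank (Fv 𝔭) (Local 𝔭 K) ≤ 1 := finrank_le_one 1 h2
  rw [Module.finrank_baseChange, hK] at h3
  omega

/-- A residue of a scalar plus a multiple of `τ` modulo `𝔭^n`. -/
lemma mem_pow_of_add_smul_mem {τ : Local 𝔭 K} (hτ : τ ∈ OKv K 𝔭)
    (hτ' : τ ∉ Submodule.span (Ov 𝔭) {(1 : Local 𝔭 K)} ⊔ ideal 𝔭 K 1) (n : ℕ) {a b : Ov 𝔭}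
    (h : a • (1 : Local 𝔭 K) + b • τ ∈ ideal 𝔭 K n) :
    a ∈ IsLocalRing.maximalIdeal (Ov 𝔭) ^ n ∧ b ∈ IsLocalRing.maximalIdeal (Ov 𝔭) ^ n := by
  obtain ⟨π, hπ⟩ := exists_local_uniformizer 𝔭
  have hπ0 : π ≠ 0 := fun h0 => by
    rw [h0, ZeroMemClass.coe_zero, map_zero] at hπ; exact exp_ne_zero hπ.symm
  rw [maximalIdeal_eq_span 𝔭 hπ, Ideal.span_singleton_pow, Ideal.mem_span_singleton,
    Ideal.mem_span_singleton]
  induction n generalizing a b with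
  | zero => simp
  | succ n ih =>
    have h1 := ideal_antitone (Nat.succ_le_succ (Nat.zero_le n)) h
    have unit_smul : ∀ {c : Ov 𝔭} {x : Local 𝔭 K} {N : Submodule (Ov 𝔭) (Local 𝔭 K)},
        IsUnit c → c • x ∈ N → x ∈ N := fun {c x N} hc hx => by
      obtain ⟨c, rfl⟩ := hc
      have := N.smul_mem (c⁻¹ : (Ov 𝔭)ˣ).1 hx
      rwa [smul_smul, Units.inv_mul, one_smul] at this
    have dvd_of_not : ∀ {c : Ov 𝔭}, ¬ IsUnit c → ∃ d, c = π * d := fun {c} hc => by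
      have : c ∈ IsLocalRing.maximalIdeal (Ov 𝔭) := (IsLocalRing.mem_maximalIdeal c).2 hc
      rwa [maximalIdeal_eq_span 𝔭 hπ, Ideal.mem_span_singleton] at this
    have hsmul : ∀ {c : Ov 𝔭} {x : Local 𝔭 K}, x ∈ OKv K 𝔭 → (π * c) • x ∈ ideal 𝔭 K 1 :=
      fun {c x} hx => (mem_ideal_iff hπ).2 ⟨c • x, Subalgebra.smul_mem _ hx c, by
        rw [pow_one, smul_smul]⟩
    -- A unit b would express τ as a scalar modulo 𝔭. So π divides b, then π divides a because 1 ∉ 𝔭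
    -- O_{K,𝔭}, and dividing by π lowers n.
    have hb : ¬ IsUnit b := fun hb => hτ' <| unit_smul hb <| by
      have : b • τ = (-a) • (1 : Local 𝔭 K) + (a • (1 : Local 𝔭 K) + b • τ) := by
        rw [neg_smul, neg_add_cancel_left]
      rw [this]
      exact add_mem (Submodule.mem_sup_left (Submodule.smul_mem _ _
        (Submodule.mem_span_singleton_self _))) (Submodule.mem_sup_right h1)
    obtain ⟨b, rfl⟩ := dvd_of_not hb
    have ha : ¬ IsUnit a := fun ha => one_notMem_ideal_one <| unit_smul ha <| by
      have := sub_mem h1 (hsmul hτ (c := b))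
      rwa [add_sub_cancel_right] at this
    obtain ⟨a, rfl⟩ := dvd_of_not ha
    obtain ⟨y, hy, h⟩ := (mem_ideal_iff hπ).1 h
    have h2 : a • (1 : Local 𝔭 K) + b • τ ∈ ideal 𝔭 K n :=
      (mem_ideal_iff hπ).2 ⟨y, hy, smul_injective_of_ne_zero hπ0 <| by
        change π • _ = π • _
        rw [smul_add, smul_smul, smul_smul, smul_smul, ← h, pow_succ']⟩
    rw [pow_succ']
    exact ⟨mul_dvd_mul_left π (ih h2).1, mul_dvd_mul_left π (ih h2).2⟩

lemma mem_sup_localScalars_iff {j : ℕ} {x : (Local 𝔭 K)ˣ} :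
    x ∈ localU 𝔭 K j ⊔ localScalars K 𝔭 ↔ ∃ w ∈ localU 𝔭 K j, ∃ c : (Fv 𝔭)ˣ,
      x = w * Units.map (algebraMap (Fv 𝔭) (Local 𝔭 K) : Fv 𝔭 →* Local 𝔭 K) c := by
  have : (localScalars K 𝔭).Normal := ⟨fun n hn g => by
    have h : g * n * g⁻¹ = n := by
      rw [mul_inv_eq_iff_eq_mul]
      exact Units.ext (mul_comm (g : Local 𝔭 K) (n : Local 𝔭 K))
    rwa [h]⟩
  rw [Subgroup.mem_sup_of_normal_right]
  constructor
  · rintro ⟨w, hw, _, ⟨c, rfl⟩, rfl⟩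
    exact ⟨w, hw, c, rfl⟩
  · rintro ⟨w, hw, c, rfl⟩
    exact ⟨w, hw, _, ⟨c, rfl⟩, rfl⟩

/-- A family of elements of `(1 + 𝔭^j O_{K,𝔭})^×`, indexed by the residue field, that are
inequivalent modulo `(1 + 𝔭^(j+1) O_{K,𝔭})^× F_𝔭^×`. -/
lemma exists_localU_family (hK : Module.finrank F K = 2) {j : ℕ} (hj : 1 ≤ j) :
    ∃ u : IsLocalRing.ResidueField (Ov 𝔭) → (Local 𝔭 K)ˣ, (∀ b, u b ∈ localU 𝔭 K j) ∧
      ∀ b b', (u b)⁻¹ * u b' ∈ localU 𝔭 K (j + 1) ⊔ localScalars K 𝔭 → b = b' := by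
  obtain ⟨τ, hτ, hτ'⟩ := exists_notMem_sup (𝔭 := 𝔭) hK
  obtain ⟨π, hπ⟩ := exists_local_uniformizer 𝔭
  have hπ0 : π ≠ 0 := fun h0 => by
    rw [h0, ZeroMemClass.coe_zero, map_zero] at hπ; exact exp_ne_zero hπ.symm
  choose r hr using IsLocalRing.residue_surjective (R := Ov 𝔭)
  -- The family is u b = 1 + π^j r(b) τ, where r lifts residues to O_{F_𝔭}.
  choose u hu hu' using fun b => exists_localU hj (z := π ^ j • r b • τ)
    ((mem_ideal_iff hπ).2 ⟨_, Subalgebra.smul_mem _ hτ (r b), rfl⟩)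
  refine ⟨u, hu, fun b b' h => ?_⟩
  obtain ⟨w, hw, c, hwc⟩ := mem_sup_localScalars_iff.1 h
  have hub' : u b' = u b * w * Units.map (algebraMap (Fv 𝔭) (Local 𝔭 K) : Fv 𝔭 →* Local 𝔭 K) c := by
    rw [mul_assoc, ← hwc, mul_inv_cancel_left]
  have hc : (c : Fv 𝔭) ∈ Ov 𝔭 := by
    have : Units.map (algebraMap (Fv 𝔭) (Local 𝔭 K) : Fv 𝔭 →* Local 𝔭 K) c ∈ unitsOf (OKv K 𝔭) := by
      have h1 : Units.map (algebraMap (Fv 𝔭) (Local 𝔭 K) : Fv 𝔭 →* Local 𝔭 K) c =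
        w⁻¹ * ((u b)⁻¹ * u b') := by rw [hwc, inv_mul_cancel_left]
      rw [h1]
      exact mul_mem (inv_mem hw.1) (mul_mem (inv_mem (hu b).1) (hu b').1)
    exact mem_Ov_of_algebraMap_mem this.1
  have hval : (u b' : Local 𝔭 K) = (u b : Local 𝔭 K) * w * algebraMap (Fv 𝔭) (Local 𝔭 K) c :=
    congrArg Units.val hub'
  have hcmap : algebraMap (Fv 𝔭) (Local 𝔭 K) c = (⟨c, hc⟩ : Ov 𝔭) • (1 : Local 𝔭 K) :=
    Algebra.algebraMap_eq_smul_one _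
  generalize (⟨c, hc⟩ : Ov 𝔭) = d at hcmap
  -- This element is u b' - d u b = d u b (w - 1) with w ∈ 1 + 𝔭^(j+1) O_{K,𝔭}. Comparing
  -- coefficients gives d ≡ 1 and then r b' ≡ r b modulo 𝔭.
  have hmem : (1 - d) • (1 : Local 𝔭 K) + (π ^ j * (r b' - d * r b)) • τ ∈ ideal 𝔭 K (j + 1) := by
    have h1 : (1 - d) • (1 : Local 𝔭 K) + (π ^ j * (r b' - d * r b)) • τ =
        d • ((u b : Local 𝔭 K) * ((w : Local 𝔭 K) - 1)) := by
      have h2 : d • ((u b : Local 𝔭 K) * ((w : Local 𝔭 K) - 1)) = u b' - d • (u b : Local 𝔭 K) := by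
        rw [hval, hcmap, mul_sub, smul_sub, mul_smul_comm, mul_one, mul_one]
      rw [h2, hu', hu', mul_sub, sub_smul, sub_smul, mul_smul, mul_smul, mul_smul, one_smul,
        smul_add, smul_comm (π ^ j) d]
      abel
    rw [h1]
    exact Submodule.smul_mem _ _ (ideal_mul_mem 𝔭 K _ (hu b).1.1 hw.2)
  obtain ⟨h1, h2⟩ := mem_pow_of_add_smul_mem hτ hτ' (j + 1) hmem
  have h3 : 1 - d ∈ IsLocalRing.maximalIdeal (Ov 𝔭) :=
    Ideal.pow_le_self (Nat.succ_ne_zero j) h1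
  have h4 : r b' - d * r b ∈ IsLocalRing.maximalIdeal (Ov 𝔭) := by
    rw [maximalIdeal_eq_span 𝔭 hπ, Ideal.span_singleton_pow, Ideal.mem_span_singleton, pow_succ] at h2
    rw [maximalIdeal_eq_span 𝔭 hπ, Ideal.mem_span_singleton]
    exact (mul_dvd_mul_iff_left (pow_ne_zero j hπ0)).1 h2
  have h5 : r b' - r b ∈ IsLocalRing.maximalIdeal (Ov 𝔭) := by
    have : r b' - r b = (r b' - d * r b) - (1 - d) * r b := by ring
    rw [this]
    exact sub_mem h4 (Ideal.mul_mem_right _ _ h3)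
  have h6 := (IsLocalRing.residue_eq_zero_iff _).2 h5
  rw [map_sub, hr, hr, sub_eq_zero] at h6
  exact h6.symm

end LocalOrder

/-! ### Stability and the fibres of H_{j+1} → H_j -/

section Stability

variable {F : Type*} [Field F] [NumberField F] {𝔭 : Place F}
  {K : Type*} [Field K] [NumberField K] [Algebra F K]

/-- The scalar units of `K_𝔭`. -/
def localScalarHom (𝔭 : Place F) (K : Type*) [Field K] [Algebra F K] :
    (Fv 𝔭)ˣ →* (Local 𝔭 K)ˣ :=
  Units.map (algebraMap (Fv 𝔭) (Local 𝔭 K) : Fv 𝔭 →* Local 𝔭 K)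

/-- The embedding `O_{F_𝔭}^× → F_𝔭^×`. -/
def integerUnits (𝔭 : Place F) : (Ov 𝔭)ˣ →* (Fv 𝔭)ˣ :=
  Units.map (algebraMap (Ov 𝔭) (Fv 𝔭) : Ov 𝔭 →* Fv 𝔭)

lemma integerUnits_mem_unitsOf_bot (v : Place F) (c : (Ov v)ˣ) :
    localScalarHom v K (integerUnits v c) ∈ unitsOf (⊥ : Subalgebra (Ov v) (Local v K)) :=
  ⟨Algebra.mem_bot.2 ⟨(c : Ov v), rfl⟩, Algebra.mem_bot.2 ⟨((c⁻¹ : (Ov v)ˣ) : Ov v), rfl⟩⟩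

lemma unitsOf_bot_le (v : Place F) :
    unitsOf (⊥ : Subalgebra (Ov v) (Local v K)) ≤ unitsOf (OKv K v) := fun _ hx =>
  ⟨bot_le (a := OKv K v) hx.1, bot_le (a := OKv K v) hx.2⟩

lemma exists_integerUnits {c : (Fv 𝔭)ˣ} (h : localScalarHom 𝔭 K c ∈ unitsOf (OKv K 𝔭)) :
    ∃ d, integerUnits 𝔭 d = c := by
  have h1 : (c : Fv 𝔭) ∈ Ov 𝔭 := mem_Ov_of_algebraMap_mem h.1
  have h2 : ((c⁻¹ : (Fv 𝔭)ˣ) : Fv 𝔭) ∈ Ov 𝔭 := mem_Ov_of_algebraMap_mem h.2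
  exact ⟨⟨⟨_, h1⟩, ⟨_, h2⟩, Subtype.ext c.mul_inv, Subtype.ext c.inv_mul⟩, Units.ext rfl⟩

lemma atPlace_integerUnits_mem (c : (Ov 𝔭)ˣ) :
    atPlace K 𝔭 (localScalarHom 𝔭 K (integerUnits 𝔭 c)) ∈ unitsAway 𝔭 K := by
  refine mem_unitsAway_iff.2 ⟨fun v => ?_, ?_⟩
  · by_cases hv : v = 𝔭
    · subst hv
      rw [componentUnits_atPlace_self]
      exact unitsOf_bot_le _ (integerUnits_mem_unitsOf_bot _ c)
    · rw [componentUnits_atPlace_of_ne hv]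
      exact one_mem _
  · rw [componentUnits_atPlace_self]
    exact integerUnits_mem_unitsOf_bot _ c

lemma one_tmul_mem_ideal {j : ℕ} {y : 𝓞 K}
    (hy : y ∈ (𝔭.asIdeal ^ j).map (algebraMap (𝓞 F) (𝓞 K))) :
    (1 : Fv 𝔭) ⊗ₜ[F] algebraMap (𝓞 K) K y ∈ ideal 𝔭 K j := by
  induction hy using Submodule.span_induction with
  | mem x hx =>
    obtain ⟨a, ha, rfl⟩ := hx
    have h1 : (1 : Fv 𝔭) ⊗ₜ[F] algebraMap (𝓞 K) K (algebraMap (𝓞 F) (𝓞 K) a) =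
        algebraMap (𝓞 F) (Ov 𝔭) a • (1 : Local 𝔭 K) := by
      rw [← Algebra.algebraMap_eq_smul_one, ← IsScalarTower.algebraMap_apply,
        IsScalarTower.algebraMap_apply (𝓞 F) F K]
      exact (Algebra.TensorProduct.includeRight : K →ₐ[F] Local 𝔭 K).commutes _
    rw [h1]
    refine Submodule.smul_mem_smul ?_ (one_mem (OKv K 𝔭))
    rw [mem_maximalIdeal_pow_iff]
    exact (valued_algebraMap_le_iff 𝔭 a j).2 ha
  | zero => simp
  | add x y _ _ hx hy => rw [map_add, TensorProduct.tmul_add]; exact add_mem hx hy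
  | smul a x _ hx =>
    have h1 : (1 : Fv 𝔭) ⊗ₜ[F] algebraMap (𝓞 K) K (a • x) =
        ((1 : Fv 𝔭) ⊗ₜ[F] algebraMap (𝓞 K) K a) * ((1 : Fv 𝔭) ⊗ₜ[F] algebraMap (𝓞 K) K x) := by
      rw [Algebra.TensorProduct.tmul_mul_tmul, smul_eq_mul, map_mul, mul_one]
    rw [h1]
    exact ideal_mul_mem 𝔭 K j (one_tmul_mem_OKv 𝔭 a) hx

lemma one_tmul_sub (y : 𝓞 K) (a : 𝓞 F) :
    (1 : Fv 𝔭) ⊗ₜ[F] algebraMap (𝓞 K) K (y - algebraMap (𝓞 F) (𝓞 K) a) =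
      (1 : Fv 𝔭) ⊗ₜ[F] algebraMap (𝓞 K) K y -
        algebraMap (Fv 𝔭) (Local 𝔭 K) (algebraMap (𝓞 F) (Fv 𝔭) a) := by
  rw [map_sub, TensorProduct.tmul_sub, ← IsScalarTower.algebraMap_apply,
    IsScalarTower.algebraMap_apply (𝓞 F) F K]
  congr 1
  exact (Algebra.TensorProduct.includeRight : K →ₐ[F] Local 𝔭 K).commutes _

/-- An integer of `K` that is congruent to a local scalar modulo `𝔭^j` lies in the order of
conductor `𝔭^j`. -/
lemma memOrder_of_sub_mem {j : ℕ} {y : 𝓞 K} (c : Ov 𝔭)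
    (h : (1 : Fv 𝔭) ⊗ₜ[F] algebraMap (𝓞 K) K y - algebraMap (Fv 𝔭) (Local 𝔭 K) c ∈ ideal 𝔭 K j) :
    MemOrder 𝔭 j y := by
  -- Density of O_F in O_{F_𝔭} replaces the local scalar by a global integer.
  obtain ⟨a, ha⟩ := exists_integer_sub_le 𝔭 c j
  refine ⟨a, mem_map_pow_of_mem_ideal ?_⟩
  have h1 : algebraMap (Fv 𝔭) (Local 𝔭 K) (c - algebraMap (𝓞 F) (Fv 𝔭) a) ∈ ideal 𝔭 K j := by
    have h2 : algebraMap (Fv 𝔭) (Local 𝔭 K) (c - algebraMap (𝓞 F) (Fv 𝔭) a) =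
        (c - algebraMap (𝓞 F) (Ov 𝔭) a) • (1 : Local 𝔭 K) :=
      Algebra.algebraMap_eq_smul_one _
    rw [h2]
    exact Submodule.smul_mem_smul ((mem_maximalIdeal_pow_iff 𝔭 j).2 ha) (one_mem (OKv K 𝔭))
  rw [one_tmul_sub]
  have h3 := add_mem h h1
  rwa [map_sub, sub_add_sub_cancel] at h3

lemma componentUnits_diagonal (v : Place F) (x : Kˣ) :
    ((componentUnits K v (diagonal F K x) : (Local v K)ˣ) : Local v K) = 1 ⊗ₜ (x : K) := rfl

/-- If `j` is stable, then a local unit that is trivial in `H_{j+1}` is a scalar modulo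
`𝔭^(j+1)`. -/
lemma mem_sup_of_eq_diagonal_mul {j : ℕ} (hj : UnitsStable 𝔭 K j) {w : (Local 𝔭 K)ˣ}
    (hw : w ∈ localU 𝔭 K j) {x : Kˣ} {a : (Adelic F K)ˣ} (ha : a ∈ unitsAway 𝔭 K)
    (h : atPlace K 𝔭 w = diagonal F K x * a) :
    w ∈ localU 𝔭 K (j + 1) ⊔ localScalars K 𝔭 := by
  obtain ⟨ha, ha𝔭⟩ := mem_unitsAway_iff.1 ha
  obtain ⟨c, hc⟩ := exists_unit_of_mem_unitsOf_bot ha𝔭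
  have hc : componentUnits K 𝔭 a = localScalarHom 𝔭 K (integerUnits 𝔭 c) := hc
  have hx : ∀ v, componentUnits K v (diagonal F K x) ∈ unitsOf (OKv K v) := fun v => by
    have h1 : componentUnits K v (diagonal F K x) =
        componentUnits K v (atPlace K 𝔭 w) * (componentUnits K v a)⁻¹ := by
      rw [h, map_mul, mul_inv_cancel_right]
    rw [h1]
    refine mul_mem ?_ (inv_mem (ha v))
    by_cases hv : v = 𝔭
    · subst hv
      rw [componentUnits_atPlace_self]
      exact hw.1
    · rw [componentUnits_atPlace_of_ne hv]
      exact one_mem _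
  have hx𝔭 : w = componentUnits K 𝔭 (diagonal F K x) * localScalarHom 𝔭 K (integerUnits 𝔭 c) := by
    rw [← hc, ← map_mul, ← h, componentUnits_atPlace_self]
  -- Both x and its inverse are integral at every place, so x is a global unit y of O_K, and w = y c
  -- at 𝔭.
  obtain ⟨y, hy⟩ := exists_integer_of_forall_mem_OKv (F := F) (y := (x : K)) fun v => (hx v).1
  obtain ⟨z, hz⟩ := exists_integer_of_forall_mem_OKv (F := F) (y := ((x⁻¹ : Kˣ) : K)) fun v => (hx v).2
  have hyz : y * z = 1 := FaithfulSMul.algebraMap_injective (𝓞 K) K (by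
    rw [map_mul, hy, hz, map_one, Units.mul_inv])
  let y' : (𝓞 K)ˣ := ⟨y, z, hyz, by rw [mul_comm, hyz]⟩
  have hwval : (w : Local 𝔭 K) =
      ((1 : Fv 𝔭) ⊗ₜ[F] algebraMap (𝓞 K) K y) * algebraMap (Fv 𝔭) (Local 𝔭 K) (c : Ov 𝔭) := by
    rw [hy]
    exact congrArg Units.val hx𝔭
  have hcinv : algebraMap (Fv 𝔭) (Local 𝔭 K) (c : Ov 𝔭) *
      algebraMap (Fv 𝔭) (Local 𝔭 K) ((c⁻¹ : (Ov 𝔭)ˣ) : Ov 𝔭) = 1 := by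
    rw [← map_mul, ← MulMemClass.coe_mul, Units.mul_inv, OneMemClass.coe_one, map_one]
  -- From w ≡ 1 it follows that y ≡ c⁻¹ modulo 𝔭^j, so y lies in the order of conductor 𝔭^j; this is
  -- where stability is used.
  have hord : MemOrder 𝔭 (j + 1) y := by
    refine hj y' (memOrder_of_sub_mem ((c⁻¹ : (Ov 𝔭)ˣ) : Ov 𝔭) ?_)
    have h1 : (1 : Fv 𝔭) ⊗ₜ[F] algebraMap (𝓞 K) K y -
        algebraMap (Fv 𝔭) (Local 𝔭 K) ((c⁻¹ : (Ov 𝔭)ˣ) : Ov 𝔭) =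
        algebraMap (Fv 𝔭) (Local 𝔭 K) ((c⁻¹ : (Ov 𝔭)ˣ) : Ov 𝔭) * ((w : Local 𝔭 K) - 1) := by
      rw [hwval, mul_sub, mul_one, mul_left_comm,
        mul_comm (algebraMap (Fv 𝔭) (Local 𝔭 K) _), hcinv, mul_one]
    change (1 : Fv 𝔭) ⊗ₜ[F] algebraMap (𝓞 K) K y - _ ∈ _
    rw [h1]
    exact ideal_mul_mem 𝔭 K j (algebraMap_mem_OKv 𝔭 _) hw.2
  obtain ⟨b, hb⟩ := hord
  have hb := one_tmul_mem_ideal hb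
  rw [one_tmul_sub] at hb
  set β : Ov 𝔭 := algebraMap (𝓞 F) (Ov 𝔭) b with hβ
  have hβ' : algebraMap (𝓞 F) (Fv 𝔭) b = β := rfl
  rw [hβ'] at hb
  -- Otherwise the unit y would be congruent to 0 modulo 𝔭 O_{K,𝔭}.
  have hunit : IsUnit β := by
    by_contra hβu
    have h1 : algebraMap (Fv 𝔭) (Local 𝔭 K) β ∈ ideal 𝔭 K 1 := by
      have h2 : algebraMap (Fv 𝔭) (Local 𝔭 K) β = β • (1 : Local 𝔭 K) :=
        Algebra.algebraMap_eq_smul_one _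
      rw [h2, ideal, pow_one]
      exact Submodule.smul_mem_smul ((IsLocalRing.mem_maximalIdeal β).2 hβu) (one_mem (OKv K 𝔭))
    have h2 := add_mem (ideal_antitone (Nat.succ_le_succ (Nat.zero_le j)) hb) h1
    rw [sub_add_cancel] at h2
    refine one_notMem_ideal_one (F := F) (K := K) (𝔭 := 𝔭) ?_
    have h3 := ideal_mul_mem 𝔭 K 1 (one_tmul_mem_OKv 𝔭 z) h2
    rwa [Algebra.TensorProduct.tmul_mul_tmul, ← map_mul, mul_comm z, hyz, map_one, mul_one] at h3
  obtain ⟨d, hd⟩ := hunit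
  rw [← hd] at hb
  have hdinv : algebraMap (Fv 𝔭) (Local 𝔭 K) ((d⁻¹ : (Ov 𝔭)ˣ) : Ov 𝔭) *
      algebraMap (Fv 𝔭) (Local 𝔭 K) (d : Ov 𝔭) = 1 := by
    rw [← map_mul, ← MulMemClass.coe_mul, Units.inv_mul, OneMemClass.coe_one, map_one]
  -- Since y ≡ d modulo 𝔭^(j+1), also w = y c ≡ c d; dividing by this scalar leaves an element of (1
  -- + 𝔭^(j+1) O_{K,𝔭})^×.
  refine mem_sup_localScalars_iff.2 ⟨w * (localScalarHom 𝔭 K (integerUnits 𝔭 (c * d)))⁻¹, ⟨?_, ?_⟩,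
    integerUnits 𝔭 (c * d), (inv_mul_cancel_right _ _).symm⟩
  · exact mul_mem hw.1 (inv_mem (unitsOf_bot_le _ (integerUnits_mem_unitsOf_bot _ _)))
  · have h1 : w * (localScalarHom 𝔭 K (integerUnits 𝔭 (c * d)))⁻¹ =
        componentUnits K 𝔭 (diagonal F K x) * localScalarHom 𝔭 K (integerUnits 𝔭 d⁻¹) := by
      rw [hx𝔭, map_mul, map_mul, map_inv, map_inv, mul_inv_rev, mul_assoc]
      congr 1
      rw [← map_inv, ← map_inv, ← map_inv, ← map_inv, ← map_mul, ← map_mul, ← map_mul, ← map_mul,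
        mul_comm d⁻¹, mul_inv_cancel_left]
    rw [h1]
    have h2 : ((componentUnits K 𝔭 (diagonal F K x) * localScalarHom 𝔭 K (integerUnits 𝔭 d⁻¹) :
        (Local 𝔭 K)ˣ) : Local 𝔭 K) - 1 = algebraMap (Fv 𝔭) (Local 𝔭 K) ((d⁻¹ : (Ov 𝔭)ˣ) : Ov 𝔭) *
          ((1 : Fv 𝔭) ⊗ₜ[F] algebraMap (𝓞 K) K y - algebraMap (Fv 𝔭) (Local 𝔭 K) (d : Ov 𝔭)) := by
      rw [mul_sub, hdinv, Units.val_mul, componentUnits_diagonal, hy, mul_comm]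
      rfl
    rw [h2]
    exact ideal_mul_mem 𝔭 K _ (algebraMap_mem_OKv 𝔭 _) hb

/-- The scalar relating u and u' is an integral unit and is absorbed by U. This direction holds
without stability, which lets it serve for the finiteness of every H_j. -/
lemma toHlev_mul_atPlace_eq_of_mem {j : ℕ} (t : (Adelic F K)ˣ) {u u' : (Local 𝔭 K)ˣ}
    (hu : u ∈ localU 𝔭 K j) (hu' : u' ∈ localU 𝔭 K j)
    (h : u⁻¹ * u' ∈ localU 𝔭 K (j + 1) ⊔ localScalars K 𝔭) :
    toHlev 𝔭 K (j + 1) (t * atPlace K 𝔭 u) = toHlev 𝔭 K (j + 1) (t * atPlace K 𝔭 u') := by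
  have hcomm : ∀ a b : (Adelic F K)ˣ, a * b = b * a := fun a b => Units.ext (mul_comm _ _)
  rw [toHlev_eq_iff]
  obtain ⟨w, hw, c, h⟩ := mem_sup_localScalars_iff.1 h
  have h : u⁻¹ * u' = w * localScalarHom 𝔭 K c := h
  obtain ⟨d, rfl⟩ := exists_integerUnits (K := K) (c := c) (by
    have : localScalarHom 𝔭 K c = w⁻¹ * (u⁻¹ * u') := by rw [h, inv_mul_cancel_left]
    rw [this]
    exact mul_mem (inv_mem hw.1) (mul_mem (inv_mem hu.1) hu'.1))
  refine ⟨1, _, atPlace_integerUnits_mem d, w, hw, ?_⟩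
  have h1 : u' = u * (w * localScalarHom 𝔭 K (integerUnits 𝔭 d)) := by
    rw [← h, mul_inv_cancel_left]
  rw [h1, map_mul, map_mul, map_one, one_mul, hcomm (atPlace K 𝔭 w), mul_assoc, mul_assoc]

/-- If `j` is stable, the kernel of `H_{j+1} → H_j` is the quotient of `(1 + 𝔭^j O_{K,𝔭})^×` by
the scalars modulo `𝔭^(j+1)`. -/
lemma toHlev_mul_atPlace_eq_iff {j : ℕ} (hj : UnitsStable 𝔭 K j) (t : (Adelic F K)ˣ)
    {u u' : (Local 𝔭 K)ˣ} (hu : u ∈ localU 𝔭 K j) (hu' : u' ∈ localU 𝔭 K j) :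
    toHlev 𝔭 K (j + 1) (t * atPlace K 𝔭 u) = toHlev 𝔭 K (j + 1) (t * atPlace K 𝔭 u') ↔
      u⁻¹ * u' ∈ localU 𝔭 K (j + 1) ⊔ localScalars K 𝔭 := by
  have hcomm : ∀ a b : (Adelic F K)ˣ, a * b = b * a := fun a b => Units.ext (mul_comm _ _)
  rw [toHlev_eq_iff]
  constructor
  · rintro ⟨x, a, ha, w, hw, h⟩
    have h1 : atPlace K 𝔭 (u⁻¹ * u' * w⁻¹) = diagonal F K x * a := by
      have h2 : atPlace K 𝔭 u' = atPlace K 𝔭 u * (diagonal F K x * a) * atPlace K 𝔭 w := by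
        refine mul_left_cancel (a := t) ?_
        rw [h, hcomm (diagonal F K x) (t * _)]
        simp only [mul_assoc]
      rw [map_mul, map_mul, map_inv, map_inv, h2]
      group
    have hmem : u⁻¹ * u' * w⁻¹ ∈ localU 𝔭 K j :=
      mul_mem (mul_mem (inv_mem hu) hu') (inv_mem (localU_antitone 𝔭 K j hw))
    have := mul_mem (mem_sup_of_eq_diagonal_mul hj hmem ha h1) (Subgroup.mem_sup_left hw)
    rwa [inv_mul_cancel_right] at this
  · exact fun h => (toHlev_eq_iff _ _ _).1 (toHlev_mul_atPlace_eq_of_mem t hu hu' h)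

/-- The fibres of `H_{j+1} → H_j`. -/
lemma proj_eq_iff (j : ℕ) (t : (Adelic F K)ˣ) (s : Hlev 𝔭 K (j + 1)) :
    proj 𝔭 K j s = toHlev 𝔭 K j t ↔
      ∃ u ∈ localU 𝔭 K j, toHlev 𝔭 K (j + 1) (t * atPlace K 𝔭 u) = s := by
  have hcomm : ∀ a b : (Adelic F K)ˣ, a * b = b * a := fun a b => Units.ext (mul_comm _ _)
  constructor
  · obtain ⟨s, rfl⟩ := toHlev_surjective (j + 1) s
    intro h
    rw [proj_toHlev] at h
    obtain ⟨x, a, ha, u, hu, rfl⟩ := (toHlev_eq_iff _ _ _).1 h.symm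
    refine ⟨u, hu, (toHlev_eq_iff _ _ _).2 ⟨x, a, ha, 1, one_mem _, ?_⟩⟩
    rw [map_one, mul_one, mul_assoc, hcomm a, ← mul_assoc, ← mul_assoc]
  · rintro ⟨u, hu, rfl⟩
    rw [proj_toHlev]
    symm
    exact (toHlev_eq_iff _ _ _).2 ⟨1, 1, one_mem _, u, hu, by rw [map_one, one_mul, mul_one]⟩

end Stability

/-! ### Matrix description of the Hecke cosets -/

section Tree

variable {F : Type*} [Field F] [NumberField F] {𝔭 : Place F}

instance finite_residueField : Finite (IsLocalRing.ResidueField (Ov 𝔭)) := by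
  have : Finite (𝓞 F ⧸ 𝔭.asIdeal) := Ideal.finiteQuotientOfFreeOfNeBot _ 𝔭.ne_bot
  let f : 𝓞 F →+* IsLocalRing.ResidueField (Ov 𝔭) :=
    (IsLocalRing.residue (Ov 𝔭)).comp (algebraMap (𝓞 F) (Ov 𝔭))
  have hf : ∀ a ∈ 𝔭.asIdeal, f a = 0 := fun a ha => by
    refine (IsLocalRing.residue_eq_zero_iff _).2 ?_
    rw [← pow_one (IsLocalRing.maximalIdeal _), mem_maximalIdeal_pow_iff]
    exact (valued_algebraMap_le_iff 𝔭 a 1).2 (by rwa [pow_one])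
  refine Finite.of_surjective (Ideal.Quotient.lift 𝔭.asIdeal f hf) fun y => ?_
  obtain ⟨x, rfl⟩ := IsLocalRing.residue_surjective y
  obtain ⟨a, ha⟩ := exists_integer_sub_le 𝔭 x 1
  refine ⟨Ideal.Quotient.mk _ a, ?_⟩
  rw [Ideal.Quotient.lift_mk, ← sub_eq_zero, RingHom.comp_apply, ← map_sub,
    IsLocalRing.residue_eq_zero_iff, ← neg_mem_iff, neg_sub,
    ← pow_one (IsLocalRing.maximalIdeal _), mem_maximalIdeal_pow_iff]
  exact ha

lemma residue_eq_zero_iff_valued {x : Ov 𝔭} :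
    IsLocalRing.residue (Ov 𝔭) x = 0 ↔ Valued.v (x : Fv 𝔭) < 1 := by
  rw [IsLocalRing.residue_eq_zero_iff, mem_maximalIdeal_iff]

lemma IsUniformizer.valued {ϖ : (Fv 𝔭)ˣ} (h : IsUniformizer ϖ) :
    Valued.v (ϖ : Fv 𝔭) = exp (-1 : ℤ) := by
  obtain ⟨π, hπ, hϖ⟩ := h
  obtain ⟨π', hπ'⟩ := exists_local_uniformizer 𝔭
  rw [← hϖ, ← hπ']
  have h1 : Ideal.span {π} = Ideal.span {π'} := by
    rw [← hπ.maximalIdeal_eq, maximalIdeal_eq_span 𝔭 hπ']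
  obtain ⟨h2, h3⟩ := Ideal.span_singleton_eq_span_singleton.1 h1 |>.dvd_dvd
  exact le_antisymm ((dvd_iff_valued_le 𝔭).1 h3) ((dvd_iff_valued_le 𝔭).1 h2)

lemma inv_apply_fin_two (g : GL2 𝔭) :
    ((g⁻¹ : GL2 𝔭) : Matrix (Fin 2) (Fin 2) (Fv 𝔭)) =
      g.val.det⁻¹ • !![g.val 1 1, -g.val 0 1; -g.val 1 0, g.val 0 0] := by
  rw [Matrix.coe_units_inv, Matrix.inv_def, Matrix.adjugate_fin_two, Ring.inverse_eq_inv']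

lemma det_ne_zero (g : GL2 𝔭) : g.val.det ≠ 0 :=
  ((Matrix.isUnit_iff_isUnit_det _).1 g.isUnit).ne_zero

lemma mem_GL2O_iff {g : GL2 𝔭} : g ∈ GL2O 𝔭 ↔
    (∀ i k, Valued.v (g.val i k) ≤ 1) ∧ Valued.v g.val.det = 1 := by
  have hdet : ∀ g : GL2 𝔭, (∀ i k, Valued.v (g.val i k) ≤ 1) → Valued.v g.val.det ≤ 1 := fun g h => by
    rw [Matrix.det_fin_two]
    refine Valuation.map_sub_le _ ?_ ?_ <;> rw [map_mul] <;> exact mul_le_one' (h _ _) (h _ _)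
  constructor
  · rintro ⟨h1, h2⟩
    have h1 : ∀ i k, Valued.v (g.val i k) ≤ 1 := h1
    have h2 : ∀ i k, Valued.v ((g⁻¹).val i k) ≤ 1 := h2
    refine ⟨h1, le_antisymm (hdet g h1) ?_⟩
    have h3 := hdet g⁻¹ h2
    have h4 : Valued.v g.val.det * Valued.v (g⁻¹).val.det = 1 := by
      rw [← map_mul, ← Matrix.det_mul, Units.mul_inv, Matrix.det_one, map_one]
    calc (1 : ℤᵐ⁰) = Valued.v g.val.det * Valued.v (g⁻¹).val.det := h4.symm
      _ ≤ Valued.v g.val.det * 1 := by gcongr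
      _ = _ := mul_one _
  · rintro ⟨h1, h2⟩
    refine ⟨h1, fun i k => ?_⟩
    change Valued.v ((g⁻¹).val i k) ≤ 1
    rw [inv_apply_fin_two, Matrix.smul_apply, smul_eq_mul, map_mul, map_inv₀, h2, inv_one, one_mul]
    fin_cases i <;> fin_cases k <;> simp [Valuation.map_neg, h1]

lemma mem_iwahori_iff {g : GL2 𝔭} : g ∈ iwahori 𝔭 ↔ g ∈ GL2O 𝔭 ∧ Valued.v (g.val 1 0) < 1 := by
  constructor
  · rintro ⟨h1, h2⟩
    exact ⟨⟨h1.1, h2.1⟩, h1.2⟩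
  · rintro ⟨h, h'⟩
    refine ⟨⟨h.1, h'⟩, h.2, ?_⟩
    change Valued.v ((g⁻¹).val 1 0) < 1
    rw [inv_apply_fin_two, Matrix.smul_apply, smul_eq_mul, map_mul, map_inv₀, (mem_GL2O_iff.1 h).2]
    simpa [Valuation.map_neg] using h'

lemma iwahori_le : iwahori 𝔭 ≤ GL2O 𝔭 := fun _ h => (mem_iwahori_iff.1 h).1

lemma scalarHom_mem_iwahori (c : (Ov 𝔭)ˣ) : scalarHom 𝔭 (integerUnits 𝔭 c) ∈ iwahori 𝔭 := by
  have h : ∀ c : (Ov 𝔭)ˣ, (scalarHom 𝔭 (integerUnits 𝔭 c)).val ∈ eichlerOrder 𝔭 := fun c => by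
    have : (scalarHom 𝔭 (integerUnits 𝔭 c)).val =
      algebraMap (Fv 𝔭) (Matrix (Fin 2) (Fin 2) (Fv 𝔭)) (c : Ov 𝔭) := rfl
    rw [this, Matrix.algebraMap_eq_diagonal]
    refine ⟨fun i k => ?_, by simp⟩
    by_cases hik : i = k
    · subst hik
      rw [Matrix.diagonal_apply_eq]
      exact (c : Ov 𝔭).2
    · rw [Matrix.diagonal_apply_ne _ hik, map_zero]
      exact zero_le
  exact ⟨h c, by
    have := h c⁻¹
    rwa [map_inv, map_inv] at this⟩

lemma diag_val (a b : (Fv 𝔭)ˣ) : (diag a b).val = !![(a : Fv 𝔭), 0; 0, (b : Fv 𝔭)] := by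
  change Matrix.diagonal _ = _
  ext i j; fin_cases i <;> fin_cases j <;> simp

lemma diag_mul (a b c d : (Fv 𝔭)ˣ) : diag a b * diag c d = diag (a * c) (b * d) := by
  refine Units.ext ?_
  rw [Units.val_mul, diag_val, diag_val, diag_val]
  simp

lemma diag_inv (a b : (Fv 𝔭)ˣ) : (diag a b)⁻¹ = diag a⁻¹ b⁻¹ := by
  rw [inv_eq_iff_mul_eq_one, diag_mul, mul_inv_cancel, mul_inv_cancel]
  refine Units.ext ?_
  rw [diag_val]
  change _ = (1 : Matrix (Fin 2) (Fin 2) (Fv 𝔭))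
  rw [Matrix.one_fin_two, Units.val_one]

lemma diag_self (c : (Fv 𝔭)ˣ) : diag c c = scalarHom 𝔭 c := by
  refine Units.ext ?_
  rw [diag_val]
  change _ = algebraMap (Fv 𝔭) (Matrix (Fin 2) (Fin 2) (Fv 𝔭)) c
  rw [Matrix.algebraMap_eq_diagonal]
  ext i j; fin_cases i <;> fin_cases j <;> simp

lemma diag_conj_val (a b : (Fv 𝔭)ˣ) (m : GL2 𝔭) :
    ((diag a b)⁻¹ * m * diag a b).val = !![m.val 0 0, (a : Fv 𝔭)⁻¹ * m.val 0 1 * b;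
      (b : Fv 𝔭)⁻¹ * m.val 1 0 * a, m.val 1 1] := by
  have ha : (a : Fv 𝔭) ≠ 0 := a.ne_zero
  have hb : (b : Fv 𝔭) ≠ 0 := b.ne_zero
  rw [diag_inv, Units.val_mul, Units.val_mul, diag_val, diag_val]
  refine Matrix.ext fun i j => ?_
  rw [Matrix.mul_apply, Fin.sum_univ_two, Matrix.mul_apply, Fin.sum_univ_two, Matrix.mul_apply,
    Fin.sum_univ_two]
  fin_cases i <;> fin_cases j <;> simp <;> field_simp

lemma det_conj (d m : GL2 𝔭) : (d⁻¹ * m * d).val.det = m.val.det := by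
  rw [Units.val_mul, Units.val_mul, Matrix.det_mul_right_comm, ← Units.val_mul, inv_mul_cancel,
    Units.val_one, one_mul]

/-- The set of cosets in the double coset of `δ`. -/
def heckeSet (C : Subgroup (GL2 𝔭)) (δ : GL2 𝔭) : Set (GL2 𝔭 ⧸ C) :=
  {σ : GL2 𝔭 ⧸ C | ∃ k ∈ C, σ = QuotientGroup.mk (k * δ)}

lemma exists_integer_matrix {k : GL2 𝔭} (hk : k ∈ GL2O 𝔭) :
    ∃ m : Fin 2 → Fin 2 → Ov 𝔭, ∀ i j, k.val i j = m i j :=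
  ⟨fun i j => ⟨k.val i j, (mem_GL2O_iff.1 hk).1 i j⟩, fun _ _ => rfl⟩

lemma inv_mul_zero_one (k k' : GL2 𝔭) : (k⁻¹ * k').val 0 1 =
    k.val.det⁻¹ * (k.val 1 1 * k'.val 0 1 - k.val 0 1 * k'.val 1 1) := by
  rw [Units.val_mul, inv_apply_fin_two, Matrix.mul_apply, Fin.sum_univ_two]
  simp; ring

lemma inv_mul_one_zero (k k' : GL2 𝔭) : (k⁻¹ * k').val 1 0 =
    k.val.det⁻¹ * (k.val 0 0 * k'.val 1 0 - k.val 1 0 * k'.val 0 0) := by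
  rw [Units.val_mul, inv_apply_fin_two, Matrix.mul_apply, Fin.sum_univ_two]
  simp; ring

open Classical in
/-- There are at most `q + 1` cosets in the double coset of `T_𝔭`. -/
lemma heckeSet_GL2O_injection {ϖ : (Fv 𝔭)ˣ} (hϖ : Valued.v (ϖ : Fv 𝔭) = exp (-1 : ℤ)) :
    ∃ f : heckeSet (GL2O 𝔭) (diag ϖ 1) → Option (IsLocalRing.ResidueField (Ov 𝔭)),
      Function.Injective f := by
  choose k hk hσ using fun σ : heckeSet (GL2O 𝔭) (diag ϖ 1) => σ.2
  choose m hm using fun σ => exists_integer_matrix (hk σ)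
  let r := IsLocalRing.residue (Ov 𝔭)
  -- The lattice k diag(ϖ, 1) O² is O k e₂ + ϖ O², so the coset depends only on the point of the
  -- projective line over the residue field given by the second column of k; `none` is the point at
  -- infinity.
  refine ⟨fun σ => if r (m σ 1 1) = 0 then none else some (r (m σ 0 1) / r (m σ 1 1)),
    fun σ σ' h => Subtype.ext ?_⟩
  have key : r (m σ 1 1 * m σ' 0 1 - m σ 0 1 * m σ' 1 1) = 0 := by
    rw [map_sub, map_mul, map_mul]
    by_cases h1 : r (m σ 1 1) = 0 <;> by_cases h2 : r (m σ' 1 1) = 0 <;>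
      simp only [h1, h2, if_true, if_false, reduceCtorEq, Option.some.injEq] at h
    · rw [h1, h2]; ring
    · rw [div_eq_div_iff h1 h2] at h
      rw [h]; ring
  rw [residue_eq_zero_iff_valued] at key
  rw [hσ, hσ, QuotientGroup.eq]
  have h1 : (k σ * diag ϖ 1)⁻¹ * (k σ' * diag ϖ 1) =
      (diag ϖ 1)⁻¹ * ((k σ)⁻¹ * k σ') * diag ϖ 1 := by group
  have hmem := mem_GL2O_iff.1 (mul_mem (inv_mem (hk σ)) (hk σ'))
  rw [h1, mem_GL2O_iff, det_conj, diag_conj_val]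
  refine ⟨fun i j => ?_, hmem.2⟩
  have h01 : Valued.v (((k σ)⁻¹ * k σ').val 0 1) ≤ exp (-1 : ℤ) := by
    rw [inv_mul_zero_one, hm, hm, hm, hm, map_mul, map_inv₀, (mem_GL2O_iff.1 (hk σ)).2, inv_one,
      one_mul, ← lt_one_iff_le_exp]
    exact key
  fin_cases i <;> fin_cases j
  · exact hmem.1 0 0
  · simp only [Fin.zero_eta, Fin.mk_one, Matrix.of_apply, Matrix.cons_val', Matrix.cons_val_one,
      Matrix.cons_val_fin_one, Matrix.cons_val_zero, Units.val_one, mul_one]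
    rw [map_mul, map_inv₀, hϖ, inv_mul_le_one₀ (by simp)]
    exact h01
  · simp only [Fin.zero_eta, Fin.mk_one, Matrix.of_apply, Matrix.cons_val', Matrix.cons_val_one,
      Matrix.cons_val_fin_one, Matrix.cons_val_zero, Units.val_one, inv_one, one_mul]
    rw [map_mul, hϖ]
    refine mul_le_one' (hmem.1 1 0) ?_
    rw [← exp_zero, exp_le_exp]; omega
  · exact hmem.1 1 1

lemma valued_zero_zero_eq_one {k : GL2 𝔭} (hk : k ∈ iwahori 𝔭) : Valued.v (k.val 0 0) = 1 := by
  obtain ⟨h, h'⟩ := mem_iwahori_iff.1 hk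
  obtain ⟨h1, h2⟩ := mem_GL2O_iff.1 h
  refine le_antisymm (h1 0 0) (not_lt.1 fun h3 => ?_)
  rw [Matrix.det_fin_two] at h2
  refine (Valuation.map_sub_lt _ ?_ ?_).ne h2 <;> rw [map_mul]
  · exact mul_lt_one_of_nonneg_of_lt_one_left zero_le h3 (h1 1 1)
  · exact mul_lt_one_of_nonneg_of_lt_one_right (h1 0 1) zero_le h'

/-- There are at most `q` cosets in the double coset of `U_𝔭`. -/
lemma heckeSet_iwahori_injection {ϖ : (Fv 𝔭)ˣ} (hϖ : Valued.v (ϖ : Fv 𝔭) = exp (-1 : ℤ)) :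
    ∃ f : heckeSet (iwahori 𝔭) (diag 1 ϖ) → IsLocalRing.ResidueField (Ov 𝔭),
      Function.Injective f := by
  choose k hk hσ using fun σ : heckeSet (iwahori 𝔭) (diag 1 ϖ) => σ.2
  choose m hm using fun σ => exists_integer_matrix (iwahori_le (hk σ))
  have hγ : ∀ σ, ∃ γ : Ov 𝔭, (k σ).val 1 0 = ϖ * γ := fun σ => by
    refine ⟨⟨(ϖ : Fv 𝔭)⁻¹ * (k σ).val 1 0, ?_⟩, (mul_inv_cancel_left₀ ϖ.ne_zero _).symm⟩
    rw [mem_adicCompletionIntegers, map_mul, map_inv₀, hϖ, inv_mul_le_one₀ (by simp),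
      ← lt_one_iff_le_exp]
    exact (mem_iwahori_iff.1 (hk σ)).2
  choose γ hγ using hγ
  let r := IsLocalRing.residue (Ov 𝔭)
  -- The first column of k is (a, ϖ γ) with a a unit, and the coset of k diag(1, ϖ) depends only on
  -- the ratio γ / a modulo 𝔭.
  refine ⟨fun σ => r (γ σ) / r (m σ 0 0), fun σ σ' h => Subtype.ext ?_⟩
  have hne : ∀ σ, r (m σ 0 0) ≠ 0 := fun σ => by
    rw [Ne, residue_eq_zero_iff_valued, ← hm, valued_zero_zero_eq_one (hk σ)]
    exact lt_irrefl _
  have key : r (m σ 0 0 * γ σ' - γ σ * m σ' 0 0) = 0 := by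
    rw [map_sub, map_mul, map_mul]
    simp only at h
    rw [div_eq_div_iff (hne σ) (hne σ')] at h
    rw [h]; ring
  rw [residue_eq_zero_iff_valued] at key
  rw [hσ, hσ, QuotientGroup.eq]
  have h1 : (k σ * diag 1 ϖ)⁻¹ * (k σ' * diag 1 ϖ) =
      (diag 1 ϖ)⁻¹ * ((k σ)⁻¹ * k σ') * diag 1 ϖ := by group
  have hmem := mem_GL2O_iff.1 (iwahori_le (mul_mem (inv_mem (hk σ)) (hk σ')))
  have h10 : Valued.v ((ϖ : Fv 𝔭)⁻¹ * ((k σ)⁻¹ * k σ').val 1 0) < 1 := by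
    have h2 : (ϖ : Fv 𝔭)⁻¹ * ((k σ)⁻¹ * k σ').val 1 0 =
        (k σ).val.det⁻¹ * ((m σ 0 0 * γ σ' - γ σ * m σ' 0 0 : Ov 𝔭) : Fv 𝔭) := by
      rw [inv_mul_one_zero, hγ, hγ, hm, hm]
      push_cast
      field_simp
    rw [h2, map_mul, map_inv₀, (mem_GL2O_iff.1 (iwahori_le (hk σ))).2, inv_one, one_mul]
    exact key
  rw [h1, mem_iwahori_iff, mem_GL2O_iff, det_conj, diag_conj_val]
  refine ⟨⟨fun i j => ?_, hmem.2⟩, ?_⟩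
  · fin_cases i <;> fin_cases j
    · exact hmem.1 0 0
    · simp only [Fin.zero_eta, Fin.mk_one, Matrix.of_apply, Matrix.cons_val', Matrix.cons_val_one,
        Matrix.cons_val_fin_one, Matrix.cons_val_zero, Units.val_one, inv_one, one_mul]
      rw [map_mul, hϖ]
      refine mul_le_one' (hmem.1 0 1) ?_
      rw [← exp_zero, exp_le_exp]; omega
    · simpa using h10.le
    · exact hmem.1 1 1
  · simpa using h10

end Tree

/-! ### Neighbours on the tree -/

section Neighbours

variable {F : Type*} [Field F] [NumberField F] {𝔭 : Place F}

/-- The translates by the double coset of `δ` of the class of `g`. -/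
def neighbours (C : Subgroup (GL2 𝔭)) (δ g : GL2 𝔭) : Set (GL2 𝔭 ⧸ (C ⊔ scalars 𝔭)) :=
  {w | ∃ k ∈ C, w = QuotientGroup.mk (g * k * δ)}

lemma mk_mul_scalarHom (C : Subgroup (GL2 𝔭)) (g : GL2 𝔭) (c : (Fv 𝔭)ˣ) :
    (QuotientGroup.mk (g * scalarHom 𝔭 c) : GL2 𝔭 ⧸ (C ⊔ scalars 𝔭)) = QuotientGroup.mk g :=
  ((mk_eq_mk_iff g _).2 ⟨1, one_mem _, c, by rw [mul_one]⟩).symm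

lemma mk_mul_mem {C : Subgroup (GL2 𝔭)} (g : GL2 𝔭) {k : GL2 𝔭} (hk : k ∈ C) :
    (QuotientGroup.mk (g * k) : GL2 𝔭 ⧸ (C ⊔ scalars 𝔭)) = QuotientGroup.mk g :=
  ((mk_eq_mk_iff g _).2 ⟨k, hk, 1, by rw [map_one, mul_one]⟩).symm

/-- An element of valuation one is a unit of `O_{F_𝔭}`. -/
lemma exists_integerUnits_of_valued {c : (Fv 𝔭)ˣ} (h : Valued.v (c : Fv 𝔭) = 1) :
    ∃ d, integerUnits 𝔭 d = c := by
  have h1 : (c : Fv 𝔭) ∈ Ov 𝔭 := h.le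
  have h2 : ((c⁻¹ : (Fv 𝔭)ˣ) : Fv 𝔭) ∈ Ov 𝔭 := by
    rw [mem_adicCompletionIntegers, Units.val_inv_eq_inv_val, map_inv₀, h, inv_one]
  exact ⟨⟨⟨_, h1⟩, ⟨_, h2⟩, Subtype.ext c.mul_inv, Subtype.ext c.inv_mul⟩, Units.ext rfl⟩

lemma det_scalarHom (c : (Fv 𝔭)ˣ) : (scalarHom 𝔭 c).val.det = (c : Fv 𝔭) ^ 2 := by
  rw [← diag_self, diag_val, Matrix.det_fin_two_of]
  ring

lemma valued_eq_one_of_sq {a : ℤᵐ⁰} (h : a ^ 2 = 1) : a = 1 :=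
  (pow_eq_one_iff_of_nonneg zero_le two_ne_zero).1 h

lemma mk_out_mul {C : Subgroup (GL2 𝔭)} (h : GL2 𝔭) :
    ∃ k ∈ C, (QuotientGroup.mk h : GL2 𝔭 ⧸ C).out = h * k := by
  obtain ⟨k, hk⟩ := QuotientGroup.mk_out_eq_mul C h
  exact ⟨k, k.2, hk⟩

/-- Enlarging C to C F_𝔭^× identifies no two cosets of one double coset: their determinants have
equal valuation, so the scalar between them has valuation 1 and already lies in C. -/
lemma heckeSet_injOn {C : Subgroup (GL2 𝔭)} (hC : C ≤ GL2O 𝔭)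
    (hC' : ∀ c, scalarHom 𝔭 (integerUnits 𝔭 c) ∈ C) (δ g : GL2 𝔭) :
    Set.InjOn (fun σ : GL2 𝔭 ⧸ C => (QuotientGroup.mk (g * σ.out) : GL2 𝔭 ⧸ (C ⊔ scalars 𝔭)))
      (heckeSet C δ) := by
  rintro _ ⟨k, hk, rfl⟩ _ ⟨k', hk', rfl⟩ h
  obtain ⟨l, hl, h1⟩ := mk_out_mul (C := C) (k * δ)
  obtain ⟨l', hl', h2⟩ := mk_out_mul (C := C) (k' * δ)
  simp only [h1, h2] at h
  obtain ⟨m, hm, c, h⟩ := (mk_eq_mk_iff _ _).1 h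
  have h3 : k' * δ * l' = k * δ * l * m * scalarHom 𝔭 c := by
    refine mul_left_cancel (a := g) ?_
    rw [h]; group
  have hdet : ∀ x ∈ C, Valued.v x.val.det = 1 := fun x hx => (mem_GL2O_iff.1 (hC hx)).2
  have h4 := congrArg (fun x : GL2 𝔭 => Valued.v x.val.det) h3
  simp only [Units.val_mul, Matrix.det_mul, map_mul, hdet _ hk, hdet _ hk', hdet _ hl, hdet _ hl',
    hdet _ hm, mul_one, one_mul, det_scalarHom, map_pow] at h4
  have h5 : Valued.v (c : Fv 𝔭) = 1 := by
    refine valued_eq_one_of_sq ?_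
    refine mul_left_cancel₀ (a := Valued.v δ.val.det) ?_ ?_
    · exact (map_ne_zero _).2 (det_ne_zero δ)
    · rw [← h4, mul_one]
  obtain ⟨d, rfl⟩ := exists_integerUnits_of_valued h5
  rw [QuotientGroup.eq]
  have h6 : (k * δ)⁻¹ * (k' * δ) = l * m * scalarHom 𝔭 (integerUnits 𝔭 d) * l'⁻¹ := by
    rw [eq_mul_inv_iff_mul_eq, mul_assoc, h3]
    group
  rw [h6]
  exact mul_mem (mul_mem (mul_mem hl hm) (hC' d)) (inv_mem hl')

lemma image_heckeSet (C : Subgroup (GL2 𝔭)) (δ g : GL2 𝔭) :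
    (fun σ : GL2 𝔭 ⧸ C => (QuotientGroup.mk (g * σ.out) : GL2 𝔭 ⧸ (C ⊔ scalars 𝔭))) ''
      heckeSet C δ = neighbours C δ g := by
  have key : ∀ k : GL2 𝔭, (QuotientGroup.mk (g * (QuotientGroup.mk (k * δ) : GL2 𝔭 ⧸ C).out) :
      GL2 𝔭 ⧸ (C ⊔ scalars 𝔭)) = QuotientGroup.mk (g * k * δ) := fun k => by
    obtain ⟨l, hl, h⟩ := mk_out_mul (C := C) (k * δ)
    rw [h, ← mul_assoc, mk_mul_mem _ hl, mul_assoc]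
  ext w
  constructor
  · rintro ⟨_, ⟨k, hk, rfl⟩, rfl⟩
    exact ⟨k, hk, key k⟩
  · rintro ⟨k, hk, rfl⟩
    exact ⟨_, ⟨k, hk, rfl⟩, key k⟩

/-- Only this upper bound is proved directly; equality along the vertex sequence follows from the
matching lower bound for torus orbits. -/
lemma neighbours_finite_card {ϖ : (Fv 𝔭)ˣ} (hϖ : Valued.v (ϖ : Fv 𝔭) = exp (-1 : ℤ)) (g : GL2 𝔭) :
    (neighbours (GL2O 𝔭) (diag ϖ 1) g).Finite ∧ (neighbours (GL2O 𝔭) (diag ϖ 1) g).ncard ≤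
      Nat.card (IsLocalRing.ResidueField (Ov 𝔭)) + 1 := by
  obtain ⟨f, hf⟩ := heckeSet_GL2O_injection hϖ
  have hfin : Finite (heckeSet (GL2O 𝔭) (diag ϖ 1)) := Finite.of_injective f hf
  rw [← image_heckeSet]
  refine ⟨Set.Finite.image _ hfin, (Set.ncard_image_le hfin).trans ?_⟩
  rw [← Finite.card_option]
  exact Nat.card_le_card_of_injective f hf

lemma neighbours_iwahori_finite_card {ϖ : (Fv 𝔭)ˣ} (hϖ : Valued.v (ϖ : Fv 𝔭) = exp (-1 : ℤ))
    (g : GL2 𝔭) :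
    (neighbours (iwahori 𝔭) (diag 1 ϖ) g).Finite ∧ (neighbours (iwahori 𝔭) (diag 1 ϖ) g).ncard ≤
      Nat.card (IsLocalRing.ResidueField (Ov 𝔭)) := by
  obtain ⟨f, hf⟩ := heckeSet_iwahori_injection hϖ
  have hfin : Finite (heckeSet (iwahori 𝔭) (diag 1 ϖ)) := Finite.of_injective f hf
  rw [← image_heckeSet]
  exact ⟨Set.Finite.image _ hfin,
    (Set.ncard_image_le hfin).trans (Nat.card_le_card_of_injective f hf)⟩

variable (𝔭) in
/-- The matrix that interchanges the basis vectors. -/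
def swapMatrix : GL2 𝔭 :=
  ⟨!![0, 1; 1, 0], !![0, 1; 1, 0], by simp [Matrix.one_fin_two], by simp [Matrix.one_fin_two]⟩

lemma swapMatrix_mem : swapMatrix 𝔭 ∈ GL2O 𝔭 := by
  refine mem_GL2O_iff.2 ⟨fun i j => ?_, ?_⟩
  · fin_cases i <;> fin_cases j <;> simp [swapMatrix]
  · simp [swapMatrix, Matrix.det_fin_two_of, Valuation.map_neg]

lemma diag_swap (a b : (Fv 𝔭)ˣ) : diag a b = swapMatrix 𝔭 * diag b a * swapMatrix 𝔭 := by
  refine Units.ext ?_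
  rw [Units.val_mul, Units.val_mul, diag_val, diag_val]
  simp [swapMatrix]

/-- The target of an edge is a neighbour of the source. -/
lemma mem_neighbours_of_source {ϖ : (Fv 𝔭)ˣ} {g h : GL2 𝔭}
    (hgh : (QuotientGroup.mk g : Vertex 𝔭) = QuotientGroup.mk h) :
    (QuotientGroup.mk (h * diag 1 ϖ) : Vertex 𝔭) ∈ neighbours (GL2O 𝔭) (diag ϖ 1) g := by
  obtain ⟨k, hk, c, rfl⟩ := (mk_eq_mk_iff _ _).1 hgh
  -- The edges use diag(1, ϖ) whereas T_𝔭 uses diag(ϖ, 1); interchanging the basis vectors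
  -- reconciles them.
  refine ⟨k * swapMatrix 𝔭, mul_mem hk swapMatrix_mem, ?_⟩
  have : g * k * scalarHom 𝔭 c * diag 1 ϖ =
      g * (k * swapMatrix 𝔭) * diag ϖ 1 * swapMatrix 𝔭 * scalarHom 𝔭 c := by
    rw [mul_assoc (g * k), scalarHom_commute, diag_swap]
    group
  rw [this, mk_mul_scalarHom, mk_mul_mem _ swapMatrix_mem]

/-- The source of an edge is a neighbour of the target. -/
lemma mem_neighbours_of_target {ϖ : (Fv 𝔭)ˣ} {g h : GL2 𝔭}
    (hgh : (QuotientGroup.mk g : Vertex 𝔭) = QuotientGroup.mk (h * diag 1 ϖ)) :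
    (QuotientGroup.mk h : Vertex 𝔭) ∈ neighbours (GL2O 𝔭) (diag ϖ 1) g := by
  obtain ⟨k, hk, c, h1⟩ := (mk_eq_mk_iff _ _).1 hgh
  refine ⟨k, hk, ?_⟩
  -- The product diag(1, ϖ) diag(ϖ, 1) is the scalar ϖ, so going back along an edge is again a
  -- T_𝔭-step.
  have : g * k * diag ϖ 1 = h * scalarHom 𝔭 (ϖ * c⁻¹) := by
    have h2 : g * k = h * diag 1 ϖ * scalarHom 𝔭 c⁻¹ := by
      rw [h1, map_inv, mul_inv_cancel_right]
    rw [h2, mul_assoc, scalarHom_commute, mul_assoc, ← mul_assoc (diag 1 ϖ), diag_mul, one_mul,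
      mul_one, diag_self, map_mul]
  rw [this, mk_mul_scalarHom]

/-- If a conjugate of an element of `GL₂(O_{F_𝔭})` lies in `F_𝔭^× GL₂(O_{F_𝔭})`, then it lies in
`GL₂(O_{F_𝔭})`. -/
lemma conj_mem_GL2O {d k k' : GL2 𝔭} (hk : k ∈ GL2O 𝔭) (hk' : k' ∈ GL2O 𝔭) {c : (Fv 𝔭)ˣ}
    (h : d⁻¹ * k * d = k' * scalarHom 𝔭 c) : d⁻¹ * k * d ∈ GL2O 𝔭 := by
  have h4 := congrArg (fun x : GL2 𝔭 => Valued.v x.val.det) h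
  simp only [det_conj, (mem_GL2O_iff.1 hk).2] at h4
  rw [Units.val_mul, Matrix.det_mul, map_mul, (mem_GL2O_iff.1 hk').2, one_mul, det_scalarHom,
    map_pow] at h4
  obtain ⟨e, rfl⟩ := exists_integerUnits_of_valued (valued_eq_one_of_sq h4.symm)
  rw [h]
  exact mul_mem hk' (iwahori_le (scalarHom_mem_iwahori e))

/-- With d = diag(1, ϖ), the Iwahori subgroup is GL₂(O) ∩ d GL₂(O) d⁻¹, so fixing an edge means
fixing both ends. -/
lemma conj_diag_mem_GL2O_iff {ϖ : (Fv 𝔭)ˣ} (hϖ : Valued.v (ϖ : Fv 𝔭) = exp (-1 : ℤ)) {k : GL2 𝔭}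
    (hk : k ∈ GL2O 𝔭) : (diag 1 ϖ)⁻¹ * k * diag 1 ϖ ∈ GL2O 𝔭 ↔ k ∈ iwahori 𝔭 := by
  have h10 : Valued.v ((ϖ : Fv 𝔭)⁻¹ * k.val 1 0) ≤ 1 ↔ Valued.v (k.val 1 0) < 1 := by
    rw [map_mul, map_inv₀, hϖ, inv_mul_le_one₀ (by simp), lt_one_iff_le_exp]
  obtain ⟨hk1, hk2⟩ := mem_GL2O_iff.1 hk
  rw [mem_iwahori_iff, mem_GL2O_iff, det_conj, diag_conj_val, ← h10]
  constructor
  · rintro ⟨h, -⟩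
    exact ⟨hk, by simpa using h 1 0⟩
  · rintro ⟨-, h⟩
    refine ⟨fun i j => ?_, hk2⟩
    fin_cases i <;> fin_cases j
    · exact hk1 0 0
    · simp only [Fin.zero_eta, Fin.mk_one, Matrix.of_apply, Matrix.cons_val', Matrix.cons_val_one,
        Matrix.cons_val_fin_one, Matrix.cons_val_zero, Units.val_one, inv_one, one_mul]
      rw [map_mul, hϖ]
      refine mul_le_one' (hk1 0 1) ?_
      rw [← exp_zero, exp_le_exp]; omega
    · simpa using h
    · exact hk1 1 1

/-- An edge is determined by its source and its target. -/
lemma mk_edge_eq_iff {ϖ : (Fv 𝔭)ˣ} (hϖ : Valued.v (ϖ : Fv 𝔭) = exp (-1 : ℤ)) (g h : GL2 𝔭) :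
    (QuotientGroup.mk g : Edge 𝔭) = QuotientGroup.mk h ↔
      (QuotientGroup.mk g : Vertex 𝔭) = QuotientGroup.mk h ∧
        (QuotientGroup.mk (g * diag 1 ϖ) : Vertex 𝔭) = QuotientGroup.mk (h * diag 1 ϖ) := by
  constructor
  · intro hgh
    obtain ⟨k, hk, c, rfl⟩ := (mk_eq_mk_iff _ _).1 hgh
    refine ⟨by rw [mk_mul_scalarHom, mk_mul_mem _ (iwahori_le hk)], ?_⟩
    have : g * k * scalarHom 𝔭 c * diag 1 ϖ =
        g * diag 1 ϖ * ((diag 1 ϖ)⁻¹ * k * diag 1 ϖ) * scalarHom 𝔭 c := by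
      rw [mul_assoc (g * k), scalarHom_commute]
      group
    rw [this, mk_mul_scalarHom, mk_mul_mem _ ((conj_diag_mem_GL2O_iff hϖ (iwahori_le hk)).2 hk)]
  · rintro ⟨h1, h2⟩
    obtain ⟨k, hk, c, rfl⟩ := (mk_eq_mk_iff _ _).1 h1
    obtain ⟨k', hk', c', h2⟩ := (mk_eq_mk_iff _ _).1 h2
    have h3 : (diag 1 ϖ)⁻¹ * k * diag 1 ϖ = k' * scalarHom 𝔭 (c' * c⁻¹) := by
      have h4 : g * k * diag 1 ϖ = g * diag 1 ϖ * k' * scalarHom 𝔭 (c' * c⁻¹) := by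
        rw [map_mul, ← mul_assoc, ← h2, map_inv, mul_assoc (g * k), scalarHom_commute, ← mul_assoc,
          mul_inv_cancel_right]
      refine mul_left_cancel (a := g * diag 1 ϖ) ?_
      rw [← mul_assoc _ k', ← h4]
      group
    have h5 := (conj_diag_mem_GL2O_iff hϖ hk).1 (conj_mem_GL2O hk hk' h3)
    rw [mk_mul_scalarHom, mk_mul_mem _ h5]

/-- The neighbours of an edge are the edges that continue it without backtracking. -/
lemma mk_edge_mem_neighbours {ϖ : (Fv 𝔭)ˣ} (hϖ : Valued.v (ϖ : Fv 𝔭) = exp (-1 : ℤ)) {g h : GL2 𝔭}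
    (h1 : (QuotientGroup.mk (g * diag 1 ϖ) : Vertex 𝔭) = QuotientGroup.mk h)
    (h2 : (QuotientGroup.mk (h * diag 1 ϖ) : Vertex 𝔭) ≠ QuotientGroup.mk g) :
    (QuotientGroup.mk h : Edge 𝔭) ∈ neighbours (iwahori 𝔭) (diag 1 ϖ) g := by
  obtain ⟨k, hk, c, rfl⟩ := (mk_eq_mk_iff _ _).1 h1
  rw [mk_mul_scalarHom]
  obtain ⟨hk1, hk2⟩ := mem_GL2O_iff.1 hk
  have hϖ1 : Valued.v (ϖ : Fv 𝔭) ≤ 1 := by rw [hϖ, ← exp_zero, exp_le_exp]; omega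
  have hϖlt : Valued.v (ϖ : Fv 𝔭) < 1 := by rw [hϖ, ← exp_zero, exp_lt_exp]; omega
  have hϖ0 : (ϖ : Fv 𝔭) ≠ 0 := ϖ.ne_zero
  have ha : Valued.v (k.val 0 0) = 1 := by
    refine le_antisymm (hk1 0 0) (not_lt.1 fun ha => h2 ?_)
    -- If ϖ divides the upper left entry of k, this matrix is integral with unit determinant, so the
    -- second edge returns to the source of the first.
    have hmem : diag 1 ϖ * k * diag 1 ϖ * scalarHom 𝔭 ϖ⁻¹ ∈ GL2O 𝔭 := by
      rw [← diag_self]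
      have hval : (diag 1 ϖ * k * diag 1 ϖ * diag ϖ⁻¹ ϖ⁻¹).val =
          !![(ϖ : Fv 𝔭)⁻¹ * k.val 0 0, k.val 0 1; k.val 1 0, ϖ * k.val 1 1] := by
        rw [Units.val_mul, Units.val_mul, Units.val_mul, diag_val, diag_val]
        conv_lhs => rw [Matrix.eta_fin_two k.val]
        refine Matrix.ext fun i j => ?_
        rw [Matrix.mul_fin_two, Matrix.mul_fin_two, Matrix.mul_fin_two]
        fin_cases i <;> fin_cases j <;> simp <;> field_simp
      refine mem_GL2O_iff.2 ⟨fun i j => ?_, ?_⟩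
      · rw [hval]
        fin_cases i <;> fin_cases j
        · simp only [Fin.zero_eta, Matrix.of_apply, Matrix.cons_val', Matrix.cons_val_fin_one,
            Matrix.cons_val_zero]
          rw [map_mul, map_inv₀, hϖ, inv_mul_le_one₀ (by simp), ← lt_one_iff_le_exp]
          exact ha
        · exact hk1 0 1
        · exact hk1 1 0
        · simp only [Fin.mk_one, Matrix.of_apply, Matrix.cons_val', Matrix.cons_val_one,
            Matrix.cons_val_fin_one]
          rw [map_mul]
          exact mul_le_one' hϖ1 (hk1 1 1)
      · rw [hval, Matrix.det_fin_two_of, ← hk2, Matrix.det_fin_two]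
        congr 1
        field_simp
    have h3 : g * diag 1 ϖ * k * scalarHom 𝔭 c * diag 1 ϖ =
        g * (diag 1 ϖ * k * diag 1 ϖ * scalarHom 𝔭 ϖ⁻¹) * scalarHom 𝔭 (ϖ * c) := by
      rw [mul_assoc _ (scalarHom 𝔭 c), scalarHom_commute, map_mul, map_inv]
      group
    rw [h3, mk_mul_scalarHom, mk_mul_mem _ hmem]
  have ha0 : k.val 0 0 ≠ 0 := fun h0 => by rw [h0, map_zero] at ha; exact zero_ne_one ha
  set a := k.val 0 0 with ha_def
  -- Conjugating l⁻¹ by diag(1, ϖ) gives the row operation that clears the lower left entry of k;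
  -- the factor ϖ in l is what puts l in the Iwahori subgroup.
  let l : GL2 𝔭 := ⟨!![1, 0; ϖ * k.val 1 0 / a, 1], !![1, 0; -(ϖ * k.val 1 0 / a), 1],
    by simp [Matrix.one_fin_two], by simp [Matrix.one_fin_two]⟩
  have hva : Valued.v (k.val 1 0 / a) ≤ 1 := by
    rw [map_div₀, ha, div_one]; exact hk1 1 0
  have hl10 : Valued.v (ϖ * k.val 1 0 / a) < 1 := by
    rw [mul_div_assoc, map_mul]
    exact mul_lt_one_of_nonneg_of_lt_one_left zero_le hϖlt hva
  have hl : l ∈ iwahori 𝔭 := by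
    refine mem_iwahori_iff.2 ⟨mem_GL2O_iff.2 ⟨fun i j => ?_, ?_⟩, hl10⟩
    · fin_cases i <;> fin_cases j
      · simp [l]
      · simp [l]
      · exact hl10.le
      · simp [l]
    · simp [l, Matrix.det_fin_two_of]
  have hm : (diag 1 ϖ)⁻¹ * l⁻¹ * diag 1 ϖ * k ∈ iwahori 𝔭 := by
    have hval : ((diag 1 ϖ)⁻¹ * l⁻¹ * diag 1 ϖ * k).val =
        !![a, k.val 0 1; 0, k.val.det / a] := by
      rw [Units.val_mul, diag_conj_val, Matrix.det_fin_two, ← ha_def]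
      have hl' : (l⁻¹).val = !![1, 0; -(ϖ * k.val 1 0 / a), 1] := rfl
      rw [hl']
      conv_lhs => rw [Matrix.eta_fin_two k.val, Matrix.mul_fin_two, ← ha_def]
      refine Matrix.ext fun i j => ?_
      fin_cases i <;> fin_cases j <;> simp <;> field_simp <;> ring
    refine mem_iwahori_iff.2 ⟨mem_GL2O_iff.2 ⟨fun i j => ?_, ?_⟩, ?_⟩
    · rw [hval]
      fin_cases i <;> fin_cases j
      · exact ha.le
      · exact hk1 0 1
      · simp
      · simp only [Fin.mk_one, Matrix.of_apply, Matrix.cons_val', Matrix.cons_val_one,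
            Matrix.cons_val_fin_one]
        rw [map_div₀, hk2, ha, div_one]
    · rw [hval, Matrix.det_fin_two_of, mul_zero, sub_zero, mul_div_cancel₀ _ ha0, hk2]
    · rw [hval]; simp
  refine ⟨l, hl, ?_⟩
  have h3 : g * diag 1 ϖ * k = g * l * diag 1 ϖ * ((diag 1 ϖ)⁻¹ * l⁻¹ * diag 1 ϖ * k) := by group
  rw [h3, mk_mul_mem _ hm]

end Neighbours

/-! ### Torus orbits exhaust the neighbours -/

section Orbits

variable {F : Type*} [Field F] [NumberField F] {𝔭 : Place F}
  {K : Type*} [Field K] [NumberField K] [Algebra F K]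
  {B : Type*} [Ring B] [Algebra F B] {O : Type*} [CommRing O]
  {ι : Local 𝔭 B ≃ₐ[Fv 𝔭] Matrix (Fin 2) (Fin 2) (Fv 𝔭)} {Ψ : K →ₐ[F] B} {ϖ : (Fv 𝔭)ˣ}

variable (ι Ψ) in
/-- The orbit of `w` under `(1 + 𝔭^j O_{K,𝔭})^×`. -/
def torusOrbit {C : Subgroup (GL2 𝔭)} (j : ℕ) (w : GL2 𝔭 ⧸ C) : Set (GL2 𝔭 ⧸ C) :=
  (fun u => torus ι Ψ u • w) '' (localU 𝔭 K j : Set (Local 𝔭 K)ˣ)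

lemma exists_mem_localU_not_mem (hK : Module.finrank F K = 2) {j : ℕ} (hj : 1 ≤ j) :
    ∃ u ∈ localU 𝔭 K j, u ∉ localU 𝔭 K (j + 1) ⊔ localScalars K 𝔭 := by
  obtain ⟨u, hu, hinj⟩ := exists_localU_family (𝔭 := 𝔭) hK hj
  exact ⟨(u 0)⁻¹ * u 1, mul_mem (inv_mem (hu _)) (hu _), fun h => zero_ne_one (hinj _ _ h)⟩

/-- The elements from `exists_localU_family` are inequivalent modulo the stabilizer of w, so they
give distinct points of the orbit. -/
lemma card_le_ncard_torusOrbit (hK : Module.finrank F K = 2) {j : ℕ} (hj : 1 ≤ j)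
    {C : Subgroup (GL2 𝔭)} {w : GL2 𝔭 ⧸ C}
    (hw : ∀ x, torus ι Ψ x • w = w → x ∈ localU 𝔭 K (j + 1) ⊔ localScalars K 𝔭)
    (hfin : (torusOrbit ι Ψ j w).Finite) :
    Nat.card (IsLocalRing.ResidueField (Ov 𝔭)) ≤ (torusOrbit ι Ψ j w).ncard := by
  obtain ⟨u, hu, hinj⟩ := exists_localU_family (𝔭 := 𝔭) hK hj
  have : Finite (torusOrbit ι Ψ j w) := hfin
  rw [← Nat.card_coe_set_eq]
  refine Nat.card_le_card_of_injective
    (fun b => (⟨torus ι Ψ (u b) • w, u b, hu b, rfl⟩ : torusOrbit ι Ψ j w)) fun b b' h => ?_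
  refine hinj b b' (hw _ ?_)
  rw [map_mul, map_inv, mul_smul, inv_smul_eq_iff]
  exact (Subtype.ext_iff.1 h).symm

lemma exists_joins_rep {x y : Vertex 𝔭} (h : ∃ e, Joins ϖ e x y) :
    ∃ g : GL2 𝔭, x = QuotientGroup.mk g ∧ y = QuotientGroup.mk (g * diag 1 ϖ) := by
  obtain ⟨e, g, -, hx, hy⟩ := h
  exact ⟨g, hx, hy⟩

namespace IsVertexSequence

variable {v : ℕ → Vertex 𝔭}

lemma torus_smul (hv : IsVertexSequence ι ϖ Ψ v) {j : ℕ} {u : (Local 𝔭 K)ˣ}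
    (hu : u ∈ localU 𝔭 K j) : torus ι Ψ u • v j = v j :=
  (hv.2 j u).2 (Subgroup.mem_sup_left hu)

lemma torusOrbit_subset (hv : IsVertexSequence ι ϖ Ψ v) {j : ℕ} {g : GL2 𝔭}
    (hg : v j = QuotientGroup.mk g) :
    torusOrbit ι Ψ j (v (j + 1)) ⊆ neighbours (GL2O 𝔭) (diag ϖ 1) g := by
  rintro _ ⟨u, hu, rfl⟩
  obtain ⟨h, h1, h2⟩ := exists_joins_rep (hv.1 j)
  dsimp only
  rw [h2, MulAction.Quotient.smul_mk, smul_eq_mul, ← mul_assoc]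
  refine mem_neighbours_of_source ?_
  rw [← hg, ← smul_eq_mul, ← MulAction.Quotient.smul_mk, ← h1, hv.torus_smul hu]

lemma torusOrbit_finite (hv : IsVertexSequence ι ϖ Ψ v) (hϖ : Valued.v (ϖ : Fv 𝔭) = exp (-1 : ℤ))
    (j : ℕ) : (torusOrbit ι Ψ j (v (j + 1))).Finite := by
  obtain ⟨g, hg⟩ := QuotientGroup.mk_surjective (v j)
  exact (neighbours_finite_card hϖ g).1.subset (hv.torusOrbit_subset hg.symm)

/-- The sequence of vertices does not backtrack. -/
lemma notMem_torusOrbit (hv : IsVertexSequence ι ϖ Ψ v) (hK : Module.finrank F K = 2) (j : ℕ) :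
    v j ∉ torusOrbit ι Ψ (j + 1) (v (j + 2)) := by
  rintro ⟨u, hu, h⟩
  obtain ⟨x, hx, hx'⟩ := exists_mem_localU_not_mem (𝔭 := 𝔭) hK (Nat.le_add_left 1 j)
  -- Since u fixes `v j`, the two vertices would coincide. Then x, which fixes `v j`, would fix `v
  -- (j + 2)`, contrary to its choice outside that stabilizer.
  have h' : v (j + 2) = v j := by
    rw [← hv.torus_smul (localU_antitone 𝔭 K j hu)] at h
    exact smul_left_cancel _ h
  refine hx' ((hv.2 (j + 2) x).1 ?_)
  rw [h', hv.torus_smul (localU_antitone 𝔭 K j hx)]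

/-- The right side is contained in the left and has at least q + 1 elements, by absence of
backtracking; the left has at most q + 1. -/
lemma neighbours_eq (hv : IsVertexSequence ι ϖ Ψ v) (hK : Module.finrank F K = 2)
    (hϖ : Valued.v (ϖ : Fv 𝔭) = exp (-1 : ℤ)) {j : ℕ} {g : GL2 𝔭}
    (hg : v (j + 1) = QuotientGroup.mk g) :
    neighbours (GL2O 𝔭) (diag ϖ 1) g = insert (v j) (torusOrbit ι Ψ (j + 1) (v (j + 2))) := by
  obtain ⟨hfin, hcard⟩ := neighbours_finite_card hϖ g
  refine (Set.eq_of_subset_of_ncard_le (Set.insert_subset ?_ (hv.torusOrbit_subset hg)) ?_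
    hfin).symm
  · obtain ⟨h, h1, h2⟩ := exists_joins_rep (hv.1 j)
    rw [h1]
    exact mem_neighbours_of_target (hg.symm.trans h2)
  · rw [Set.ncard_insert_of_notMem (hv.notMem_torusOrbit hK j) (hv.torusOrbit_finite hϖ _)]
    exact hcard.trans (Nat.add_le_add_right (card_le_ncard_torusOrbit hK (Nat.le_add_left 1 j)
      (fun x => (hv.2 _ x).1) (hv.torusOrbit_finite hϖ _)) 1)

variable {e : ℕ → Edge 𝔭}

lemma torus_smul_edge_iff (hv : IsVertexSequence ι ϖ Ψ v)
    (he : ∀ j, Joins ϖ (e (j + 1)) (v j) (v (j + 1)))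
    (hϖ : Valued.v (ϖ : Fv 𝔭) = exp (-1 : ℤ)) (j : ℕ) (x : (Local 𝔭 K)ˣ) :
    torus ι Ψ x • e (j + 1) = e (j + 1) ↔ x ∈ localU 𝔭 K (j + 1) ⊔ localScalars K 𝔭 := by
  obtain ⟨g, h, h1, h2⟩ := he j
  rw [h, MulAction.Quotient.smul_mk, mk_edge_eq_iff hϖ, smul_eq_mul, mul_assoc, ← smul_eq_mul,
    ← smul_eq_mul, ← MulAction.Quotient.smul_mk, ← MulAction.Quotient.smul_mk,
    ← h1, ← h2, hv.2, hv.2, and_iff_right_iff_imp]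
  exact fun hx => sup_le_sup_right (localU_antitone 𝔭 K j) _ hx

/-- The same count for edges. The preceding vertex is not among the continuations, so the term in
ξ_{j-1} has no counterpart. -/
lemma neighbours_iwahori_eq (hv : IsVertexSequence ι ϖ Ψ v)
    (he : ∀ j, Joins ϖ (e (j + 1)) (v j) (v (j + 1))) (hK : Module.finrank F K = 2)
    (hϖ : Valued.v (ϖ : Fv 𝔭) = exp (-1 : ℤ)) (j : ℕ) :
    ∃ g : GL2 𝔭, e (j + 1) = QuotientGroup.mk g ∧
      neighbours (iwahori 𝔭) (diag 1 ϖ) g = torusOrbit ι Ψ (j + 1) (e (j + 2)) := by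
  obtain ⟨g, hg, hg1, hg2⟩ := he j
  refine ⟨g, hg, ?_⟩
  obtain ⟨hfin, hcard⟩ := neighbours_iwahori_finite_card hϖ g
  have hsub : torusOrbit ι Ψ (j + 1) (e (j + 2)) ⊆ neighbours (iwahori 𝔭) (diag 1 ϖ) g := by
    rintro _ ⟨u, hu, rfl⟩
    obtain ⟨h, hh, hh1, hh2⟩ := he (j + 1)
    dsimp only
    rw [hh, MulAction.Quotient.smul_mk]
    refine mk_edge_mem_neighbours hϖ ?_ ?_
    · rw [← hg2, ← MulAction.Quotient.smul_mk, ← hh1, hv.torus_smul hu]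
    · rw [← hg1, smul_eq_mul, mul_assoc, ← smul_eq_mul, ← MulAction.Quotient.smul_mk, ← hh2]
      exact fun h => hv.notMem_torusOrbit hK j ⟨u, hu, h⟩
  refine (Set.eq_of_subset_of_ncard_le hsub ?_ hfin).symm
  exact hcard.trans (card_le_ncard_torusOrbit hK (Nat.le_add_left 1 j)
    (fun x => (hv.torus_smul_edge_iff he hϖ _ x).1) (hfin.subset hsub))

/-- The groups `H_j` are finite. -/
lemma finite_Hlev (hv : IsVertexSequence ι ϖ Ψ v) (hϖ : Valued.v (ϖ : Fv 𝔭) = exp (-1 : ℤ))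
    (j : ℕ) : Finite (Hlev 𝔭 K j) := by
  induction j with
  | zero => exact finite_Hlev_zero 𝔭
  | succ j ih =>
    refine Set.finite_univ_iff.1 (Set.Finite.of_finite_fibers (proj 𝔭 K j) (Set.toFinite _) ?_)
    rintro t -
    obtain ⟨t, rfl⟩ := toHlev_surjective j t
    choose! f hf hf' using fun (w : Vertex 𝔭) (hw : w ∈ torusOrbit ι Ψ j (v (j + 1))) => hw
    -- The class of t u in H_{j+1} depends only on the vertex u · v (j + 1), which ranges over a
    -- finite orbit.
    refine ((hv.torusOrbit_finite hϖ j).image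
      fun w => toHlev 𝔭 K (j + 1) (t * atPlace K 𝔭 (f w))).subset ?_
    rintro s ⟨-, hs⟩
    obtain ⟨u, hu, rfl⟩ := (proj_eq_iff j t s).1 hs
    have hmem : torus ι Ψ u • v (j + 1) ∈ torusOrbit ι Ψ j (v (j + 1)) := ⟨u, hu, rfl⟩
    refine ⟨_, hmem, toHlev_mul_atPlace_eq_of_mem t (hf _ hmem) hu ((hv.2 (j + 1) _).1 ?_)⟩
    rw [map_mul, map_inv, mul_smul, inv_smul_eq_iff]
    exact (hf' _ hmem).symm

end IsVertexSequence

/-- The sums of a function over two parametrized families with the same fibres agree. -/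
lemma finsum_mem_image_eq {α β γ : Type*} {U : Set α} {f : α → β} {g : α → γ} {φ : β → O}
    {ψ : γ → O} (h : ∀ x ∈ U, ∀ y ∈ U, f x = f y ↔ g x = g y) (hφ : ∀ x ∈ U, φ (f x) = ψ (g x)) :
    ∑ᶠ b ∈ f '' U, φ b = ∑ᶠ c ∈ g '' U, ψ c := by
  -- V contains one parameter for each value of f on U; since f and g have the same fibres on U,
  -- both are injective on V and have their full images there.
  obtain ⟨V, hVU, hV⟩ := (Set.surjOn_image f U).exists_bijOn_subset
  have hg : g '' U = g '' V := by
    refine Set.Subset.antisymm ?_ (Set.image_mono hVU)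
    rintro _ ⟨x, hx, rfl⟩
    obtain ⟨y, hy, hxy⟩ := hV.surjOn ⟨x, hx, rfl⟩
    exact ⟨y, hy, (h y (hVU hy) x hx).1 hxy⟩
  rw [← hV.image_eq, hg, finsum_mem_image hV.injOn, finsum_mem_image fun x hx y hy hxy =>
    hV.injOn hx hy ((h x (hVU hx) y (hVU hy)).2 hxy)]
  exact finsum_mem_congr rfl fun x hx => hφ x (hVU hx)

variable {C : Subgroup (GL2 𝔭)} {R : Subalgebra (awayFrom 𝔭) B} {Φ : (Adelic F B)ˣ → O}

/-- The sum of `Φ_{K,j+1}` over a fibre of `H_{j+1} → H_j` as a sum over an orbit on the tree. -/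
lemma IsAutomorphicForm.finsum_phiK (hC : ∀ c, scalarHom 𝔭 (integerUnits 𝔭 c) ∈ C)
    (hΦ : IsAutomorphicForm (level ι R C) Φ) (hΨ : IsOptimal R Ψ)
    {w : ℕ → GL2 𝔭 ⧸ (C ⊔ scalars 𝔭)} {j : ℕ}
    (hw : ∀ x, torus ι Ψ x • w (j + 1) = w (j + 1) ↔ x ∈ localU 𝔭 K (j + 1) ⊔ localScalars K 𝔭)
    (hj : UnitsStable 𝔭 K j) (t : (Adelic F K)ˣ) :
    ∑ᶠ s ∈ {s | proj 𝔭 K j s = toHlev 𝔭 K j t}, phiK ι Ψ Φ w (j + 1) s =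
      ∑ᶠ x ∈ torusOrbit ι Ψ j (w (j + 1)), valueAt ι Φ (adelicEmb Ψ t) x := by
  have h : {s | proj 𝔭 K j s = toHlev 𝔭 K j t} =
      (fun u => toHlev 𝔭 K (j + 1) (t * atPlace K 𝔭 u)) ''
        (localU 𝔭 K j : Set (Local 𝔭 K)ˣ) := Set.ext fun s => proj_eq_iff j t s
  rw [h]
  refine finsum_mem_image_eq (fun x hx y hy => ?_) fun x hx => ?_
  · rw [toHlev_mul_atPlace_eq_iff hj t hx hy, ← hw, map_mul, map_inv, mul_smul, inv_smul_eq_iff,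
      eq_comm]
  · rw [hΦ.phiK_toHlev hC hΨ fun u hu => (hw u).2 (Subgroup.mem_sup_left hu), map_mul,
      hΦ.valueAt_atPlace]

/-- The cosets σ in the Hecke sum correspond bijectively to the neighbours of the class of g, by
`heckeSet_injOn` and `image_heckeSet`. -/
lemma IsAutomorphicForm.hecke_eq_finsum (hC : C ≤ GL2O 𝔭)
    (hC' : ∀ c, scalarHom 𝔭 (integerUnits 𝔭 c) ∈ C) (hΦ : IsAutomorphicForm (level ι R C) Φ)
    (δ g : GL2 𝔭) (b : (Adelic F B)ˣ) :
    hecke ι C δ Φ (b * atP ι g) = ∑ᶠ w ∈ neighbours C δ g, valueAt ι Φ b w := by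
  rw [← image_heckeSet, finsum_mem_image (heckeSet_injOn hC hC' δ g)]
  refine finsum_mem_congr rfl fun σ _ => ?_
  rw [hΦ.valueAt_mk, map_mul, mul_assoc]

end Orbits

/-! ### Coefficients in the group rings -/

section GroupRings

variable {O : Type*} [CommRing O]

lemma coeff_finsum_single {G : Type*} [Finite G] (f : G → O) (x : G) :
    (∑ᶠ t, MonoidAlgebra.single t (f t)).coeff x = f x := by
  classical
  have := Fintype.ofFinite G
  rw [finsum_eq_sum_of_fintype, MonoidAlgebra.coeff_sum, Finsupp.finsetSum_apply]
  simp [MonoidAlgebra.coeff_single, Finsupp.single_apply]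

lemma coeff_mapDomainRingHom {G H : Type*} [Group G] [Group H] [Finite G] (f : G →* H)
    (a : MonoidAlgebra O G) (y : H) :
    (MonoidAlgebra.mapDomainRingHom O f a).coeff y = ∑ᶠ x ∈ {x | f x = y}, a.coeff x := by
  classical
  have := Fintype.ofFinite G
  rw [MonoidAlgebra.mapDomainRingHom_apply, MonoidAlgebra.coeff_mapDomain, Finsupp.mapDomain,
    Finsupp.sum_fintype _ _ (fun _ => Finsupp.single_zero _), Finsupp.finsetSum_apply,
    finsum_mem_def, finsum_eq_sum_of_fintype]
  exact Finset.sum_congr rfl fun x _ => by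
    simp [Finsupp.single_apply, Set.indicator_apply]

variable {F : Type*} [Field F] [NumberField F] {𝔭 : Place F}
  {K : Type*} [Field K] [NumberField K] [Algebra F K]

lemma coeff_xi {j : ℕ} [Finite (Hlev 𝔭 K j)] [Finite (Hlev 𝔭 K (j + 1))]
    (θ : MonoidAlgebra O (Hlev 𝔭 K j)) (x : Hlev 𝔭 K (j + 1)) :
    (xi j θ).coeff x = θ.coeff (proj 𝔭 K j x) := by
  classical
  have := Fintype.ofFinite (Hlev 𝔭 K j)
  have := Fintype.ofFinite (Hlev 𝔭 K (j + 1))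
  have h : ∀ (y : Hlev 𝔭 K j) (c : O),
      (∑ᶠ x ∈ {x | proj 𝔭 K j x = y}, MonoidAlgebra.single x c).coeff x =
        if y = proj 𝔭 K j x then c else 0 := fun y c => by
    rw [finsum_mem_def, finsum_eq_sum_of_fintype, MonoidAlgebra.coeff_sum,
      Finsupp.finsetSum_apply, Finset.sum_eq_single x]
    · by_cases hx : proj 𝔭 K j x = y
      · simp [hx]
      · simp [hx, Ne.symm hx]
    · intro z _ hz
      by_cases hz' : proj 𝔭 K j z = y
      · simp [hz', hz]
      · simp [hz']
    · simp
  rw [xi, MonoidAlgebra.coeff_finsuppSum, Finsupp.sum_fintype, Finsupp.finsetSum_apply]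
  · rw [Finset.sum_congr rfl fun y _ => h y _]
    simp
  · intro y
    refine Finsupp.ext fun x' => ?_
    simp

end GroupRings

/-! ### Measures from compatible systems -/

section Measures

variable {F : Type*} [Field F] [NumberField F] {𝔭 : Place F}
  {K : Type*} [Field K] [NumberField K] [Algebra F K] {O : Type*} [CommRing O]

lemma filtration_mono {i j : ℕ} (h : i ≤ j) : filtration 𝔭 K j ≤ filtration 𝔭 K i :=
  antitone_nat_of_succ_le (fun j => Subgroup.map_mono (localU_antitone 𝔭 K j)) h

/-- `S` is stable under the image of `(1 + 𝔭^j O_{K,𝔭})^×`. -/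
def IsStableAt (j : ℕ) (S : Set (Hinf 𝔭 K)) : Prop :=
  ∀ u ∈ filtration 𝔭 K j, ∀ t ∈ S, t * u ∈ S

lemma IsStableAt.mono {i j : ℕ} (h : i ≤ j) {S : Set (Hinf 𝔭 K)} (hS : IsStableAt i S) :
    IsStableAt j S := fun u hu => hS u (filtration_mono h hu)

/-- The image of `S` in `H_j`. -/
def levelImage (j : ℕ) (S : Set (Hinf 𝔭 K)) : Set (Hlev 𝔭 K j) := QuotientGroup.mk '' S

lemma IsStableAt.mk_mem_iff {j : ℕ} {S : Set (Hinf 𝔭 K)} (hS : IsStableAt j S) (s : Hinf 𝔭 K) :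
    (QuotientGroup.mk s : Hlev 𝔭 K j) ∈ levelImage j S ↔ s ∈ S := by
  refine ⟨?_, fun h => ⟨s, h, rfl⟩⟩
  rintro ⟨r, hr, h⟩
  have := hS _ (QuotientGroup.eq.1 h) r hr
  rwa [mul_inv_cancel_left] at this

lemma levelImage_fibre (j : ℕ) (t : Hlev 𝔭 K j) : levelImage j (fibre 𝔭 K j t).1 = {t} := by
  refine Set.Subset.antisymm ?_ (Set.singleton_subset_iff.2 ?_)
  · rintro _ ⟨s, hs, rfl⟩
    exact hs
  · obtain ⟨s, rfl⟩ := QuotientGroup.mk_surjective t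
    exact ⟨s, rfl, rfl⟩

lemma proj_mk (j : ℕ) (s : Hinf 𝔭 K) :
    proj 𝔭 K j (QuotientGroup.mk s) = QuotientGroup.mk s := rfl

/-- The mass that `φ`, a function on `H_j`, gives to a subset of `H_∞`. -/
def mass {j : ℕ} (φ : Hlev 𝔭 K j → O) (S : Set (Hinf 𝔭 K)) : O :=
  ∑ᶠ t ∈ levelImage j S, φ t

/-- The image in H_{j+1} of a set stable at level j is the disjoint union of the fibres over its
image in H_j. -/
lemma mass_succ {j : ℕ} [Finite (Hlev 𝔭 K j)] [Finite (Hlev 𝔭 K (j + 1))] {φ : Hlev 𝔭 K j → O}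
    {φ' : Hlev 𝔭 K (j + 1) → O} (h : ∀ s, φ s = ∑ᶠ t ∈ {t | proj 𝔭 K j t = s}, φ' t)
    {S : Set (Hinf 𝔭 K)} (hS : IsStableAt j S) : mass φ S = mass φ' S := by
  have hU : levelImage (j + 1) S =
      ⋃ s ∈ levelImage j S, {t | proj 𝔭 K j t = s} := by
    ext t
    obtain ⟨t, rfl⟩ := QuotientGroup.mk_surjective t
    simp [(hS.mono (Nat.le_succ j)).mk_mem_iff, proj_mk, hS.mk_mem_iff]
  rw [mass, mass, hU, finsum_mem_biUnion _ (Set.toFinite _) fun _ _ => Set.toFinite _]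
  · exact finsum_mem_congr rfl fun s _ => h s
  · intro s _ s' _ hss'
    refine Set.disjoint_left.2 fun t ht ht' => hss' ?_
    exact ht.symm.trans ht'

lemma mass_union {j : ℕ} [Finite (Hlev 𝔭 K j)] (φ : Hlev 𝔭 K j → O) {S T : Set (Hinf 𝔭 K)}
    (hS : IsStableAt j S) (hT : IsStableAt j T) (h : Disjoint S T) :
    mass φ (S ∪ T) = mass φ S + mass φ T := by
  rw [mass, levelImage, Set.image_union]
  refine finsum_mem_union (Set.disjoint_left.2 fun t ht ht' => ?_) (Set.toFinite _)
    (Set.toFinite _)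
  obtain ⟨t, rfl⟩ := QuotientGroup.mk_surjective t
  exact Set.disjoint_left.1 h ((hS.mk_mem_iff t).1 ht) ((hT.mk_mem_iff t).1 ht')

/-- The preimage in `H_∞` of a subset of `H_j`. -/
def levelPreimage (j : ℕ) (A : Set (Hlev 𝔭 K j)) : CompactOpen 𝔭 K :=
  ⟨{s | (QuotientGroup.mk s : Hlev 𝔭 K j) ∈ A}, j, fun u hu s hs => by
    have h : (QuotientGroup.mk (s * u) : Hlev 𝔭 K j) = QuotientGroup.mk s :=
      QuotientGroup.mk_mul_of_mem _ hu
    rwa [Set.mem_ofPred_eq, h]⟩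

lemma HMeasure.levelPreimage_eq (μ : HMeasure 𝔭 K O) {j : ℕ} [Finite (Hlev 𝔭 K j)]
    (A : Set (Hlev 𝔭 K j)) :
    μ.1 (levelPreimage j A) = ∑ᶠ t ∈ A, μ.1 (fibre 𝔭 K j t) := by
  induction A, Set.toFinite A using Set.Finite.induction_on with
  | empty =>
    -- Additivity for ∅ = ∅ ∪ ∅ forces the value 0 on the empty set.
    have h := μ.2 (levelPreimage j ∅) (levelPreimage j ∅) (levelPreimage j ∅)
      (Set.union_self _).symm (Set.disjoint_left.2 fun _ h => h.elim)
    rw [finsum_mem_empty]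
    exact left_eq_add.1 h
  | @insert a A ha hA ih =>
    rw [finsum_mem_insert _ ha hA, ← ih]
    refine μ.2 _ _ _ rfl (Set.disjoint_left.2 fun s hs hs' => ha ?_)
    rw [← show (QuotientGroup.mk s : Hlev 𝔭 K j) = a from hs]
    exact hs'

/-- A compatible system of functions on the groups `H_j` defines a unique measure. -/
lemma existsUnique_measure (hfin : ∀ j, Finite (Hlev 𝔭 K j)) (φ : ∀ j, Hlev 𝔭 K j → O) (j₀ : ℕ)
    (h : ∀ j, j₀ ≤ j → ∀ s, φ j s = ∑ᶠ t ∈ {t | proj 𝔭 K j t = s}, φ (j + 1) t) :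
    ∃! μ : HMeasure 𝔭 K O, ∀ j, j₀ ≤ j → ∀ t : Hlev 𝔭 K j, μ.1 (fibre 𝔭 K j t) = φ j t := by
  have hmass : ∀ {i j : ℕ} {S : Set (Hinf 𝔭 K)}, j₀ ≤ i → i ≤ j → IsStableAt i S →
      mass (φ i) S = mass (φ j) S := by
    intro i j S hi hij hS
    induction j, hij using Nat.le_induction with
    | base => rfl
    | succ j hij ih => rw [ih, mass_succ (h j (hi.trans hij)) (hS.mono hij)]
  have hmass' : ∀ {i j : ℕ} {S : Set (Hinf 𝔭 K)}, j₀ ≤ i → j₀ ≤ j → IsStableAt i S →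
      IsStableAt j S → mass (φ i) S = mass (φ j) S := by
    intro i j S hi hj hS hS'
    rw [hmass hi (le_max_left i j) hS, hmass hj (le_max_right i j) hS']
  -- A stability level is chosen for each set and raised to at least `j₀`, where compatibility
  -- begins; by `hmass'` the mass does not depend on this choice.
  choose lev hlev using fun S : CompactOpen 𝔭 K => S.2
  let μ : CompactOpen 𝔭 K → O := fun S => mass (φ (max j₀ (lev S))) S.1
  have hμ : ∀ (S : CompactOpen 𝔭 K) (j : ℕ), j₀ ≤ j → IsStableAt j S.1 → μ S = mass (φ j) S.1 :=
    fun S j hj hS => hmass' (le_max_left _ _) hj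
      (IsStableAt.mono (le_max_right j₀ (lev S)) (hlev S)) hS
  refine ⟨⟨μ, fun S T V hV hST => ?_⟩, fun j hj t => ?_, fun ν hν => ?_⟩
  · have hS : IsStableAt (max j₀ (max (lev S) (lev T))) S.1 :=
      IsStableAt.mono ((le_max_left _ _).trans (le_max_right _ _)) (hlev S)
    have hT : IsStableAt (max j₀ (max (lev S) (lev T))) T.1 :=
      IsStableAt.mono ((le_max_right _ _).trans (le_max_right _ _)) (hlev T)
    rw [hμ S _ (le_max_left _ _) hS, hμ T _ (le_max_left _ _) hT, hμ V _ (le_max_left _ _) ?_, hV,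
      mass_union _ hS hT hST]
    rw [hV]
    exact fun u hu t ht => ht.imp (hS u hu t) (hT u hu t)
  · change μ _ = _
    rw [hμ _ j hj, mass, levelImage_fibre, finsum_mem_singleton]
    intro u hu s hs
    exact (QuotientGroup.mk_mul_of_mem s hu).trans hs
  · refine Subtype.ext (funext fun S => ?_)
    have hS : IsStableAt (max j₀ (lev S)) S.1 := IsStableAt.mono (le_max_right _ _) (hlev S)
    -- Uniqueness: S is a finite disjoint union of fibres at its level, on which the values are
    -- prescribed.
    have h1 : S = levelPreimage (max j₀ (lev S)) (levelImage _ S.1) :=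
      Subtype.ext (Set.ext fun s => (hS.mk_mem_iff s).symm)
    change ν.1 S = mass (φ (max j₀ (lev S))) S.1
    conv_lhs => rw [h1]
    rw [ν.levelPreimage_eq]
    exact finsum_mem_congr rfl fun t _ => hν _ (le_max_left _ _) t

end Measures

/-! ### Distribution relations and the main theorem -/

section Theta

variable {F : Type*} [Field F] [NumberField F] {𝔭 : Place F}
  {K : Type*} [Field K] [NumberField K] [Algebra F K]
  {B : Type*} [Ring B] [Algebra F B] {O : Type*} [CommRing O]
  {ι : Local 𝔭 B ≃ₐ[Fv 𝔭] Matrix (Fin 2) (Fin 2) (Fv 𝔭)} {Ψ : K →ₐ[F] B} {ϖ : (Fv 𝔭)ˣ}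
  {R : Subalgebra (awayFrom 𝔭) B} {Φ : (Adelic F B)ˣ → O}

lemma coeff_theta {C : Subgroup (GL2 𝔭)} {w : ℕ → GL2 𝔭 ⧸ C} {j : ℕ} [Finite (Hlev 𝔭 K j)]
    (t : Hlev 𝔭 K j) : (theta ι Ψ Φ w j).coeff t = phiK ι Ψ Φ w j t :=
  coeff_finsum_single _ t

lemma projRing_theta_eq_iff {C : Subgroup (GL2 𝔭)} {w : ℕ → GL2 𝔭 ⧸ C} {j : ℕ}
    [Finite (Hlev 𝔭 K (j + 1))] {x : MonoidAlgebra O (Hlev 𝔭 K j)} :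
    projRing 𝔭 K O j (theta ι Ψ Φ w (j + 1)) = x ↔
      ∀ s, ∑ᶠ t ∈ {t | proj 𝔭 K j t = s}, phiK ι Ψ Φ w (j + 1) t = x.coeff s := by
  have h : ∀ s, (projRing 𝔭 K O j (theta ι Ψ Φ w (j + 1))).coeff s =
      ∑ᶠ t ∈ {t | proj 𝔭 K j t = s}, phiK ι Ψ Φ w (j + 1) t := fun s => by
    rw [projRing, coeff_mapDomainRingHom]
    exact finsum_mem_congr rfl fun t _ => coeff_theta t
  rw [← MonoidAlgebra.coeff_inj, Finsupp.ext_iff]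
  simp only [h]

/-- The distribution relation for `Φ_{K,j}` on vertices. -/
lemma IsAutomorphicForm.finsum_phiK_vertex (hΦ : IsAutomorphicForm (level ι R (GL2O 𝔭)) Φ)
    (hΨ : IsOptimal R Ψ) (hK : Module.finrank F K = 2) (hϖ : IsUniformizer ϖ) {a : O}
    (ha : heckeT ι ϖ Φ = a • Φ) {v : ℕ → Vertex 𝔭} (hv : IsVertexSequence ι ϖ Ψ v) {j : ℕ}
    (hj : UnitsStable 𝔭 K (j + 1)) (s : Hlev 𝔭 K (j + 1)) :
    ∑ᶠ t ∈ {t | proj 𝔭 K (j + 1) t = s}, phiK ι Ψ Φ v (j + 2) t =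
      a * phiK ι Ψ Φ v (j + 1) s - phiK ι Ψ Φ v j (proj 𝔭 K j s) := by
  have hC : ∀ c, scalarHom 𝔭 (integerUnits 𝔭 c) ∈ GL2O 𝔭 :=
    fun c => iwahori_le (scalarHom_mem_iwahori c)
  have hfix : ∀ (j : ℕ) (u), u ∈ localU 𝔭 K j → torus ι Ψ u • v j = v j :=
    fun j u hu => hv.torus_smul hu
  obtain ⟨s, rfl⟩ := toHlev_surjective (j + 1) s
  obtain ⟨g, hg⟩ := QuotientGroup.mk_surjective (v (j + 1))
  rw [hΦ.finsum_phiK hC hΨ (hv.2 (j + 2)) hj, proj_toHlev, hΦ.phiK_toHlev hC hΨ (hfix _),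
    hΦ.phiK_toHlev hC hΨ (hfix _), ← hg, hΦ.valueAt_mk, eq_sub_iff_add_eq, add_comm]
  -- The eigenvalue equation at the vertex `v (j + 1)`, represented by g. The Hecke sum splits into
  -- the term at `v j` and the orbit of `v (j + 2)`, and the latter is the fibre sum.
  have h := congrFun ha (adelicEmb Ψ s * atP ι g)
  rw [Pi.smul_apply, smul_eq_mul] at h
  rw [← h, heckeT, hΦ.hecke_eq_finsum le_rfl hC, hv.neighbours_eq hK hϖ.valued hg.symm,
    finsum_mem_insert _ (hv.notMem_torusOrbit hK j) (hv.torusOrbit_finite hϖ.valued _)]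

/-- The distribution relation for `Φ_{K,j}` on directed edges. -/
lemma IsAutomorphicForm.finsum_phiK_edge (hΦ : IsAutomorphicForm (level ι R (iwahori 𝔭)) Φ)
    (hΨ : IsOptimal R Ψ) (hK : Module.finrank F K = 2) (hϖ : IsUniformizer ϖ) {α : O}
    (hα : heckeU ι ϖ Φ = α • Φ) {v : ℕ → Vertex 𝔭} (hv : IsVertexSequence ι ϖ Ψ v)
    {e : ℕ → Edge 𝔭} (he : ∀ j, Joins ϖ (e (j + 1)) (v j) (v (j + 1))) {j : ℕ}
    (hj : UnitsStable 𝔭 K (j + 1)) (s : Hlev 𝔭 K (j + 1)) :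
    ∑ᶠ t ∈ {t | proj 𝔭 K (j + 1) t = s}, phiK ι Ψ Φ e (j + 2) t =
      α * phiK ι Ψ Φ e (j + 1) s := by
  have hiff := hv.torus_smul_edge_iff he hϖ.valued
  obtain ⟨s, rfl⟩ := toHlev_surjective (j + 1) s
  obtain ⟨g, hg, hg'⟩ := hv.neighbours_iwahori_eq he hK hϖ.valued j
  rw [hΦ.finsum_phiK scalarHom_mem_iwahori hΨ (hiff (j + 1)) hj,
    hΦ.phiK_toHlev scalarHom_mem_iwahori hΨ fun u hu => (hiff j u).2 (Subgroup.mem_sup_left hu),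
    hg, hΦ.valueAt_mk, ← hg', ← hΦ.hecke_eq_finsum iwahori_le scalarHom_mem_iwahori]
  exact congrFun hα _

end Theta

end QuaternionicTheta

end

open QuaternionicTheta in
theorem mainTheorem8
    {F : Type*} [Field F] [NumberField F] [IsTotallyReal F]
    {K : Type*} [Field K] [NumberField K] [IsTotallyComplex K] [Algebra F K]
    (hK : Module.finrank F K = 2)
    {B : Type*} [Ring B] [Algebra F B] [Algebra.IsCentral F B] [IsSimpleRing B]
    (hB : Module.finrank F B = 4) (hdef : IsTotallyDefinite F B)
    (𝔭 : Place F) (ϖ : (Fv 𝔭)ˣ) (hϖ : IsUniformizer ϖ)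
    (ι : Local 𝔭 B ≃ₐ[Fv 𝔭] Matrix (Fin 2) (Fin 2) (Fv 𝔭))
    (R : Subalgebra (awayFrom 𝔭) B) (hR : IsOrder 𝔭 R)
    (Ψ : K →ₐ[F] B) (hΨ : IsOptimal R Ψ)
    {O : Type*} [CommRing O] :
    -- sequences of vertices
    (∀ (Φ : (Adelic F B)ˣ → O) (a : O) (v : ℕ → Vertex 𝔭),
      IsAutomorphicForm (level ι R (GL2O 𝔭)) Φ → heckeT ι ϖ Φ = a • Φ →
      IsVertexSequence ι ϖ Ψ v →
      (∀ (j : ℕ) (t : (Adelic F K)ˣ) (g : GL2 𝔭), v j = QuotientGroup.mk g →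
        phiK ι Ψ Φ v j (toHlev 𝔭 K j t) = Φ (adelicEmb Ψ t * atP ι g)) ∧
      ∀ j : ℕ, UnitsStable 𝔭 K (j + 1) →
        projRing 𝔭 K O (j + 1) (theta ι Ψ Φ v (j + 2)) =
          a • theta ι Ψ Φ v (j + 1) - xi j (theta ι Ψ Φ v j)) ∧
    -- sequences of directed edges
    (∀ (Φ : (Adelic F B)ˣ → O) (α : O) (e : ℕ → Edge 𝔭),
      IsAutomorphicForm (level ι R (iwahori 𝔭)) Φ → heckeU ι ϖ Φ = α • Φ →
      IsEdgeSequence ι ϖ Ψ e →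
      (∀ (j : ℕ) (t : (Adelic F K)ˣ) (g : GL2 𝔭), 1 ≤ j → e j = QuotientGroup.mk g →
        phiK ι Ψ Φ e j (toHlev 𝔭 K j t) = Φ (adelicEmb Ψ t * atP ι g)) ∧
      (∀ j : ℕ, 1 ≤ j → UnitsStable 𝔭 K j →
        projRing 𝔭 K O j (theta ι Ψ Φ e (j + 1)) = α • theta ι Ψ Φ e j) ∧
      -- the measure in the ordinary case
      ∀ β : O, β * α = 1 → ∀ j₀ : ℕ, 1 ≤ j₀ → (∀ j, j₀ ≤ j → UnitsStable 𝔭 K j) →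
        (∀ j, j₀ ≤ j → projRing 𝔭 K O j (β ^ (j + 1) • theta ι Ψ Φ e (j + 1)) =
          β ^ j • theta ι Ψ Φ e j) ∧
        ∃! μ : HMeasure 𝔭 K O, ∀ j, j₀ ≤ j → ∀ t : Hlev 𝔭 K j,
          μ.1 (fibre 𝔭 K j t) = β ^ j * phiK ι Ψ Φ e j t) := by
  refine ⟨fun Φ a v hΦ ha hv => ?_, fun Φ α e hΦ hα he => ?_⟩
  · have hfin : ∀ j, Finite (Hlev 𝔭 K j) := hv.finite_Hlev hϖ.valued
    refine ⟨fun j t g hg => ?_, fun j hj => ?_⟩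
    · rw [hΦ.phiK_toHlev (fun c => iwahori_le (scalarHom_mem_iwahori c)) hΨ
        fun u hu => hv.torus_smul hu, hg, hΦ.valueAt_mk]
    · refine projRing_theta_eq_iff.2 fun s => ?_
      rw [hΦ.finsum_phiK_vertex hΨ hK hϖ ha hv hj, MonoidAlgebra.coeff_sub, Finsupp.sub_apply,
        MonoidAlgebra.coeff_smul_apply, coeff_xi, coeff_theta, coeff_theta, smul_eq_mul]
  · obtain ⟨v, hv, he⟩ := he
    have hfin : ∀ j, Finite (Hlev 𝔭 K j) := hv.finite_Hlev hϖ.valued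
    have hsum : ∀ j, 1 ≤ j → UnitsStable 𝔭 K j → ∀ s : Hlev 𝔭 K j,
        ∑ᶠ t ∈ {t | proj 𝔭 K j t = s}, phiK ι Ψ Φ e (j + 1) t = α * phiK ι Ψ Φ e j s := by
      intro j hj1 hj
      obtain ⟨j, rfl⟩ := Nat.exists_eq_add_of_le' hj1
      exact hΦ.finsum_phiK_edge hΨ hK hϖ hα hv he hj
    have hsum' : ∀ β : O, β * α = 1 → ∀ j, 1 ≤ j → UnitsStable 𝔭 K j → ∀ s : Hlev 𝔭 K j,
        β ^ j * phiK ι Ψ Φ e j s =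
          ∑ᶠ t ∈ {t | proj 𝔭 K j t = s}, β ^ (j + 1) * phiK ι Ψ Φ e (j + 1) t := by
      intro β hβ j hj1 hj s
      -- The constant leaves the finite sum, and β^(j+1) α = β^j.
      refine Eq.trans ?_ ((AddMonoidHom.mulLeft (β ^ (j + 1))).map_finsum_mem
        (phiK ι Ψ Φ e (j + 1)) (Set.toFinite {t | proj 𝔭 K j t = s}))
      rw [AddMonoidHom.coe_mulLeft, hsum j hj1 hj, pow_succ, mul_assoc, ← mul_assoc β, hβ,
        one_mul]
    have htheta : ∀ j, 1 ≤ j → UnitsStable 𝔭 K j →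
        projRing 𝔭 K O j (theta ι Ψ Φ e (j + 1)) = α • theta ι Ψ Φ e j := by
      intro j hj1 hj
      refine projRing_theta_eq_iff.2 fun s => ?_
      rw [hsum j hj1 hj, MonoidAlgebra.coeff_smul_apply, coeff_theta, smul_eq_mul]
    refine ⟨fun j t g hj hg => ?_, htheta, fun β hβ j₀ hj₀ hst => ⟨fun j hj => ?_, ?_⟩⟩
    · obtain ⟨j, rfl⟩ := Nat.exists_eq_add_of_le' hj
      rw [hΦ.phiK_toHlev scalarHom_mem_iwahori hΨ fun u hu =>
        (hv.torus_smul_edge_iff he hϖ.valued j u).2 (Subgroup.mem_sup_left hu), hg, hΦ.valueAt_mk]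
    · have hsmul : ∀ (c : O) (x : MonoidAlgebra O (Hlev 𝔭 K (j + 1))),
          projRing 𝔭 K O j (c • x) = c • projRing 𝔭 K O j x := fun c x => by
        rw [projRing, MonoidAlgebra.mapDomainRingHom_apply, MonoidAlgebra.mapDomainRingHom_apply,
          MonoidAlgebra.mapDomain_smul]
      rw [hsmul, htheta j (hj₀.trans hj) (hst j hj), smul_smul, pow_succ, mul_assoc, hβ, mul_one]
    · exact existsUnique_measure hfin (fun j t => β ^ j * phiK ι Ψ Φ e j t) j₀ fun j hj =>
        hsum' β hβ j (hj₀.trans hj) (hst j hj)
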